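/- Let $a\in[2\pi/5,\pi/2)$. For a complex-valued $q\in L(a,\pi)$, extended by $q\equiv 0$ on $[0,a)$, and $j=0,1$, let $L_j(q)$ be the boundary value problem $$-y''(x)+q(x)y(x-a)=\lambda y(x),\quad x\in(0,\pi),\qquad y(0)=y^{(j)}(\pi)=0 .$$ Let $Y(x,\lambda)$ be the solution of the equation with $Y(0,\lambda)=0$, $Y'(0,\lambda)=1$, and let $\Delta_j(\lambda)=Y^{(j)}(\pi,\lambda)$ be the characteristic function of $L_j(q)$. Its zeros are the eigenvalues of $L_j(q)$; the multiplicity of an eigenvalue is its order as a zero of $\Delta_j$. The eigenvalues $\lambda_{1j},\lambda_{2j},\dots$ of $L_j(q)$ are repeated according to multiplicity and numbered by nondecreasing modulus. (i) Uniqueness. If $q,\tilde q\in L(a,\pi)$, and for $j=0$ and $j=1$ the problems $L_j(q)$ and $L_j(\tilde q)$ have the same eigenvalues with the same multiplicities, then $q=\tilde q$ almost everywhere on $(a,\pi)$. (ii) Reconstruction. Let in addition $q$ be absolutely continuous on $[a,\pi]$ (so that $q(a)$ below is the value $q(a+0)$). Then the following steps can be carried out, starting from the two sequences $\{\lambda_{nj}\}_{n\ge1}$,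 $j=0,1$; whenever they are carried out, they return $q(x)$ for all $x\in[a,\pi]$. 1. Put $\Delta_0(\lambda)=\pi\prod_{n=1}^\infty\frac{\lambda_{n0}-\lambda}{n^2}$, $\Delta_1(\lambda)=\prod_{n=1}^\infty\frac{\lambda_{n1}-\lambda}{(n-1/2)^2}$; these are the characteristic functions. 2. Find $A_0$ from either one of $\sqrt{\lambda_{n0}}=n+\frac{A_0\cos na}{2\pi n}+o(\frac1n)$, $\sqrt{\lambda_{n1}}=n-\frac12+\frac{A_0\cos (n-1/2)a}{2\pi n}+o(\frac1n)$, $n\to\infty$ (principal square root); here $A_0=\int_a^\pi q(t)\,dt$. 3. Put $\Delta_0^*(\rho)=2\rho^2\bigl(\Delta_0(\rho^2)-\frac{\sin\rho\pi}{\rho}+A_0\frac{\cos\rho(\pi-a)}{2\rho^2}\bigr)$, $\Delta_1^*(\rho)=2\rho\bigl(\Delta_1(\rho^2)-\cos\rho\pi-A_0\frac{\sin\rho(\pi-a)}{2\rho}\bigr)$, $\rho\in\mathbb C$ (multiplied out, so that $\rho=0$ is included). 4. Find $A,B_1,B_2$ such that, as $\rho\to+\infty$, $$4\rho\Delta_0^*(\rho)=B_1\sin\rho(\pi-a)-2A\sin\rho(\pi-2a)+o(1),\quad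 4\rho\Delta_1^*(\rho)=B_2\cos\rho(\pi-a)-2A\cos\rho(\pi-2a)+o(1);$$ here $A=\int_{2a}^\pi q(t)\int_a^{t-a}q(s)\,ds\,dt$, $B_1=2(q(a)+q(\pi))$, $B_2=2(q(a)-q(\pi))$. Put $q(a)=(B_1+B_2)/4$, $q(\pi)=(B_1-B_2)/4$. 5. Put $d_0(\rho)=4\rho\Delta_0^*(\rho)-B_1\sin\rho(\pi-a)+2A\sin\rho(\pi-2a)$, $d_1(\rho)=4\rho\Delta_1^*(\rho)-B_2\cos\rho(\pi-a)+2A\cos\rho(\pi-2a)$. 6. Find the integrable function $R$ on $(-(\pi-a),\pi-a)$ with $d_0(\rho)=-\int_{-(\pi-a)}^{\pi-a}R(\xi)\sin\rho\xi\,d\xi$ and $d_1(\rho)=\int_{-(\pi-a)}^{\pi-a}R(\xi)\cos\rho\xi\,d\xi$ for all $\rho\in\mathbb C$; here, for almost every $\xi$, $R(\xi)=q'(\xi/2+\pi/2+a/2)-Q(\xi)$, where $Q(\xi)=0$ for $|\xi|\ge\pi-2a$ and, for $|\xi|<\pi-2a$, with $x=\xi/2+\pi/2$, $$Q(\xi)=q(x+a)\int_a^{x}q(s)\,ds-q(x)\int_{x+a}^\pi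 q(s)\,ds-\int_{x+a}^\pi q(s)q(s-x)\,ds .$$ 7. Put $q_0(\xi)=R(\xi)$ for $\xi\in(-(\pi-a),-(\pi-2a))\cup(\pi-2a,\pi-a)$. 8. Put $q_1(x)=q_0(2x-\pi-a)$ for $x\in(a,3a/2)\cup(\pi-a/2,\pi)$. 9. Put $q(x)=q(a)+\int_a^xq_1(t)\,dt$ for $x\in[a,3a/2)$ and $q(x)=q(\pi)-\int_x^\pi q_1(t)\,dt$ for $x\in(\pi-a/2,\pi]$. 10. For $x\in(3a/2,\pi-a/2)$ put $$q_1(x)=R(2x-\pi-a)+q(x+\tfrac a2)\int_a^{x-a/2}q(s)\,ds-q(x-\tfrac a2)\int_{x+a/2}^\pi q(s)\,ds-\int_{x+a/2}^\pi q(s)q(s-x+\tfrac a2)\,ds .$$ 11. Put $q(x)=q(a)+\int_a^xq_1(t)\,dt$ for $x\in[3a/2,\pi-a/2]$. -/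

import Mathlib

open Real Set Filter Topology MeasureTheory

/-- Admissible potentials for the delay `a`: complex-valued, integrable on `(a, π)` and
zero on `[0, a)`. -/
structure IsPotential (a : ℝ) (q : ℝ → ℂ) : Prop where
  integrable : IntegrableOn q (Ioo a π)
  zero : ∀ x ∈ Ico 0 a, q x = 0

/-- `y` solves `-y''(x) + q(x) y(x - a) = μ y(x)` on `(0, π)` with derivative `y' = dy`, in the
sense of Carathéodory: `y` is continuously differentiable on `[0, π]`, `y'` is absolutely
continuous and the equation holds almost everywhere (the second and the third requirement are
written in the equivalent integrated form). As `q` vanishes on `[0, a)`, the values of `y` at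
negative points play no role. -/
structure IsSolution (a : ℝ) (q : ℝ → ℂ) (μ : ℂ) (y dy : ℝ → ℂ) : Prop where
  hasDeriv : ∀ x ∈ Icc 0 π, HasDerivWithinAt y (dy x) (Icc 0 π) x
  equation : ∀ x ∈ Icc 0 π, dy x = dy 0 + ∫ t in (0 : ℝ)..x, (q t * y (t - a) - μ * y t)

/-- `μ` is an eigenvalue of the boundary value problem `L_j(q)`, `j = 0, 1`: the equation has a
solution with `y(0) = y^{(j)}(π) = 0` that is not identically zero. -/
def IsEigenvalue (a : ℝ) (q : ℝ → ℂ) (j : Fin 2) (μ : ℂ) : Prop :=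
  ∃ y dy : ℝ → ℂ, IsSolution a q μ y dy ∧ y 0 = 0 ∧ ![y, dy] j π = 0 ∧ ∃ x ∈ Icc 0 π, y x ≠ 0

/-- The pair `(Y(·, μ), Y'(·, μ))`, where `Y` is the solution with `Y(0, μ) = 0`, `Y'(0, μ) = 1`
(for an admissible potential it exists and is unique on `[0, π]`). -/
noncomputable def fundamentalSolution (a : ℝ) (q : ℝ → ℂ) (μ : ℂ) : (ℝ → ℂ) × (ℝ → ℂ) :=
  Classical.epsilon fun p => IsSolution a q μ p.1 p.2 ∧ p.1 0 = 0 ∧ p.2 0 = 1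

/-- The characteristic function `Δ_j(μ) = Y^{(j)}(π, μ)` of `L_j(q)`. -/
noncomputable def characteristicFn (a : ℝ) (q : ℝ → ℂ) (j : Fin 2) (μ : ℂ) : ℂ :=
  ![(fundamentalSolution a q μ).1, (fundamentalSolution a q μ).2] j π

open Classical in
/-- The multiplicity of `μ` as an eigenvalue of `L_j(q)`, i.e. the order of `μ` as a zero of the
characteristic function; it is `0` if `μ` is not an eigenvalue. -/
noncomputable def eigenvalueMultiplicity (a : ℝ) (q : ℝ → ℂ) (j : Fin 2) (μ : ℂ) : ℕ∞ :=
  if IsEigenvalue a q j μ then analyticOrderAt (characteristicFn a q j) μ else 0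

/-- `lam 0, lam 1, …` are the eigenvalues `λ_{1j}, λ_{2j}, …` of `L_j(q)`, repeated according to
multiplicity and numbered by nondecreasing modulus. So `lam n` stands for `λ_{n+1,j}`. -/
structure IsSpectrum (a : ℝ) (q : ℝ → ℂ) (j : Fin 2) (lam : ℕ → ℂ) : Prop where
  mono : Monotone fun n => ‖lam n‖
  multiplicity : ∀ μ : ℂ, {n | lam n = μ}.encard = eigenvalueMultiplicity a q j μ

/-- The function `Q(ξ)`, `|ξ| < π - 2a`, continued by zero, where
`Q(ξ) = Q₁(ξ/2 + π/2 + a) - Q₂(ξ/2 + π/2) - Q₃(ξ/2 + π/2)`,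
`Q₁(x) = q(x) ∫_a^{x-a} q(s) ds`, `Q₂(x) = q(x) ∫_{x+a}^π q(s) ds`,
`Q₃(x) = ∫_{x+a}^π q(s) q(s-x) ds`. -/
noncomputable def quadraticPart (a : ℝ) (q : ℝ → ℂ) (ξ : ℝ) : ℂ :=
  if |ξ| < π - 2 * a then
    q (ξ / 2 + π / 2 + a) * (∫ s in a..(ξ / 2 + π / 2 + a) - a, q s)
      - q (ξ / 2 + π / 2) * (∫ s in (ξ / 2 + π / 2) + a..π, q s)
      - ∫ s in (ξ / 2 + π / 2) + a..π, q s * q (s - (ξ / 2 + π / 2))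
  else 0

/-- A complete run of the reconstruction algorithm, with input the two sequences
`lam 0 = {λ_{n0}}`, `lam 1 = {λ_{n1}}` (and the known delay `a`) and output `q`. The data fields
are the quantities computed on the way, the other fields say how each of them is obtained from
the earlier ones. In the second step either spectrum may be used; `i` is the one that is used. -/
structure ReconstructionRun (a : ℝ) (lam : Fin 2 → ℕ → ℂ) (i : Fin 2) where
  Δ₀ : ℂ → ℂ
  Δ₁ : ℂ → ℂ
  A₀ : ℂ
  Δs₀ : ℂ → ℂ
  Δs₁ : ℂ → ℂ
  A : ℂ
  B₁ : ℂ
  B₂ : ℂ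
  q_a : ℂ
  q_pi : ℂ
  d₀ : ℂ → ℂ
  d₁ : ℂ → ℂ
  R : ℝ → ℂ
  q₀ : ℝ → ℂ
  q₁ : ℝ → ℂ
  q : ℝ → ℂ
  /-- The characteristic functions as infinite products
  `Δ₀(μ) = π ∏ (λ_{n0} - μ) / n²`, `Δ₁(μ) = ∏ (λ_{n1} - μ) / (n - 1/2)²`, `n ≥ 1`. -/
  product₀ : ∀ μ : ℂ, Tendsto
    (fun N : ℕ => (π : ℂ) * ∏ n ∈ Finset.range N, (lam 0 n - μ) / ((n : ℂ) + 1) ^ 2)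
    atTop (𝓝 (Δ₀ μ))
  product₁ : ∀ μ : ℂ, Tendsto
    (fun N : ℕ => ∏ n ∈ Finset.range N, (lam 1 n - μ) / ((n : ℂ) + 1 / 2) ^ 2)
    atTop (𝓝 (Δ₁ μ))
  /-- The constant `A₀` from the asymptotics of the eigenvalues, with `m = n` if `i = 0` and
  `m = n - 1/2` if `i = 1`: `√λ_{ni} = m + A₀ cos (m a) / (2πn) + o(1/n)`. -/
  asymptotics :
    (fun n : ℕ => (lam i n) ^ (1 / 2 : ℂ) - (((n : ℂ) + (![1, 1 / 2] i : ℂ))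
        + A₀ * Complex.cos (((n : ℂ) + (![1, 1 / 2] i : ℂ)) * a) / (2 * π * ((n : ℂ) + 1))))
      =o[atTop] fun n : ℕ => 1 / ((n : ℝ) + 1)
  /-- `Δ*₀(ρ) = 2ρ² (Δ₀(ρ²) - sin ρπ / ρ + A₀ cos ρ(π-a) / (2ρ²))`, multiplied out. -/
  star₀ : ∀ ρ : ℂ, Δs₀ ρ = 2 * ρ ^ 2 * Δ₀ (ρ ^ 2) - 2 * ρ * Complex.sin (ρ * π)
    + A₀ * Complex.cos (ρ * (π - a))
  /-- `Δ*₁(ρ) = 2ρ (Δ₁(ρ²) - cos ρπ - A₀ sin ρ(π-a) / (2ρ))`, multiplied out. -/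
  star₁ : ∀ ρ : ℂ, Δs₁ ρ = 2 * ρ * Δ₁ (ρ ^ 2) - 2 * ρ * Complex.cos (ρ * π)
    - A₀ * Complex.sin (ρ * (π - a))
  /-- The constants `A, B₁, B₂` from the leading terms of `4ρΔ*_j(ρ)` as `ρ → +∞`. -/
  leading₀ : Tendsto (fun ρ : ℝ => 4 * (ρ : ℂ) * Δs₀ ρ
      - (B₁ * Complex.sin (ρ * (π - a)) - 2 * A * Complex.sin (ρ * (π - 2 * a)))) atTop (𝓝 0)
  leading₁ : Tendsto (fun ρ : ℝ => 4 * (ρ : ℂ) * Δs₁ ρ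
      - (B₂ * Complex.cos (ρ * (π - a)) - 2 * A * Complex.cos (ρ * (π - 2 * a)))) atTop (𝓝 0)
  q_a_eq : q_a = (B₁ + B₂) / 4
  q_pi_eq : q_pi = (B₁ - B₂) / 4
  d₀_eq : ∀ ρ : ℂ, d₀ ρ = 4 * ρ * Δs₀ ρ - B₁ * Complex.sin (ρ * (π - a))
    + 2 * A * Complex.sin (ρ * (π - 2 * a))
  d₁_eq : ∀ ρ : ℂ, d₁ ρ = 4 * ρ * Δs₁ ρ - B₂ * Complex.cos (ρ * (π - a))
    + 2 * A * Complex.cos (ρ * (π - 2 * a))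
  /-- `R` by inversion of the sine and cosine transforms. -/
  R_integrable : IntegrableOn R (Ioo (-(π - a)) (π - a))
  sine : ∀ ρ : ℂ, d₀ ρ = -∫ ξ in -(π - a)..(π - a), R ξ * Complex.sin (ρ * ξ)
  cosine : ∀ ρ : ℂ, d₁ ρ = ∫ ξ in -(π - a)..(π - a), R ξ * Complex.cos (ρ * ξ)
  /-- The derivative `q₁` and then `q` itself on the two outer intervals. -/
  q₀_outer : ∀ ξ ∈ Ioo (-(π - a)) (-(π - 2 * a)) ∪ Ioo (π - 2 * a) (π - a), q₀ ξ = R ξ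
  q₁_outer : ∀ x ∈ Ioo a (3 * a / 2) ∪ Ioo (π - a / 2) π, q₁ x = q₀ (2 * x - π - a)
  q_left : ∀ x ∈ Ico a (3 * a / 2), q x = q_a + ∫ t in a..x, q₁ t
  q_right : ∀ x ∈ Ioc (π - a / 2) π, q x = q_pi - ∫ t in x..π, q₁ t
  /-- The derivative `q₁` and then `q` itself on the middle interval. -/
  q₁_middle : ∀ x ∈ Ioo (3 * a / 2) (π - a / 2),
    q₁ x = R (2 * x - π - a) + q (x + a / 2) * (∫ s in a..(x - a / 2), q s)
      - q (x - a / 2) * (∫ s in (x + a / 2)..π, q s)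
      - ∫ s in (x + a / 2)..π, q s * q (s - x + a / 2)
  q_middle : ∀ x ∈ Icc (3 * a / 2) (π - a / 2), q x = q_a + ∫ t in a..x, q₁ t

/-!
Write `μ = ρ²`, and let `w` be the potential continued by zero outside `(a, π)`. Since `3a ≥ π`,
the method of steps stops after two iterations, so that `Y(·, ρ²)` (`solY`) is a polynomial of
degree two in `w`, and `Δ_j` is entire (`differentiable_characteristicFn`). Uniqueness for the
Cauchy problem identifies the eigenvalues with the zeros of `Δ_j` (`isEigenvalue_iff`).

Everything rests on the identity `sol_identity`. Up to explicit exponentials with the coefficients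
`A₀` and `A`, the combination `-8ρ² (Y'(π) - iρY(π) - e^{-iρπ})` is the Fourier transform of the
quadratic part `Q` plus `4iρ` times that of the rescaled potential, both over `(-(π - a), π - a)`.
Replacing `ρ` by `-ρ` separates `Δ₁` from `Δ₀`. With the Riemann–Lebesgue lemma the identity yields
the asymptotics of `Δ_j`, on large circles in the plane and along sequences that approach the real
axis.

Uniqueness. Two characteristic functions with the same zeros have an entire quotient without zeros,
which tends to `1` on large circles, and so they coincide
(`characteristicFn_eq_of_multiplicity_eq`). By the identity, the difference of the two potentials
is then a primitive of the difference of the quadratic parts plus a point mass. For `|ξ| > π - 2a`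
this primitive vanishes, which means that the potentials agree near both ends of the interval. As
`5a ≥ 2π`, the quadratic part only involves the values of the potential there
(`quadraticPart_ae_eq`), so it is the same for both, and the potentials agree everywhere
(`cutoff_ae_eq`).

Reconstruction. Rouché's theorem (`IsZeroSeq.ncard_eq`) shows that large discs contain as many
eigenvalues as for the zero potential. So each large eigenvalue is near its counterpart, and the
asymptotics of `Δ_j` then give those of the eigenvalues. The constant `A₀` can be read off because
`cos (n a)` does not tend to zero. For the product formula, the maximum principle is applied to the
quotient of the cofactors that remain after the zeros in a large disc are split off from `Δ_j` and
from the characteristic function of the zero potential (`exists_prod_ratio`), for which the formula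
is Euler's product. If `q` is absolutely continuous, an integration by parts turns the identity
into the representation of `4ρΔ_j*` with the density `R` (`four_mul_starZero`, `four_mul_starOne`).
The leading terms are unique because sine waves of different frequencies cannot cancel
asymptotically, and `R` is unique by Fourier inversion. Since `Q` vanishes for `|ξ| ≥ π - 2a`, the
function `R` gives `q'` near the ends, hence `q` there; for `5a ≥ 2π` this determines `Q`, and with
it `q'` on the middle interval.
-/

namespace DelayInverse

/-! ### Exponentials and Fourier transforms -/

open scoped ContDiff

/-- The exponential `e^{iρx}` with complex frequency `ρ`. -/
noncomputable def wave (ρ : ℂ) (x : ℝ) : ℂ := Complex.exp (Complex.I * ρ * x)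

lemma wave_add (ρ : ℂ) (x y : ℝ) : wave ρ (x + y) = wave ρ x * wave ρ y := by
  simp only [wave, ← Complex.exp_add]
  push_cast
  ring_nf

@[simp] lemma wave_zero (x : ℝ) : wave 0 x = 1 := by simp [wave]

lemma wave_neg (ρ : ℂ) (x : ℝ) : wave (-ρ) x = wave ρ (-x) := by
  simp only [wave, Complex.ofReal_neg]
  ring_nf

lemma continuous_wave (ρ : ℂ) : Continuous (wave ρ) := by
  unfold wave
  fun_prop

lemma differentiable_wave (x : ℝ) : Differentiable ℂ fun ρ => wave ρ x := by
  simp only [wave]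
  fun_prop

lemma hasDerivAt_wave (ρ : ℂ) (x : ℝ) :
    HasDerivAt (wave ρ) (Complex.I * ρ * wave ρ x) x := by
  have h : HasDerivAt (fun z : ℂ => Complex.exp (Complex.I * ρ * z))
      (Complex.exp (Complex.I * ρ * x) * (Complex.I * ρ * 1)) (x : ℂ) :=
    ((hasDerivAt_id (x : ℂ)).const_mul (Complex.I * ρ)).cexp
  exact h.comp_ofReal.congr_deriv (by rw [wave]; ring)

lemma wave_eq_cos_add_sin (ρ : ℂ) (x : ℝ) :
    wave ρ x = Complex.cos (ρ * x) + Complex.I * Complex.sin (ρ * x) := by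
  rw [wave, mul_comm Complex.I (Complex.sin _), ← Complex.exp_mul_I]
  ring_nf

lemma norm_wave (ρ : ℂ) (x : ℝ) : ‖wave ρ x‖ = Real.exp (-(ρ.im * x)) := by
  rw [wave, Complex.norm_exp]
  simp

lemma norm_wave_le (ρ : ℂ) {x b : ℝ} (h : |x| ≤ b) : ‖wave ρ x‖ ≤ Real.exp (b * |ρ.im|) := by
  rw [norm_wave]
  apply Real.exp_le_exp.2
  calc -(ρ.im * x) ≤ |ρ.im * x| := neg_le_abs _
    _ = |x| * |ρ.im| := by rw [abs_mul, mul_comm]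
    _ ≤ b * |ρ.im| := by gcongr

lemma norm_wave_ofReal (ρ x : ℝ) : ‖wave ρ x‖ = 1 := by simp [norm_wave]

lemma intervalIntegrable_mul_wave {w : ℝ → ℂ} {α β : ℝ} (hw : IntervalIntegrable w volume α β)
    (ρ : ℂ) : IntervalIntegrable (fun x => w x * wave ρ x) volume α β :=
  hw.mul_continuousOn (continuous_wave ρ).continuousOn

lemma norm_integral_mul_wave_le {w : ℝ → ℂ} {α β b : ℝ} (hαβ : α ≤ β)
    (hw : IntervalIntegrable w volume α β) (hα : -b ≤ α) (hβ : β ≤ b) (ρ : ℂ) :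
    ‖∫ x in α..β, w x * wave ρ x‖ ≤ (∫ x in α..β, ‖w x‖) * Real.exp (b * |ρ.im|) := by
  rw [← intervalIntegral.integral_mul_const]
  apply intervalIntegral.norm_integral_le_of_norm_le hαβ
  · refine ae_of_all _ fun x hx => ?_
    rw [norm_mul]
    gcongr
    exact norm_wave_le ρ (abs_le.2 ⟨by linarith [hx.1], by linarith [hx.2]⟩)
  · exact hw.norm.mul_const _

/-- The Riemann-Lebesgue lemma on an interval, along real frequencies perturbed by complex
numbers that tend to `0`. -/
lemma tendsto_integral_mul_wave {ι : Type*} {l : Filter ι} {w : ℝ → ℂ} {α β : ℝ} (hαβ : α ≤ β)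
    (hw : IntervalIntegrable w volume α β) {m : ι → ℝ} (hm : Tendsto m l (cocompact ℝ))
    {ε : ι → ℂ} (hε : Tendsto ε l (𝓝 0)) :
    Tendsto (fun i => ∫ x in α..β, w x * wave (m i + ε i) x) l (𝓝 0) := by
  have h1 : Tendsto (fun i => ∫ x in α..β, w x * wave (m i) x) l (𝓝 0) := by
    have h := Real.tendsto_integral_exp_smul_cocompact ((Ioc α β).indicator w)
    have h2 : Tendsto (fun i => -(m i) / (2 * π)) l (cocompact ℝ) := by
      have hc : (-(2 * π)⁻¹ : ℝ) ≠ 0 := by simp [pi_ne_zero]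
      have := (Homeomorph.mulLeft₀ _ hc).isClosedEmbedding.tendsto_cocompact.comp hm
      refine this.congr fun i => ?_
      simp [div_eq_mul_inv, mul_comm]
    refine (h.comp h2).congr fun i => ?_
    rw [intervalIntegral.integral_of_le hαβ, ← integral_indicator measurableSet_Ioc]
    refine integral_congr_ae (ae_of_all _ fun x => ?_)
    simp only [indicator]
    split_ifs
    · rw [Circle.smul_def, Real.fourierChar_apply, smul_eq_mul, mul_comm, wave]
      congr 2
      push_cast
      field_simp
    · simp
  have h2 : Tendsto (fun i => ∫ x in α..β, w x * wave (m i) x * (wave (ε i) x - 1)) l (𝓝 0) := by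
    obtain ⟨b, hb0, hb⟩ : ∃ b : ℝ, 0 < b ∧ ∀ x ∈ Ioc α β, |x| ≤ b :=
      ⟨|α| + |β| + 1, by positivity, fun x hx => abs_le.2
        ⟨by linarith [neg_abs_le α, abs_nonneg β, hx.1],
          by linarith [le_abs_self β, abs_nonneg α, hx.2]⟩⟩
    have key : ∀ᶠ i in l, ‖∫ x in α..β, w x * wave (m i) x * (wave (ε i) x - 1)‖
        ≤ (∫ x in α..β, ‖w x‖) * (2 * (‖ε i‖ * b)) := by
      have hs : ∀ᶠ i in l, ‖ε i‖ * b ≤ 1 := by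
        have : Tendsto (fun i => ‖ε i‖ * b) l (𝓝 0) := by
          simpa using hε.norm.mul_const b
        exact this.eventually_le_const one_pos
      filter_upwards [hs] with i hi
      rw [← intervalIntegral.integral_mul_const]
      apply intervalIntegral.norm_integral_le_of_norm_le hαβ
      · refine ae_of_all _ fun x hx => ?_
        rw [norm_mul, norm_mul, norm_wave_ofReal, mul_one]
        gcongr
        have hz : ‖Complex.I * ε i * x‖ ≤ ‖ε i‖ * b := by
          simp only [norm_mul, Complex.norm_I, one_mul, Complex.norm_real, Real.norm_eq_abs]
          gcongr
          exact hb x hx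
        calc ‖wave (ε i) x - 1‖ ≤ 2 * ‖Complex.I * ε i * x‖ :=
              Complex.norm_exp_sub_one_le (hz.trans hi)
          _ ≤ _ := by gcongr
      · exact hw.norm.mul_const _
    refine squeeze_zero_norm' key ?_
    have : Tendsto (fun i => (∫ x in α..β, ‖w x‖) * (2 * (‖ε i‖ * b))) l
        (𝓝 ((∫ x in α..β, ‖w x‖) * (2 * (‖(0 : ℂ)‖ * b)))) :=
      ((hε.norm.mul_const b).const_mul 2).const_mul _
    simpa using this
  have h3 := h1.add h2
  rw [add_zero] at h3
  refine h3.congr fun i => ?_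
  have hi : IntervalIntegrable (fun x => w x * wave (m i) x * (wave (ε i) x - 1)) volume α β :=
    (intervalIntegrable_mul_wave hw _).mul_continuousOn
      ((continuous_wave _).sub continuous_const).continuousOn
  rw [← intervalIntegral.integral_add (intervalIntegrable_mul_wave hw _) hi]
  refine intervalIntegral.integral_congr fun x _ => ?_
  simp only [wave, mul_add, add_mul, Complex.exp_add]
  ring

lemma tendsto_integral_mul_wave_atTop {w : ℝ → ℂ} {α β : ℝ} (hαβ : α ≤ β)
    (hw : IntervalIntegrable w volume α β) :
    Tendsto (fun ρ : ℝ => ∫ x in α..β, w x * wave ρ x) atTop (𝓝 0) := by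
  simpa using tendsto_integral_mul_wave hαβ hw
    (tendsto_id.mono_right (by rw [cocompact_eq_atBot_atTop]; exact le_sup_right))
    (tendsto_const_nhds (x := (0 : ℂ)) (f := atTop))

/-- Injectivity of the Fourier transform on integrable functions on an interval. -/
lemma ae_eq_zero_of_integral_mul_wave_eq_zero {w : ℝ → ℂ} {α β : ℝ} (hαβ : α ≤ β)
    (hw : IntervalIntegrable w volume α β)
    (h : ∀ ρ : ℝ, ∫ x in α..β, w x * wave ρ x = 0) :
    ∀ᵐ x ∂(volume.restrict (Ioc α β)), w x = 0 := by
  set f : ℝ → ℂ := (Ioc α β).indicator w with hf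
  have hfi : Integrable f := by
    rw [hf, integrable_indicator_iff measurableSet_Ioc]
    exact (intervalIntegrable_iff_integrableOn_Ioc_of_le hαβ).1 hw
  have hF : FourierTransform.fourier f = 0 := by
    funext v
    rw [Real.fourier_real_eq_integral_exp_smul]
    have := h (-2 * π * v)
    rw [intervalIntegral.integral_of_le hαβ, ← integral_indicator measurableSet_Ioc] at this
    rw [Pi.zero_apply, ← this]
    refine integral_congr_ae (ae_of_all _ fun x => ?_)
    simp only [hf, indicator]
    split_ifs
    · rw [smul_eq_mul, mul_comm, wave]
      congr 2
      push_cast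
      ring
    · simp
  have h0 : ∀ᵐ x ∂(volume : Measure ℝ), f x = 0 := by
    refine ae_eq_zero_of_integral_contDiff_smul_eq_zero hfi.locallyIntegrable fun g hg hgc => ?_
    have hgc' : HasCompactSupport fun x => (g x : ℂ) := hgc.comp_left (g := fun r : ℝ => (r : ℂ)) rfl
    have hg' : ContDiff ℝ ∞ fun x => (g x : ℂ) := Complex.ofRealCLM.contDiff.comp hg
    let φ : SchwartzMap ℝ ℂ := hgc'.toSchwartzMap hg'
    obtain ⟨ψ, hψ⟩ : ∃ ψ : SchwartzMap ℝ ℂ, FourierTransform.fourier ψ = φ :=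
      ⟨FourierTransformInv.fourierInv φ, FourierTransform.fourier_fourierInv_eq φ⟩
    have key := VectorFourier.integral_fourierIntegral_smul_eq_flip (L := innerₗ ℝ)
      Real.continuous_fourierChar continuous_inner (f := f) (g := ψ) (μ := volume) (ν := volume) hfi
      ψ.integrable
    have e1 : VectorFourier.fourierIntegral Real.fourierChar volume (innerₗ ℝ).flip ψ
        = FourierTransform.fourier (ψ : ℝ → ℂ) := by
      rw [flip_innerₗ]
      rfl
    rw [e1, ← SchwartzMap.fourier_coe, hψ] at key
    have e2 : VectorFourier.fourierIntegral Real.fourierChar volume (innerₗ ℝ) f = 0 := hF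
    rw [e2] at key
    simp only [Pi.zero_apply, zero_smul, integral_zero] at key
    rw [key]
    refine integral_congr_ae (ae_of_all _ fun x => ?_)
    change g x • f x = f x • (g x : ℂ)
    rw [Complex.real_smul, smul_eq_mul, mul_comm]
  rw [ae_restrict_iff' measurableSet_Ioc]
  filter_upwards [h0] with x hx hxm
  simpa [hf, indicator_of_mem hxm] using hx

/-! ### Integrals over triangles and integrals with a parameter -/

/-- Fubini's theorem on the triangle `α < t ≤ x ≤ β`. -/
lemma triangle_fubini {α β : ℝ} (hαβ : α ≤ β) {F : ℝ → ℝ → ℂ}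
    (hF : IntegrableOn (Function.uncurry F) (Ioc α β ×ˢ Ioc α β)) :
    IntervalIntegrable (fun x => ∫ t in α..x, F x t) volume α β ∧
    IntervalIntegrable (fun t => ∫ x in t..β, F x t) volume α β ∧
    ∫ x in α..β, (∫ t in α..x, F x t) = ∫ t in α..β, ∫ x in t..β, F x t := by
  set μ : Measure ℝ := volume.restrict (Ioc α β) with hμ
  set G : ℝ → ℝ → ℂ := fun x t => (Iic x).indicator (F x) t with hG
  have hGi : Integrable (Function.uncurry G) (μ.prod μ) := by
    have : Function.uncurry G = {p : ℝ × ℝ | p.2 ≤ p.1}.indicator (Function.uncurry F) := by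
      ext ⟨x, t⟩
      simp [hG, indicator]
    rw [this, hμ, Measure.prod_restrict]
    exact Integrable.indicator hF (measurableSet_le measurable_snd measurable_fst)
  have h1 : ∀ x ∈ Ioc α β, ∫ t, G x t ∂μ = ∫ t in α..x, F x t := fun x hx => by
    rw [intervalIntegral.integral_of_le hx.1.le, integral_indicator measurableSet_Iic, hμ,
      Measure.restrict_restrict measurableSet_Iic]
    congr 2
    ext t
    simp only [mem_inter_iff, mem_Iic, mem_Ioc]
    exact ⟨fun h => ⟨h.2.1, h.1⟩, fun h => ⟨h.2, h.1, h.2.trans hx.2⟩⟩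
  have h2 : ∀ t ∈ Ioc α β, ∫ x, G x t ∂μ = ∫ x in t..β, F x t := fun t ht => by
    have : (fun x => G x t) = (Ici t).indicator fun x => F x t := by
      ext x
      simp [hG, indicator]
    rw [intervalIntegral.integral_of_le ht.2, this, integral_indicator measurableSet_Ici, hμ,
      Measure.restrict_restrict measurableSet_Ici, ← integral_Icc_eq_integral_Ioc]
    congr 2
    ext x
    simp only [mem_inter_iff, mem_Ici, mem_Ioc, mem_Icc]
    exact ⟨fun h => ⟨h.1, h.2.2⟩, fun h => ⟨h.1, ht.1.trans_le h.1, h.2⟩⟩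
  have a1 : (fun x => ∫ t, G x t ∂μ) =ᵐ[μ] fun x => ∫ t in α..x, F x t := by
    filter_upwards [ae_restrict_mem measurableSet_Ioc] with x hx using h1 x hx
  have a2 : (fun t => ∫ x, G x t ∂μ) =ᵐ[μ] fun t => ∫ x in t..β, F x t := by
    filter_upwards [ae_restrict_mem measurableSet_Ioc] with x hx using h2 x hx
  refine ⟨?_, ?_, ?_⟩
  · rw [intervalIntegrable_iff_integrableOn_Ioc_of_le hαβ]
    exact hGi.integral_prod_left.congr a1
  · rw [intervalIntegrable_iff_integrableOn_Ioc_of_le hαβ]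
    exact hGi.integral_prod_right.congr a2
  · rw [intervalIntegral.integral_of_le hαβ, intervalIntegral.integral_of_le hαβ,
      ← integral_congr_ae a1, ← integral_congr_ae a2]
    exact integral_integral_swap hGi

lemma integrableOn_square_mul {α β : ℝ} {w : ℝ → ℂ} (hαβ : α ≤ β)
    (hw : IntervalIntegrable w volume α β) {k : ℝ → ℝ → ℂ} (hk : Continuous (Function.uncurry k)) :
    IntegrableOn (Function.uncurry fun x t => w t * k x t) (Ioc α β ×ˢ Ioc α β) := by
  have hw' : IntegrableOn w (Icc α β) := (intervalIntegrable_iff_integrableOn_Icc_of_le hαβ).1 hw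
  have h1 : IntegrableOn (fun p : ℝ × ℝ => w p.2) (Icc α β ×ˢ Icc α β) := by
    rw [IntegrableOn, Measure.volume_eq_prod, ← Measure.prod_restrict]
    exact hw'.comp_snd _
  exact (h1.mul_continuousOn hk.continuousOn (isCompact_Icc.prod isCompact_Icc)).mono_set
    (prod_mono Ioc_subset_Icc_self Ioc_subset_Icc_self)

/-- Integration by parts when one factor is the primitive of an integrable function. -/
lemma integral_primitive_mul_deriv {α β : ℝ} {w φ φ' : ℝ → ℂ} (hαβ : α ≤ β)
    (hw : IntervalIntegrable w volume α β) (hφ : ∀ x, HasDerivAt φ (φ' x) x)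
    (hφ' : Continuous φ') :
    ∫ x in α..β, (∫ t in α..x, w t) * φ' x = ∫ t in α..β, w t * (φ β - φ t) := by
  have h := (triangle_fubini hαβ (F := fun x t => w t * φ' x)
    (integrableOn_square_mul hαβ hw (k := fun x _ => φ' x) (hφ'.comp continuous_fst))).2.2
  simp only [intervalIntegral.integral_mul_const, intervalIntegral.integral_const_mul] at h
  rw [h]
  refine intervalIntegral.integral_congr fun t _ => ?_
  rw [intervalIntegral.integral_eq_sub_of_hasDerivAt (fun x _ => hφ x)
    (hφ'.intervalIntegrable _ _)]

/-- An integral that depends holomorphically on a parameter. -/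
lemma differentiable_integral_mul {α β : ℝ} {w : ℝ → ℂ} (hw : IntervalIntegrable w volume α β)
    {F : ℝ → ℂ → ℂ} (hc : ∀ ρ, Continuous fun t => F t ρ) (hd : ∀ t, Differentiable ℂ (F t))
    (hb : ∀ r : ℝ, ∃ M, ∀ t ∈ uIcc α β, ∀ ρ : ℂ, ‖ρ‖ ≤ r → ‖F t ρ‖ ≤ M) :
    Differentiable ℂ fun ρ => ∫ t in α..β, w t * F t ρ := by
  intro ρ₀
  obtain ⟨M, hM⟩ := hb (‖ρ₀‖ + 2)
  have hder : ∀ t ∈ uIcc α β, ∀ ρ ∈ Metric.ball ρ₀ 1, ‖deriv (F t) ρ‖ ≤ M := by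
    intro t ht ρ hρ
    have := Complex.norm_deriv_le_of_forall_mem_sphere_norm_le (f := F t) (c := ρ) (C := M)
      one_pos (hd t).diffContOnCl fun z hz => hM t ht z ?_
    · simpa using this
    · have h1 : ‖z - ρ‖ = 1 := by simpa [dist_eq_norm] using hz
      have h2 : ‖ρ - ρ₀‖ < 1 := by simpa [dist_eq_norm] using hρ
      calc ‖z‖ = ‖(z - ρ) + (ρ - ρ₀) + ρ₀‖ := by ring_nf
        _ ≤ ‖z - ρ‖ + ‖ρ - ρ₀‖ + ‖ρ₀‖ := norm_add₃_le
        _ ≤ ‖ρ₀‖ + 2 := by linarith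
  have hmeas : AEStronglyMeasurable (fun t => deriv (F t) ρ₀) (volume.restrict (uIoc α β)) := by
    have hlim : ∀ t, Tendsto (fun n : ℕ => ((1 : ℂ) / ((n : ℂ) + 1))⁻¹ *
        (F t (ρ₀ + 1 / ((n : ℂ) + 1)) - F t ρ₀)) atTop (𝓝 (deriv (F t) ρ₀)) := by
      intro t
      have h1 := (hd t ρ₀).hasDerivAt.tendsto_slope_zero
      have h2 : Tendsto (fun n : ℕ => (1 : ℂ) / ((n : ℂ) + 1)) atTop (𝓝[≠] 0) := by
        refine tendsto_nhdsWithin_iff.2 ⟨?_, Eventually.of_forall fun n => ?_⟩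
        · exact tendsto_one_div_add_atTop_nhds_zero_nat
        · have : (n : ℂ) + 1 ≠ 0 := Nat.cast_add_one_ne_zero n
          simp [this]
      exact (h1.comp h2).congr fun n => by simp
    exact aestronglyMeasurable_of_tendsto_ae atTop
      (fun n => (continuous_const.mul ((hc _).sub (hc _))).aestronglyMeasurable)
      (ae_of_all _ hlim)
  have := (intervalIntegral.hasDerivAt_integral_of_dominated_loc_of_deriv_le
    (F := fun ρ t => w t * F t ρ) (F' := fun ρ t => w t * deriv (F t) ρ) (x₀ := ρ₀) (μ := volume)
    (a := α) (b := β) (bound := fun t => ‖w t‖ * M)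
    (Metric.ball_mem_nhds ρ₀ one_pos)
    (Eventually.of_forall fun ρ => hw.def'.aestronglyMeasurable.mul (hc ρ).aestronglyMeasurable)
    (hw.mul_continuousOn (hc ρ₀).continuousOn)
    (hw.def'.aestronglyMeasurable.mul hmeas)
    (ae_of_all _ fun t ht ρ hρ => by
      rw [norm_mul]
      gcongr
      exact hder t (uIoc_subset_uIcc ht) ρ hρ)
    (hw.norm.mul_const M)
    (ae_of_all _ fun t _ ρ _ => ((hd t ρ).hasDerivAt).const_mul (w t))).2
  exact this.differentiableAt

/-- A function of `λ = ρ²` that is entire in `ρ` is entire in `λ`. -/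
lemma differentiable_of_comp_sq {F G : ℂ → ℂ} (hG : Differentiable ℂ G)
    (h : ∀ ρ, F (ρ ^ 2) = G ρ) : Differentiable ℂ F := by
  have hsq : ∀ z : ℂ, (z ^ (1 / 2 : ℂ)) ^ 2 = z := fun z => by
    rw [one_div]
    exact_mod_cast Complex.cpow_nat_inv_pow z two_ne_zero
  have hne : ∀ z : ℂ, z ≠ 0 → DifferentiableAt ℂ F z := by
    intro z hz
    -- near `z`, a holomorphic branch of the square root is `√z √(u / z)`
    have h1 : F = fun u => G (z ^ (1 / 2 : ℂ) * (u / z) ^ (1 / 2 : ℂ)) := by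
      funext u
      rw [← h, mul_pow, hsq, hsq, mul_div_cancel₀ _ hz]
    rw [h1]
    refine (hG _).comp z (DifferentiableAt.const_mul ?_ _)
    refine DifferentiableAt.cpow_const (by fun_prop) ?_
    rw [div_self hz]
    exact Complex.one_mem_slitPlane
  intro z
  by_cases hz : z = 0
  · subst hz
    refine (Complex.analyticAt_of_differentiable_on_punctured_nhds_of_continuousAt ?_ ?_
      ).differentiableAt
    · filter_upwards [self_mem_nhdsWithin] with u hu using hne u hu
    · have h1 : F = fun u => G (u ^ (1 / 2 : ℂ)) := by
        funext u
        rw [← h, hsq]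
      rw [h1]
      refine ContinuousAt.comp (g := G) hG.continuous.continuousAt ?_
      refine ContinuousAt.comp (g := fun p : ℂ × ℂ => p.1 ^ p.2) (f := fun u : ℂ => (u, (1 / 2 : ℂ)))
        (Complex.continuousAt_cpow_zero_of_re_pos (by norm_num)) (by fun_prop)
  · exact hne z hz

/-! ### The fundamental solution -/

/-- `sin (ρx) / ρ`, continued by `x` to `ρ = 0`: the solution of `-y'' = ρ² y` with `y(0) = 0`,
`y'(0) = 1`. -/
noncomputable def sn (ρ : ℂ) (x : ℝ) : ℂ := if ρ = 0 then x else Complex.sin (ρ * x) / ρ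

/-- `cos (ρx)`, the derivative of `sn ρ`. -/
noncomputable def cs (ρ : ℂ) (x : ℝ) : ℂ := Complex.cos (ρ * x)

@[simp] lemma sn_zero (ρ : ℂ) : sn ρ 0 = 0 := by simp [sn]

lemma mul_sn (ρ : ℂ) (x : ℝ) : ρ * sn ρ x = Complex.sin (ρ * x) := by
  unfold sn
  split_ifs with h
  · simp [h]
  · field_simp

@[simp] lemma cs_zero (ρ : ℂ) : cs ρ 0 = 1 := by simp [cs]

lemma hasDerivAt_sn (ρ : ℂ) (x : ℝ) : HasDerivAt (sn ρ) (cs ρ x) x := by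
  by_cases h : ρ = 0
  · subst h
    have : sn 0 = fun x : ℝ => (x : ℂ) := by funext x; simp [sn]
    rw [this]
    simpa [cs] using (hasDerivAt_id (x : ℂ)).comp_ofReal
  · have h1 : HasDerivAt (fun z : ℂ => Complex.sin (ρ * z) / ρ)
        (Complex.cos (ρ * x) * (ρ * 1) / ρ) (x : ℂ) :=
      (((hasDerivAt_id (x : ℂ)).const_mul ρ).csin).div_const ρ
    have : sn ρ = fun x : ℝ => Complex.sin (ρ * x) / ρ := by funext x; simp [sn, h]
    rw [this]
    exact h1.comp_ofReal.congr_deriv (by rw [cs]; field_simp)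

lemma hasDerivAt_cs (ρ : ℂ) (x : ℝ) : HasDerivAt (cs ρ) (-ρ ^ 2 * sn ρ x) x := by
  have h1 : HasDerivAt (fun z : ℂ => Complex.cos (ρ * z))
      (-Complex.sin (ρ * x) * (ρ * 1)) (x : ℂ) :=
    ((hasDerivAt_id (x : ℂ)).const_mul ρ).ccos
  exact h1.comp_ofReal.congr_deriv (by rw [← mul_sn]; ring)

lemma continuous_sn (ρ : ℂ) : Continuous (sn ρ) :=
  continuous_iff_continuousAt.2 fun x => (hasDerivAt_sn ρ x).continuousAt

lemma continuous_cs (ρ : ℂ) : Continuous (cs ρ) :=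
  continuous_iff_continuousAt.2 fun x => (hasDerivAt_cs ρ x).continuousAt

lemma sn_sub (ρ : ℂ) (x t : ℝ) : sn ρ (x - t) = sn ρ x * cs ρ t - cs ρ x * sn ρ t := by
  by_cases h : ρ = 0
  · simp [sn, cs, h]
  · simp only [sn, cs, h, if_false]
    push_cast
    rw [mul_sub, Complex.sin_sub]
    ring

lemma cs_sub (ρ : ℂ) (x t : ℝ) :
    cs ρ (x - t) = cs ρ x * cs ρ t + ρ ^ 2 * (sn ρ x * sn ρ t) := by
  have : ρ ^ 2 * (sn ρ x * sn ρ t) = (ρ * sn ρ x) * (ρ * sn ρ t) := by ring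
  rw [this, mul_sn, mul_sn]
  simp only [cs]
  push_cast
  rw [mul_sub, Complex.cos_sub]

lemma cs_sub_I_mul_sn (ρ : ℂ) (x : ℝ) : cs ρ x - Complex.I * (ρ * sn ρ x) = wave ρ (-x) := by
  rw [wave_eq_cos_add_sin, mul_sn]
  simp [cs]
  ring

/-- Families of functions of `x`, depending on the parameter `ρ`, that are continuous in `x`, entire
in `ρ` and locally bounded. -/
structure IsEntireFamily (F : ℂ → ℝ → ℂ) : Prop where
  continuous : ∀ ρ, Continuous (F ρ)
  differentiable : ∀ x, Differentiable ℂ fun ρ => F ρ x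
  bounded : ∀ r b : ℝ, ∃ M, ∀ ρ : ℂ, ‖ρ‖ ≤ r → ∀ x : ℝ, |x| ≤ b → ‖F ρ x‖ ≤ M

lemma isEntireFamily_sn : IsEntireFamily sn := by
  have hd : Differentiable ℂ (dslope Complex.sin 0) := fun z =>
    ((Complex.differentiableOn_dslope (s := univ) univ_mem).2
      Complex.differentiable_sin.differentiableOn z (mem_univ z)).differentiableAt univ_mem
  have hs : ∀ ρ x, sn ρ x = x * dslope Complex.sin 0 (ρ * x) := by
    intro ρ x
    by_cases h : ρ = 0
    · simp [h, sn]
    · by_cases hx : x = 0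
      · simp [hx]
      · have hx' : (x : ℂ) ≠ 0 := Complex.ofReal_ne_zero.2 hx
        rw [dslope_of_ne _ (mul_ne_zero h hx'), slope_def_field]
        simp only [sn, h, if_false, Complex.sin_zero, sub_zero]
        field_simp
  refine ⟨continuous_sn, fun x => ?_, fun r b => ?_⟩
  · simp only [hs]
    exact (hd.comp (by fun_prop : Differentiable ℂ fun ρ : ℂ => ρ * x)).const_mul _
  · obtain ⟨M, hM⟩ := (isCompact_closedBall (0 : ℂ) (r * b)).exists_bound_of_continuousOn
      hd.continuous.continuousOn
    refine ⟨b * M, fun ρ hρ x hx => ?_⟩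
    have hM' := hM (ρ * x) (by
      rw [mem_closedBall_zero_iff, norm_mul, Complex.norm_real, Real.norm_eq_abs]
      gcongr
      exact (norm_nonneg _).trans hρ)
    rw [hs, norm_mul, Complex.norm_real, Real.norm_eq_abs]
    gcongr
    exact (abs_nonneg _).trans hx

lemma isEntireFamily_cs : IsEntireFamily cs := by
  refine ⟨continuous_cs, fun x => ?_, fun r b => ?_⟩
  · simp only [cs]
    fun_prop
  · obtain ⟨M, hM⟩ := (isCompact_closedBall (0 : ℂ) (r * b)).exists_bound_of_continuousOn
      Complex.continuous_cos.continuousOn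
    refine ⟨M, fun ρ hρ x hx => hM (ρ * x) ?_⟩
    rw [mem_closedBall_zero_iff, norm_mul, Complex.norm_real, Real.norm_eq_abs]
    gcongr
    exact (norm_nonneg _).trans hρ

lemma IsEntireFamily.add {F G : ℂ → ℝ → ℂ} (hF : IsEntireFamily F) (hG : IsEntireFamily G) :
    IsEntireFamily fun ρ x => F ρ x + G ρ x := by
  refine ⟨fun ρ => (hF.continuous ρ).add (hG.continuous ρ),
    fun x => (hF.differentiable x).add (hG.differentiable x), fun r b => ?_⟩
  obtain ⟨M, hM⟩ := hF.bounded r b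
  obtain ⟨N, hN⟩ := hG.bounded r b
  exact ⟨M + N, fun ρ hρ x hx => (norm_add_le _ _).trans (add_le_add (hM ρ hρ x hx) (hN ρ hρ x hx))⟩

/-- The integral operator `f ↦ ∫₀ˣ w(t) k(x - t) f(t - a) dt` of the method of successive
approximations. -/
noncomputable def delayConv (a : ℝ) (w : ℝ → ℂ) (k f : ℂ → ℝ → ℂ) (ρ : ℂ) (x : ℝ) : ℂ :=
  ∫ t in (0 : ℝ)..x, w t * (k ρ (x - t) * f ρ (t - a))

section delayConv

variable {a : ℝ} {w : ℝ → ℂ} {k f : ℂ → ℝ → ℂ}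

lemma exists_bound_kernel (hk : IsEntireFamily k) (hf : IsEntireFamily f) (r b : ℝ) :
    ∃ M, ∀ ρ : ℂ, ‖ρ‖ ≤ r → ∀ x : ℝ, |x| ≤ b → ∀ t ∈ uIcc 0 x,
      ‖k ρ (x - t) * f ρ (t - a)‖ ≤ M := by
  obtain ⟨M, hM⟩ := hk.bounded r (b + b)
  obtain ⟨N, hN⟩ := hf.bounded r (b + |a|)
  refine ⟨M * N, fun ρ hρ x hx t ht => ?_⟩
  have ht' : |t| ≤ |x| := by simpa using abs_sub_left_of_mem_uIcc ht
  rw [norm_mul]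
  have h1 := hM ρ hρ (x - t) ((abs_sub _ _).trans (by linarith))
  exact mul_le_mul h1 (hN ρ hρ (t - a) ((abs_sub _ _).trans (by linarith))) (norm_nonneg _)
    ((norm_nonneg _).trans h1)

lemma continuous_kernel (hk : IsEntireFamily k) (hf : IsEntireFamily f) (ρ : ℂ) (x : ℝ) :
    Continuous fun t => k ρ (x - t) * f ρ (t - a) :=
  ((hk.continuous ρ).comp (by fun_prop)).mul ((hf.continuous ρ).comp (by fun_prop))

lemma differentiable_delayConv (hw : Integrable w) (hk : IsEntireFamily k)
    (hf : IsEntireFamily f) (x : ℝ) : Differentiable ℂ fun ρ => delayConv a w k f ρ x := by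
  refine differentiable_integral_mul (F := fun t ρ => k ρ (x - t) * f ρ (t - a))
    hw.intervalIntegrable (fun ρ => continuous_kernel hk hf ρ x)
    (fun t => (hk.differentiable _).mul (hf.differentiable _)) fun r => ?_
  obtain ⟨M, hM⟩ := exists_bound_kernel (a := a) hk hf r |x|
  exact ⟨M, fun t ht ρ hρ => hM ρ hρ x le_rfl t ht⟩

/-- Continuity in `x` follows from the addition theorems for the kernels `sn` and `cs`. -/
lemma continuous_delayConv_sn (hw : Integrable w) (hf : IsEntireFamily f) (ρ : ℂ) :
    Continuous (delayConv a w sn f ρ) := by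
  have hg : ∀ {h : ℝ → ℂ}, Continuous h → ∀ x y,
      IntervalIntegrable (fun t => w t * (h t * f ρ (t - a))) volume x y := fun {h} hh x y =>
    hw.intervalIntegrable.mul_continuousOn
      (hh.mul ((hf.continuous ρ).comp (by fun_prop))).continuousOn
  have : delayConv a w sn f ρ = fun x =>
      sn ρ x * (∫ t in (0 : ℝ)..x, w t * (cs ρ t * f ρ (t - a)))
        - cs ρ x * ∫ t in (0 : ℝ)..x, w t * (sn ρ t * f ρ (t - a)) := by
    funext x
    rw [delayConv, ← intervalIntegral.integral_const_mul, ← intervalIntegral.integral_const_mul,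
      ← intervalIntegral.integral_sub ((hg (continuous_cs ρ) _ _).const_mul _)
        ((hg (continuous_sn ρ) _ _).const_mul _)]
    refine intervalIntegral.integral_congr fun t _ => ?_
    simp only [sn_sub]
    ring
  rw [this]
  exact ((continuous_sn ρ).mul (intervalIntegral.continuous_primitive (hg (continuous_cs ρ)) 0)).sub
    ((continuous_cs ρ).mul (intervalIntegral.continuous_primitive (hg (continuous_sn ρ)) 0))

lemma continuous_delayConv_cs (hw : Integrable w) (hf : IsEntireFamily f) (ρ : ℂ) :
    Continuous (delayConv a w cs f ρ) := by
  have hg : ∀ {h : ℝ → ℂ}, Continuous h → ∀ x y,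
      IntervalIntegrable (fun t => w t * (h t * f ρ (t - a))) volume x y := fun {h} hh x y =>
    hw.intervalIntegrable.mul_continuousOn
      (hh.mul ((hf.continuous ρ).comp (by fun_prop))).continuousOn
  have : delayConv a w cs f ρ = fun x =>
      cs ρ x * (∫ t in (0 : ℝ)..x, w t * (cs ρ t * f ρ (t - a)))
        + ρ ^ 2 * sn ρ x * ∫ t in (0 : ℝ)..x, w t * (sn ρ t * f ρ (t - a)) := by
    funext x
    rw [delayConv, ← intervalIntegral.integral_const_mul, ← intervalIntegral.integral_const_mul,
      ← intervalIntegral.integral_add ((hg (continuous_cs ρ) _ _).const_mul _)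
        ((hg (continuous_sn ρ) _ _).const_mul _)]
    refine intervalIntegral.integral_congr fun t _ => ?_
    simp only [cs_sub]
    ring
  rw [this]
  exact ((continuous_cs ρ).mul (intervalIntegral.continuous_primitive (hg (continuous_cs ρ)) 0)).add
    ((continuous_const.mul (continuous_sn ρ)).mul
      (intervalIntegral.continuous_primitive (hg (continuous_sn ρ)) 0))

lemma isEntireFamily_delayConv_sn (hw : Integrable w) (hf : IsEntireFamily f) :
    IsEntireFamily (delayConv a w sn f) := by
  refine ⟨continuous_delayConv_sn hw hf, differentiable_delayConv hw isEntireFamily_sn hf,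
    fun r b => ?_⟩
  obtain ⟨M, hM⟩ := exists_bound_kernel (a := a) isEntireFamily_sn hf r b
  refine ⟨(∫ t, ‖w t‖) * |M|, fun ρ hρ x hx => ?_⟩
  rw [← integral_mul_const]
  have hi : Integrable fun t => ‖w t‖ * |M| := hw.norm.mul_const _
  refine (intervalIntegral.norm_integral_le_abs_of_norm_le
    (g := fun t => ‖w t‖ * |M|) ((ae_restrict_iff' measurableSet_uIoc).2
      (ae_of_all _ fun t ht => ?_)) hi.intervalIntegrable).trans ?_
  · rw [norm_mul]
    gcongr
    exact (hM ρ hρ x hx t (uIoc_subset_uIcc ht)).trans (le_abs_self M)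
  · rw [intervalIntegral.abs_integral_eq_abs_integral_uIoc,
      abs_of_nonneg (integral_nonneg fun t => by positivity)]
    exact setIntegral_le_integral hi (ae_of_all _ fun t => by positivity)

lemma delayConv_sn_eq_integral (hw : Integrable w) (hf : IsEntireFamily f) (ρ : ℂ) {x : ℝ}
    (hx : 0 ≤ x) : delayConv a w sn f ρ x = ∫ r in (0 : ℝ)..x, delayConv a w cs f ρ r := by
  have hg : IntervalIntegrable (fun t => w t * f ρ (t - a)) volume 0 x :=
    hw.intervalIntegrable.mul_continuousOn ((hf.continuous ρ).comp (by fun_prop)).continuousOn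
  have h := (triangle_fubini hx (F := fun r t => w t * f ρ (t - a) * cs ρ (r - t))
    (integrableOn_square_mul hx hg (k := fun r t => cs ρ (r - t))
      ((continuous_cs ρ).comp (continuous_fst.sub continuous_snd)))).2.2
  have e : ∫ r in (0 : ℝ)..x, delayConv a w cs f ρ r
      = ∫ r in (0 : ℝ)..x, ∫ t in (0 : ℝ)..r, w t * f ρ (t - a) * cs ρ (r - t) := by
    refine intervalIntegral.integral_congr fun r _ => ?_
    refine intervalIntegral.integral_congr fun t _ => ?_
    ring
  rw [e, h, delayConv]
  refine intervalIntegral.integral_congr fun t _ => ?_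
  rw [intervalIntegral.integral_const_mul, intervalIntegral.integral_comp_sub_right,
    intervalIntegral.integral_eq_sub_of_hasDerivAt (fun y _ => hasDerivAt_sn ρ y)
      ((continuous_cs ρ).intervalIntegrable _ _)]
  simp
  ring

lemma delayConv_cs_eq_integral (hw : Integrable w) (hf : IsEntireFamily f) (ρ : ℂ) {x : ℝ}
    (hx : 0 ≤ x) : delayConv a w cs f ρ x = (∫ t in (0 : ℝ)..x, w t * f ρ (t - a))
      - ρ ^ 2 * ∫ r in (0 : ℝ)..x, delayConv a w sn f ρ r := by
  have hg : IntervalIntegrable (fun t => w t * f ρ (t - a)) volume 0 x :=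
    hw.intervalIntegrable.mul_continuousOn ((hf.continuous ρ).comp (by fun_prop)).continuousOn
  have h := (triangle_fubini hx (F := fun r t => w t * f ρ (t - a) * (-ρ ^ 2 * sn ρ (r - t)))
    (integrableOn_square_mul hx hg (k := fun r t => -ρ ^ 2 * sn ρ (r - t)) <| by
      have := continuous_sn ρ
      fun_prop)).2.2
  have e : -(ρ ^ 2 * ∫ r in (0 : ℝ)..x, delayConv a w sn f ρ r)
      = ∫ r in (0 : ℝ)..x, ∫ t in (0 : ℝ)..r, w t * f ρ (t - a) * (-ρ ^ 2 * sn ρ (r - t)) := by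
    rw [← neg_mul, ← intervalIntegral.integral_const_mul]
    refine intervalIntegral.integral_congr fun r _ => ?_
    simp only [delayConv]
    rw [← intervalIntegral.integral_const_mul]
    congr! 2
    ring
  have h2 : ∀ t, ∫ r in t..x, w t * f ρ (t - a) * (-ρ ^ 2 * sn ρ (r - t))
      = w t * (cs ρ (x - t) * f ρ (t - a)) - w t * f ρ (t - a) := by
    intro t
    rw [intervalIntegral.integral_const_mul,
      intervalIntegral.integral_comp_sub_right (fun y => -ρ ^ 2 * sn ρ y),
      intervalIntegral.integral_eq_sub_of_hasDerivAt (fun y _ => hasDerivAt_cs ρ y)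
        ((continuous_const.mul (continuous_sn ρ)).intervalIntegrable _ _)]
    simp
    ring
  rw [sub_eq_add_neg, e, h]
  simp only [h2]
  rw [intervalIntegral.integral_sub _ hg]
  · simp [delayConv]
  · exact hw.intervalIntegrable.mul_continuousOn
      (continuous_kernel isEntireFamily_cs hf ρ x).continuousOn

end delayConv

/-- The potential cut off to `(a, π)`. -/
noncomputable def cutoff (a : ℝ) (q : ℝ → ℂ) : ℝ → ℂ := (Ioo a π).indicator q

lemma integrable_cutoff {a : ℝ} {q : ℝ → ℂ} (hq : IsPotential a q) : Integrable (cutoff a q) :=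
  (integrable_indicator_iff measurableSet_Ioo).2 hq.integrable

lemma cutoff_of_mem {a : ℝ} {q : ℝ → ℂ} {x : ℝ} (hx : x ∈ Ioo a π) : cutoff a q x = q x :=
  indicator_of_mem hx q

lemma cutoff_of_le {a : ℝ} {q : ℝ → ℂ} {x : ℝ} (hx : x ≤ a) : cutoff a q x = 0 :=
  indicator_of_notMem (fun h => hx.not_gt h.1) q

/-- `y + ∫₀ˣ w(t) sn(x - t) y(t - a) dt` with `y = sn`: the fundamental solution on `[0, 2a]`. -/
noncomputable def firstApprox (a : ℝ) (w : ℝ → ℂ) (ρ : ℂ) (x : ℝ) : ℂ :=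
  sn ρ x + delayConv a w sn sn ρ x

/-- The fundamental solution with parameter `ρ²`, on `[0, 3a]`. -/
noncomputable def solY (a : ℝ) (w : ℝ → ℂ) (ρ : ℂ) (x : ℝ) : ℂ :=
  sn ρ x + delayConv a w sn (firstApprox a w) ρ x

/-- The derivative of `solY`. -/
noncomputable def solDY (a : ℝ) (w : ℝ → ℂ) (ρ : ℂ) (x : ℝ) : ℂ :=
  cs ρ x + delayConv a w cs (firstApprox a w) ρ x

lemma isEntireFamily_firstApprox {a : ℝ} {w : ℝ → ℂ} (hw : Integrable w) :
    IsEntireFamily (firstApprox a w) :=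
  isEntireFamily_sn.add (isEntireFamily_delayConv_sn hw isEntireFamily_sn)

lemma differentiable_solY {a : ℝ} {w : ℝ → ℂ} (hw : Integrable w) (x : ℝ) :
    Differentiable ℂ fun ρ => solY a w ρ x :=
  (isEntireFamily_sn.differentiable x).add
    (differentiable_delayConv hw isEntireFamily_sn (isEntireFamily_firstApprox hw) x)

lemma differentiable_solDY {a : ℝ} {w : ℝ → ℂ} (hw : Integrable w) (x : ℝ) :
    Differentiable ℂ fun ρ => solDY a w ρ x :=
  (isEntireFamily_cs.differentiable x).add
    (differentiable_delayConv hw isEntireFamily_cs (isEntireFamily_firstApprox hw) x)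

lemma delayConv_eq_zero {a : ℝ} {w : ℝ → ℂ} (hw : ∀ x ≤ a, w x = 0) (k f : ℂ → ℝ → ℂ) (ρ : ℂ)
    {x : ℝ} (h0 : 0 ≤ x) (hx : x ≤ a) : delayConv a w k f ρ x = 0 := by
  refine intervalIntegral.integral_zero_ae (ae_of_all _ fun t ht => ?_)
  rw [uIoc_of_le h0] at ht
  rw [hw t (ht.2.trans hx), zero_mul]

lemma solY_eq_firstApprox {a : ℝ} {w : ℝ → ℂ} (hw : ∀ x ≤ a, w x = 0) (ρ : ℂ) {x : ℝ}
    (h0 : 0 ≤ x) (hx : x ≤ 2 * a) : solY a w ρ x = firstApprox a w ρ x := by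
  rw [solY, firstApprox, delayConv, delayConv]
  congr 1
  refine intervalIntegral.integral_congr fun t ht => ?_
  rw [uIcc_of_le h0] at ht
  rcases le_or_gt t a with h | h
  · simp [hw t h]
  · simp only [firstApprox]
    rw [delayConv_eq_zero hw sn sn ρ (x := t - a) (by linarith) (by linarith [ht.2]), add_zero]

lemma isSolution_solY {a : ℝ} {q : ℝ → ℂ} (ha3 : π ≤ 3 * a) (hq : IsPotential a q)
    (ρ : ℂ) : IsSolution a q (ρ ^ 2) (solY a (cutoff a q) ρ) (solDY a (cutoff a q) ρ) := by
  set w := cutoff a q with hw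
  have hwi : Integrable w := integrable_cutoff hq
  have hw0 : ∀ x ≤ a, w x = 0 := fun x hx => cutoff_of_le hx
  have hf := isEntireFamily_firstApprox (a := a) hwi
  have hY0 : solDY a w ρ 0 = 1 := by simp [solDY, delayConv]
  refine ⟨fun x hx => ?_, fun x hx => ?_⟩
  · have h1 : HasDerivAt (fun x => sn ρ x + ∫ r in (0 : ℝ)..x, delayConv a w cs (firstApprox a w) ρ r)
        (solDY a w ρ x) x :=
      (hasDerivAt_sn ρ x).add
        ((continuous_delayConv_cs hwi hf ρ).integral_hasStrictDerivAt 0 x).hasDerivAt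
    refine h1.hasDerivWithinAt.congr (fun y hy => ?_) ?_
    · rw [solY, delayConv_sn_eq_integral hwi hf ρ hy.1]
    · rw [solY, delayConv_sn_eq_integral hwi hf ρ hx.1]
  · have hg : IntervalIntegrable (fun t => w t * firstApprox a w ρ (t - a)) volume 0 x :=
      hwi.intervalIntegrable.mul_continuousOn ((hf.continuous ρ).comp (by fun_prop)).continuousOn
    have hYc : Continuous (solY a w ρ) :=
      (continuous_sn ρ).add (continuous_delayConv_sn hwi hf ρ)
    have e1 : ∫ t in (0 : ℝ)..x, (q t * solY a w ρ (t - a) - ρ ^ 2 * solY a w ρ t)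
        = ∫ t in (0 : ℝ)..x, (w t * firstApprox a w ρ (t - a) - ρ ^ 2 * solY a w ρ t) := by
      refine intervalIntegral.integral_congr_ae ?_
      filter_upwards [compl_mem_ae_iff.2 (measure_singleton a),
        compl_mem_ae_iff.2 (measure_singleton π)] with t hta htπ ht
      rw [uIoc_of_le hx.1] at ht
      rcases lt_or_gt_of_ne (hta : t ≠ a) with h | h
      · rw [hq.zero t ⟨ht.1.le, h⟩, hw0 t h.le]
        ring
      · have htπ' : t < π := lt_of_le_of_ne (ht.2.trans hx.2) htπ
        rw [hw, cutoff_of_mem ⟨h, htπ'⟩, solY_eq_firstApprox hw0 ρ (by linarith) (by linarith)]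
    have hYi : IntervalIntegrable (fun t => ρ ^ 2 * solY a w ρ t) volume 0 x :=
      (continuous_const.mul hYc).intervalIntegrable _ _
    rw [e1, hY0, intervalIntegral.integral_sub hg hYi, solDY,
      delayConv_cs_eq_integral hwi hf ρ hx.1, intervalIntegral.integral_const_mul]
    have e2 : ∫ t in (0 : ℝ)..x, solY a w ρ t = (∫ t in (0 : ℝ)..x, sn ρ t)
        + ∫ t in (0 : ℝ)..x, delayConv a w sn (firstApprox a w) ρ t :=
      intervalIntegral.integral_add ((continuous_sn ρ).intervalIntegrable _ _)
        ((continuous_delayConv_sn hwi hf ρ).intervalIntegrable _ _)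
    have e3 : ∫ t in (0 : ℝ)..x, -ρ ^ 2 * sn ρ t = cs ρ x - cs ρ 0 :=
      intervalIntegral.integral_eq_sub_of_hasDerivAt (fun y _ => hasDerivAt_cs ρ y)
        ((continuous_const.mul (continuous_sn ρ)).intervalIntegrable _ _)
    rw [intervalIntegral.integral_const_mul, cs_zero] at e3
    rw [e2]
    linear_combination -e3

section uniqueness

variable {a : ℝ} {q : ℝ → ℂ} {μ : ℂ} {y dy z dz : ℝ → ℂ}

lemma _root_.IsSolution.continuousOn (h : IsSolution a q μ y dy) : ContinuousOn y (Icc 0 π) :=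
  fun x hx => (h.hasDeriv x hx).continuousWithinAt

lemma _root_.IsSolution.intervalIntegrable_delay (ha : 0 < a) (hq : IsPotential a q)
    (h : IsSolution a q μ y dy) {x : ℝ} (hx : x ∈ Icc 0 π) :
    IntervalIntegrable (fun t => q t * y (t - a)) volume 0 x := by
  set p : ℝ → ℝ := fun t => max 0 (min (t - a) π)
  have hp : Continuous fun t => y (p t) := h.continuousOn.comp_continuous (by fun_prop)
    fun t => ⟨le_max_left _ _, max_le pi_pos.le (min_le_right _ _)⟩
  have h1 : IntervalIntegrable (fun t => cutoff a q t * y (p t)) volume 0 x :=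
    (integrable_cutoff hq).intervalIntegrable.mul_continuousOn hp.continuousOn
  rw [intervalIntegrable_iff] at h1 ⊢
  refine h1.congr ?_
  rw [uIoc_of_le hx.1, EventuallyEq, ae_restrict_iff' measurableSet_Ioc]
  filter_upwards [compl_mem_ae_iff.2 (measure_singleton a),
    compl_mem_ae_iff.2 (measure_singleton π)] with t hta htπ ht
  rcases lt_or_gt_of_ne (hta : t ≠ a) with h' | h'
  · rw [hq.zero t ⟨ht.1.le, h'⟩, cutoff_of_le h'.le]
    ring
  · have htπ' : t < π := lt_of_le_of_ne (ht.2.trans hx.2) htπ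
    rw [cutoff_of_mem ⟨h', htπ'⟩]
    congr 2
    simp only [p]
    rw [min_eq_left (by linarith), max_eq_right (by linarith)]

lemma _root_.IsSolution.intervalIntegrable (ha : 0 < a) (hq : IsPotential a q) (h : IsSolution a q μ y dy)
    {x : ℝ} (hx : x ∈ Icc 0 π) :
    IntervalIntegrable (fun t => q t * y (t - a) - μ * y t) volume 0 x :=
  (h.intervalIntegrable_delay ha hq hx).sub ((h.continuousOn.mono (by
    rw [uIcc_of_le hx.1]
    exact Icc_subset_Icc_right hx.2)).intervalIntegrable.const_mul μ)

lemma _root_.IsSolution.sub_smul (ha : 0 < a) (hq : IsPotential a q) (hy : IsSolution a q μ y dy)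
    (hz : IsSolution a q μ z dz) (c : ℂ) :
    IsSolution a q μ (fun x => y x - c * z x) (fun x => dy x - c * dz x) := by
  refine ⟨fun x hx => (hy.hasDeriv x hx).sub ((hz.hasDeriv x hx).const_mul c), fun x hx => ?_⟩
  have e : ∫ t in (0 : ℝ)..x, (q t * (y (t - a) - c * z (t - a)) - μ * (y t - c * z t))
      = (∫ t in (0 : ℝ)..x, (q t * y (t - a) - μ * y t))
        - c * ∫ t in (0 : ℝ)..x, (q t * z (t - a) - μ * z t) := by
    rw [← intervalIntegral.integral_const_mul, ← intervalIntegral.integral_sub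
      (hy.intervalIntegrable ha hq hx) ((hz.intervalIntegrable ha hq hx).const_mul c)]
    refine intervalIntegral.integral_congr fun t _ => ?_
    ring
  rw [e, hy.equation x hx, hz.equation x hx]
  ring

/-- The Cauchy problem has at most one solution: on each interval of length `a` the delayed term is
known from the preceding interval, and Grönwall's inequality applies. -/
lemma _root_.IsSolution.eq_zero (ha : 0 < a) (hq : IsPotential a q) (h : IsSolution a q μ y dy)
    (h0 : y 0 = 0) (h0' : dy 0 = 0) : ∀ x ∈ Icc 0 π, y x = 0 ∧ dy x = 0 := by
  have step : ∀ k : ℕ, ∀ x ∈ Icc 0 π, x ≤ k * a → y x = 0 ∧ dy x = 0 := by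
    intro k
    induction k with
    | zero =>
      intro x hx hxk
      have : x = 0 := le_antisymm (by simpa using hxk) hx.1
      subst this
      exact ⟨h0, h0'⟩
    | succ k ih =>
      intro x hx hxk
      set b := min π ((k + 1 : ℕ) * a) with hb
      have hbπ : b ≤ π := min_le_left _ _
      set Y : ℝ → ℂ := fun t => y (max 0 (min t π)) with hY
      have hYc : Continuous Y := h.continuousOn.comp_continuous (by fun_prop)
        fun t => ⟨le_max_left _ _, max_le pi_pos.le (min_le_right _ _)⟩
      have hYy : ∀ t ∈ Icc 0 π, Y t = y t := fun t ht => by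
        simp only [hY]
        rw [min_eq_left ht.2, max_eq_right ht.1]
      have hdy : ∀ t ∈ Icc 0 b, dy t = ∫ r in (0 : ℝ)..t, -μ * Y r := by
        intro t ht
        rw [h.equation t ⟨ht.1, ht.2.trans hbπ⟩, h0', zero_add]
        refine intervalIntegral.integral_congr fun r hr => ?_
        rw [uIcc_of_le ht.1] at hr
        have hrb : r ≤ b := hr.2.trans ht.2
        rw [hYy r ⟨hr.1, hrb.trans hbπ⟩]
        have : q r * y (r - a) = 0 := by
          rcases lt_or_ge r a with hra | hra
          · rw [hq.zero r ⟨hr.1, hra⟩, zero_mul]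
          · have h2 : r ≤ (k + 1 : ℕ) * a := hrb.trans (min_le_right _ _)
            push_cast at h2
            rw [(ih (r - a) ⟨by linarith, by linarith [hrb.trans hbπ]⟩ (by linarith)).1, mul_zero]
        rw [this]
        ring
      have hder : ∀ t ∈ Ico 0 b, HasDerivWithinAt (fun t => (y t, dy t)) (dy t, -μ * y t)
          (Ici t) t := by
        intro t ht
        have htπ : t < π := ht.2.trans_le hbπ
        refine HasDerivWithinAt.prodMk ?_ ?_
        · exact (h.hasDeriv t ⟨ht.1, htπ.le⟩).mono_of_mem_nhdsWithin
            (mem_of_superset (Icc_mem_nhdsGE htπ) (Icc_subset_Icc_left ht.1))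
        · have h1 : HasDerivAt (fun t => ∫ r in (0 : ℝ)..t, -μ * Y r) (-μ * Y t) t :=
            ((continuous_const.mul hYc).integral_hasStrictDerivAt 0 t).hasDerivAt
          rw [← hYy t ⟨ht.1, htπ.le⟩]
          refine h1.hasDerivWithinAt.congr_of_eventuallyEq ?_ (hdy t ⟨ht.1, ht.2.le⟩)
          filter_upwards [Icc_mem_nhdsGE ht.2] with s hs using hdy s ⟨ht.1.trans hs.1, hs.2⟩
      have hcont : ContinuousOn (fun t => (y t, dy t)) (Icc 0 b) := by
        refine (h.continuousOn.mono (Icc_subset_Icc_right hbπ)).prodMk ?_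
        exact (intervalIntegral.continuous_primitive
          (fun _ _ => (continuous_const.mul hYc).intervalIntegrable _ _) 0).continuousOn.congr hdy
      have := eq_zero_of_abs_deriv_le_mul_abs_self_of_eq_zero_right (K := 1 + ‖μ‖) hcont hder
        (by simp [h0, h0']) (fun t _ => by
          have h1 := norm_fst_le (y t, dy t)
          have h2 := norm_snd_le (y t, dy t)
          simp only at h1 h2
          rw [Prod.norm_mk]
          refine max_le ?_ ?_
          · nlinarith [norm_nonneg μ, norm_nonneg (y t, dy t)]
          · rw [norm_mul, norm_neg]
            nlinarith [norm_nonneg μ, norm_nonneg (y t, dy t), norm_nonneg (y t)])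
        x ⟨hx.1, le_min hx.2 hxk⟩
      simpa using this
  intro x hx
  obtain ⟨k, hk⟩ := exists_nat_ge (x / a)
  exact step k x hx ((div_le_iff₀ ha).1 hk)

end uniqueness

lemma sol_init (a : ℝ) (w : ℝ → ℂ) (ρ : ℂ) : solY a w ρ 0 = 0 ∧ solDY a w ρ 0 = 1 := by
  simp [solY, solDY, delayConv]

section characteristic

variable {a : ℝ} {q : ℝ → ℂ}

lemma characteristicFn_sq (ha : 0 < a) (ha3 : π ≤ 3 * a) (hq : IsPotential a q) (j : Fin 2)
    (ρ : ℂ) : characteristicFn a q j (ρ ^ 2)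
      = ![solY a (cutoff a q) ρ π, solDY a (cutoff a q) ρ π] j := by
  have hs := isSolution_solY ha3 hq ρ
  have hi := sol_init a (cutoff a q) ρ
  have he : ∃ p : (ℝ → ℂ) × (ℝ → ℂ), IsSolution a q (ρ ^ 2) p.1 p.2 ∧ p.1 0 = 0 ∧ p.2 0 = 1 :=
    ⟨(_, _), hs, hi⟩
  have hp := Classical.epsilon_spec he
  have hz := (hp.1.sub_smul ha hq hs 1).eq_zero ha hq (by simp [hp.2.1, hi.1])
    (by simp [hp.2.2, hi.2]) π ⟨pi_pos.le, le_rfl⟩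
  simp only [one_mul, sub_eq_zero] at hz
  fin_cases j
  · exact hz.1
  · exact hz.2

lemma differentiable_characteristicFn (ha : 0 < a) (ha3 : π ≤ 3 * a) (hq : IsPotential a q)
    (j : Fin 2) : Differentiable ℂ (characteristicFn a q j) := by
  refine differentiable_of_comp_sq (G := fun ρ => ![solY a (cutoff a q) ρ π,
    solDY a (cutoff a q) ρ π] j) ?_ (characteristicFn_sq ha ha3 hq j)
  have hw := integrable_cutoff hq
  fin_cases j
  · exact differentiable_solY hw π
  · exact differentiable_solDY hw π

lemma isEigenvalue_iff (ha : 0 < a) (ha3 : π ≤ 3 * a) (hq : IsPotential a q) (j : Fin 2) (μ : ℂ) :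
    IsEigenvalue a q j μ ↔ characteristicFn a q j μ = 0 := by
  obtain ⟨ρ, rfl⟩ : ∃ ρ : ℂ, ρ ^ 2 = μ := IsAlgClosed.exists_pow_nat_eq μ two_pos
  have hs := isSolution_solY ha3 hq ρ
  have hi := sol_init a (cutoff a q) ρ
  rw [characteristicFn_sq ha ha3 hq]
  constructor
  · rintro ⟨y, dy, hy, hy0, hyj, x, hx, hxy⟩
    have hz := (hy.sub_smul ha hq hs (dy 0)).eq_zero ha hq (by simp [hy0, hi.1]) (by simp [hi.2])
    have hdy : dy 0 ≠ 0 := fun h => hxy (by simpa [h] using (hz x hx).1)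
    have hπ := hz π ⟨pi_pos.le, le_rfl⟩
    fin_cases j
    · have : y π = 0 := hyj
      simpa [this, hdy] using hπ.1
    · have : dy π = 0 := hyj
      simpa [this, hdy] using hπ.2
  · intro h
    refine ⟨_, _, hs, hi.1, ?_, ?_⟩
    · fin_cases j <;> exact h
    · by_contra! hc
      -- a function that vanishes on `[0, π]` cannot have derivative `1` at `0`
      have h1 : HasDerivWithinAt (solY a (cutoff a q) ρ) 0 (Icc 0 π) 0 :=
        (hasDerivWithinAt_const 0 (Icc 0 π) (0 : ℂ)).congr hc (hc 0 ⟨le_rfl, pi_pos.le⟩)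
      have h2 := hs.hasDeriv 0 ⟨le_rfl, pi_pos.le⟩
      have := (uniqueDiffOn_Icc pi_pos 0 ⟨le_rfl, pi_pos.le⟩).eq_deriv _ h1 h2
      rw [hi.2] at this
      exact zero_ne_one this

lemma eigenvalueMultiplicity_eq (ha : 0 < a) (ha3 : π ≤ 3 * a) (hq : IsPotential a q) (j : Fin 2)
    (μ : ℂ) : eigenvalueMultiplicity a q j μ = analyticOrderAt (characteristicFn a q j) μ := by
  unfold eigenvalueMultiplicity
  split_ifs with h
  · rfl
  · rw [isEigenvalue_iff ha ha3 hq] at h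
    have := (differentiable_characteristicFn ha ha3 hq j).analyticAt μ
    exact (this.analyticOrderAt_eq_zero.2 h).symm

end characteristic

/-! ### The characteristic functions as Fourier transforms -/

section quadratic

variable {a : ℝ} {w : ℝ → ℂ}

lemma quadraticPart_eq_indicator (a : ℝ) (w : ℝ → ℂ) : quadraticPart a w =
    (Ioo (-(π - 2 * a)) (π - 2 * a)).indicator fun ξ =>
      (fun x => w (x + a) * (∫ s in a..x, w s) - w x * (∫ s in x..(π - a), w (s + a))
        - ∫ s in x..(π - a), w (s + a) * w (s + a - x)) (ξ / 2 + π / 2) := by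
  funext ξ
  simp only [quadraticPart, indicator, mem_Ioo, ← abs_lt]
  congr 1
  rw [intervalIntegral.integral_comp_add_right w,
    intervalIntegral.integral_comp_add_right fun s => w s * w (s - (ξ / 2 + π / 2))]
  simp

/-- Integrals of the kernel `w(x + a) w(t) k(x, t)` over the triangle `a < t < x < π - a`. -/
noncomputable def triangleIntegral (a : ℝ) (w : ℝ → ℂ) (k : ℝ → ℝ → ℂ) : ℂ :=
  ∫ x in a..(π - a), ∫ t in a..x, w (x + a) * (w t * k x t)

lemma integrableOn_kernel (hw : Integrable w) {k : ℝ → ℝ → ℂ}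
    (hk : Continuous (Function.uncurry k)) :
    IntegrableOn (Function.uncurry fun x t => w (x + a) * (w t * k x t))
      (Ioc a (π - a) ×ˢ Ioc a (π - a)) := by
  have h : Integrable fun p : ℝ × ℝ => w (p.1 + a) * w p.2 :=
    (hw.comp_add_right a).mul_prod hw
  have h2 := (h.integrableOn (s := Icc a (π - a) ×ˢ Icc a (π - a))).mul_continuousOn
    hk.continuousOn (isCompact_Icc.prod isCompact_Icc)
  refine (h2.mono_set (prod_mono Ioc_subset_Icc_self Ioc_subset_Icc_self)).congr
    (ae_of_all _ fun p => ?_)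
  simp only [Function.uncurry]
  ring

lemma integrableOn_convolution_kernel (hw : Integrable w) {h : ℝ → ℂ} (hh : Continuous h) :
    IntegrableOn (Function.uncurry fun x t => w (x + a) * (w (x + a - t) * h t))
      (Ioc a (π - a) ×ˢ Ioc a (π - a)) := by
  have h1 := Integrable.convolution_integrand (ContinuousLinearMap.mul ℝ ℂ) (μ := volume)
    (ν := volume) (hw.comp_add_right a) (hw.comp_sub_left a)
  have h2 : Integrable fun p : ℝ × ℝ => w (p.1 + a) * w (p.1 + a - p.2) := by
    refine h1.swap.congr (ae_of_all _ fun p => ?_)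
    simp only [Function.comp, Prod.swap, ContinuousLinearMap.mul_apply']
    ring_nf
  have h3 := (h2.integrableOn (s := Icc a (π - a) ×ˢ Icc a (π - a))).mul_continuousOn
    (hh.comp continuous_snd).continuousOn (isCompact_Icc.prod isCompact_Icc)
  refine (h3.mono_set (prod_mono Ioc_subset_Icc_self Ioc_subset_Icc_self)).congr
    (ae_of_all _ fun p => ?_)
  simp only [Function.uncurry, Function.comp]
  ring

lemma triangleIntegral_add (ha : 2 * a ≤ π) (hw : Integrable w) {k l : ℝ → ℝ → ℂ}
    (hk : Continuous (Function.uncurry k)) (hl : Continuous (Function.uncurry l)) :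
    triangleIntegral a w (fun x t => k x t + l x t)
      = triangleIntegral a w k + triangleIntegral a w l := by
  have hab : a ≤ π - a := by linarith
  have hi := fun {k} hk => (triangle_fubini hab (integrableOn_kernel (a := a) (k := k) hw hk)).1
  rw [triangleIntegral, triangleIntegral, triangleIntegral,
    ← intervalIntegral.integral_add (hi hk) (hi hl)]
  refine intervalIntegral.integral_congr fun x _ => ?_
  have hj : ∀ {k : ℝ → ℝ → ℂ}, Continuous (Function.uncurry k) →
      IntervalIntegrable (fun t => w (x + a) * (w t * k x t)) volume a x := fun {k} hk =>
    (hw.intervalIntegrable.mul_continuousOn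
      (hk.comp (by fun_prop : Continuous fun t : ℝ => (x, t))).continuousOn).const_mul _
  rw [← intervalIntegral.integral_add (hj hk) (hj hl)]
  congr! 2
  ring

lemma triangleIntegral_const_mul (c : ℂ) (k : ℝ → ℝ → ℂ) :
    triangleIntegral a w (fun x t => c * k x t) = c * triangleIntegral a w k := by
  simp only [triangleIntegral, ← intervalIntegral.integral_const_mul]
  congr! 4
  ring

lemma intervalIntegrable_aux (ha : 2 * a ≤ π) (hw : Integrable w) (ρ : ℂ) :
    IntervalIntegrable (fun x => w (x + a) * (∫ s in a..x, w s) * wave ρ (2 * x - π))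
      volume a (π - a) ∧
    IntervalIntegrable (fun x => w x * (∫ s in x..(π - a), w (s + a)) * wave ρ (2 * x - π))
      volume a (π - a) ∧
    IntervalIntegrable (fun x => (∫ s in x..(π - a), w (s + a) * w (s + a - x))
      * wave ρ (2 * x - π)) volume a (π - a) ∧
    (∫ x in a..(π - a), w (x + a) * (∫ s in a..x, w s) * wave ρ (2 * x - π)
      = triangleIntegral a w fun x _ => wave ρ (2 * x - π)) ∧
    (∫ x in a..(π - a), w x * (∫ s in x..(π - a), w (s + a)) * wave ρ (2 * x - π)
      = triangleIntegral a w fun _ t => wave ρ (2 * t - π)) ∧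
    (∫ x in a..(π - a), (∫ s in x..(π - a), w (s + a) * w (s + a - x)) * wave ρ (2 * x - π)
      = triangleIntegral a w fun x t => wave ρ (2 * (x + a - t) - π)) := by
  have hab : a ≤ π - a := by linarith
  have hwc := continuous_wave ρ
  have h1 := triangle_fubini hab (integrableOn_kernel (a := a) (k := fun x _ => wave ρ (2 * x - π))
    hw (by fun_prop))
  have h2 := triangle_fubini hab (integrableOn_kernel (a := a) (k := fun _ t => wave ρ (2 * t - π))
    hw (by fun_prop))
  have h3 := triangle_fubini hab (integrableOn_convolution_kernel (a := a)
    (h := fun t => wave ρ (2 * t - π)) hw (by fun_prop))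
  have e1 : ∀ x, ∫ t in a..x, w (x + a) * (w t * wave ρ (2 * x - π))
      = w (x + a) * (∫ s in a..x, w s) * wave ρ (2 * x - π) := fun x => by
    rw [intervalIntegral.integral_const_mul, intervalIntegral.integral_mul_const, mul_assoc]
  have e2 : ∀ t, ∫ x in t..(π - a), w (x + a) * (w t * wave ρ (2 * t - π))
      = w t * (∫ s in t..(π - a), w (s + a)) * wave ρ (2 * t - π) := fun t => by
    rw [intervalIntegral.integral_mul_const]
    ring
  have e3 : ∀ t, ∫ x in t..(π - a), w (x + a) * (w (x + a - t) * wave ρ (2 * t - π))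
      = (∫ s in t..(π - a), w (s + a) * w (s + a - t)) * wave ρ (2 * t - π) := fun t => by
    rw [← intervalIntegral.integral_mul_const]
    congr! 2
    ring
  simp only [e1] at h1
  simp only [e2] at h2
  simp only [e3] at h3
  refine ⟨h1.1, h2.2.1, h3.2.1, ?_, h2.2.2.symm, ?_⟩
  · simp only [triangleIntegral, e1]
  · rw [← h3.2.2, triangleIntegral]
    refine intervalIntegral.integral_congr fun x _ => ?_
    have := intervalIntegral.integral_comp_sub_left (a := a) (b := x)
      (fun r => w (x + a) * (w r * wave ρ (2 * (x + a - r) - π))) (x + a)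
    simp only [add_sub_cancel_left, add_sub_cancel_right, sub_sub_cancel] at this
    exact this

/-- The quadratic part is integrable, and its Fourier transform is a sum of integrals over a
triangle. -/
lemma intervalIntegrable_quadraticPart (ha : 2 * a ≤ π) (ha0 : 0 ≤ a) (hw : Integrable w) :
    IntervalIntegrable (quadraticPart a w) volume (-(π - a)) (π - a) := by
  obtain ⟨h1, h2, h3, -⟩ := intervalIntegrable_aux ha hw 0
  simp only [wave_zero, mul_one] at h1 h2 h3
  have h := ((h1.sub h2).sub h3)
  have h' := (h.comp_add_right (π / 2)).comp_mul_left (c := 1 / 2)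
  rw [quadraticPart_eq_indicator, intervalIntegrable_iff_integrableOn_Ioc_of_le (by linarith)]
  refine Integrable.integrableOn ?_
  rw [integrable_indicator_iff measurableSet_Ioo,
    ← intervalIntegrable_iff_integrableOn_Ioo_of_le (by linarith)]
  convert h' using 1
  · funext ξ
    simp
    ring_nf
  · ring
  · ring

lemma integral_quadraticPart_mul_wave (ha : 2 * a ≤ π) (ha0 : 0 ≤ a) (hw : Integrable w) (ρ : ℂ) :
    ∫ ξ in -(π - a)..(π - a), quadraticPart a w ξ * wave ρ ξ
      = 2 * ((triangleIntegral a w fun x _ => wave ρ (2 * x - π))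
        - (triangleIntegral a w fun _ t => wave ρ (2 * t - π))
        - triangleIntegral a w fun x t => wave ρ (2 * (x + a - t) - π)) := by
  obtain ⟨h1, h2, h3, e1, e2, e3⟩ := intervalIntegrable_aux ha hw ρ
  rw [← e1, ← e2, ← e3, ← intervalIntegral.integral_sub h1 h2,
    ← intervalIntegral.integral_sub (h1.sub h2) h3]
  set f : ℝ → ℂ := fun x => w (x + a) * (∫ s in a..x, w s) - w x * (∫ s in x..(π - a), w (s + a))
        - ∫ s in x..(π - a), w (s + a) * w (s + a - x) with hf
  have hsub := intervalIntegral.integral_comp_mul_sub (a := a) (b := π - a)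
    (fun ξ => f (ξ / 2 + π / 2) * wave ρ ξ) two_ne_zero π
  have e4 : ∫ ξ in -(π - a)..(π - a), quadraticPart a w ξ * wave ρ ξ
      = ∫ ξ in (2 * a - π)..(2 * (π - a) - π), f (ξ / 2 + π / 2) * wave ρ ξ := by
    rw [intervalIntegral.integral_of_le (by linarith), intervalIntegral.integral_of_le (by linarith),
      quadraticPart_eq_indicator]
    simp only [← indicator_mul_left]
    rw [setIntegral_indicator measurableSet_Ioo, integral_Ioc_eq_integral_Ioo]
    congr 2
    ext ξ
    simp only [mem_inter_iff, mem_Ioc, mem_Ioo]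
    constructor
    · rintro ⟨-, h⟩
      constructor <;> linarith [h.1, h.2]
    · rintro h
      refine ⟨⟨?_, ?_⟩, ?_, ?_⟩ <;> linarith [h.1, h.2]
  rw [e4]
  have e5 : ∫ x in a..(π - a), f ((2 * x - π) / 2 + π / 2) * wave ρ (2 * x - π)
      = ∫ x in a..(π - a), (w (x + a) * (∫ s in a..x, w s) * wave ρ (2 * x - π)
        - w x * (∫ s in x..(π - a), w (s + a)) * wave ρ (2 * x - π)
        - (∫ s in x..(π - a), w (s + a) * w (s + a - x)) * wave ρ (2 * x - π)) := by
    refine intervalIntegral.integral_congr fun x _ => ?_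
    have : (2 * x - π) / 2 + π / 2 = x := by ring
    simp only [this, hf]
    ring
  rw [← e5, hsub, Complex.real_smul]
  push_cast
  ring

end quadratic

section identity

variable {a : ℝ} {w : ℝ → ℂ}

lemma integral_zero_eq_integral_of_zero (hw0 : ∀ x ≤ a, w x = 0) (ha : 0 ≤ a) (hw : Integrable w)
    {h : ℝ → ℂ} (hh : Continuous h) (x : ℝ) :
    ∫ t in (0 : ℝ)..x, w t * h t = ∫ t in a..x, w t * h t := by
  have hi : ∀ u v, IntervalIntegrable (fun t => w t * h t) volume u v := fun u v =>
    hw.intervalIntegrable.mul_continuousOn hh.continuousOn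
  rw [← intervalIntegral.integral_add_adjacent_intervals (hi 0 a) (hi a x),
    intervalIntegral.integral_zero_ae (ae_of_all _ fun t ht => ?_), zero_add]
  rw [uIoc_of_le ha] at ht
  rw [hw0 t ht.2, zero_mul]

lemma firstApprox_eq (hw0 : ∀ x ≤ a, w x = 0) (ha : 0 ≤ a) (hw : Integrable w) (ρ : ℂ) (x : ℝ) :
    firstApprox a w ρ x = sn ρ x + ∫ s in a..x, w s * (sn ρ (x - s) * sn ρ (s - a)) := by
  rw [firstApprox, delayConv, integral_zero_eq_integral_of_zero hw0 ha hw
    (continuous_kernel isEntireFamily_sn isEntireFamily_sn ρ x)]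

lemma integral_eq_triangleIntegral (k : ℝ → ℝ → ℂ) :
    ∫ t in (2 * a)..π, w t * ∫ s in a..(t - a), w s * k (t - a) s = triangleIntegral a w k := by
  rw [triangleIntegral]
  have := intervalIntegral.integral_comp_add_right (a := a) (b := π - a)
    (fun t => w t * ∫ s in a..(t - a), w s * k (t - a) s) a
  rw [sub_add_cancel, ← two_mul] at this
  simp only [add_sub_cancel_right] at this
  rw [← this]
  simp only [intervalIntegral.integral_const_mul]

lemma two_I_mul_sn (ρ : ℂ) (y : ℝ) :
    2 * Complex.I * (ρ * sn ρ y) = wave ρ y - wave ρ (-y) := by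
  rw [mul_sn, wave_eq_cos_add_sin, wave_eq_cos_add_sin]
  simp
  ring

lemma eight_mul_sn_wave (ρ : ℂ) (t : ℝ) :
    8 * ρ ^ 2 * (wave ρ (t - π) * sn ρ (t - a))
      = -4 * Complex.I * ρ * wave ρ (2 * t - π - a) + 4 * Complex.I * ρ * wave ρ (a - π) := by
  have h1 : 8 * ρ ^ 2 * (wave ρ (t - π) * sn ρ (t - a))
      = 8 * ρ * (wave ρ (t - π) * (ρ * sn ρ (t - a))) := by ring
  have h2 := two_I_mul_sn ρ (t - a)
  have h3 : wave ρ (2 * t - π - a) = wave ρ (t - π) * wave ρ (t - a) := by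
    rw [← wave_add]; ring_nf
  have h4 : wave ρ (a - π) = wave ρ (t - π) * wave ρ (-(t - a)) := by
    rw [← wave_add]; ring_nf
  rw [h1, h3, h4]
  linear_combination (-4 * Complex.I * ρ * wave ρ (t - π)) * h2
    + 8 * ρ * wave ρ (t - π) * (ρ * sn ρ (t - a)) * Complex.I_sq

lemma eight_mul_sn_sn_wave (ρ : ℂ) (x t : ℝ) :
    8 * ρ ^ 2 * (wave ρ (x + a - π) * (sn ρ (x - t) * sn ρ (t - a)))
      = -2 * (wave ρ (2 * x - π) - wave ρ (2 * t - π) - wave ρ (2 * (x + a - t) - π))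
        - 2 * wave ρ (2 * a - π) := by
  have h1 : 8 * ρ ^ 2 * (wave ρ (x + a - π) * (sn ρ (x - t) * sn ρ (t - a)))
      = -2 * wave ρ (x + a - π) * ((2 * Complex.I * (ρ * sn ρ (x - t)))
        * (2 * Complex.I * (ρ * sn ρ (t - a)))) := by
    linear_combination 8 * ρ ^ 2 * (wave ρ (x + a - π) * (sn ρ (x - t) * sn ρ (t - a)))
      * Complex.I_sq
  have e1 : wave ρ (2 * x - π) = wave ρ (x + a - π) * (wave ρ (x - t) * wave ρ (t - a)) := by
    rw [← wave_add, ← wave_add]; ring_nf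
  have e2 : wave ρ (2 * t - π) = wave ρ (x + a - π) * (wave ρ (-(x - t)) * wave ρ (t - a)) := by
    rw [← wave_add, ← wave_add]; ring_nf
  have e3 : wave ρ (2 * (x + a - t) - π)
      = wave ρ (x + a - π) * (wave ρ (x - t) * wave ρ (-(t - a))) := by
    rw [← wave_add, ← wave_add]; ring_nf
  have e4 : wave ρ (2 * a - π)
      = wave ρ (x + a - π) * (wave ρ (-(x - t)) * wave ρ (-(t - a))) := by
    rw [← wave_add, ← wave_add]; ring_nf
  rw [h1, two_I_mul_sn, two_I_mul_sn, e1, e2, e3, e4]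
  ring

lemma sol_combination (hw : Integrable w) (ρ : ℂ) :
    solDY a w ρ π - Complex.I * (ρ * solY a w ρ π) - wave ρ (-π)
      = ∫ t in (0 : ℝ)..π, w t * (wave ρ (t - π) * firstApprox a w ρ (t - a)) := by
  have hf := isEntireFamily_firstApprox (a := a) hw
  have h1 := hw.intervalIntegrable (a := 0) (b := π) |>.mul_continuousOn
    (continuous_kernel (a := a) isEntireFamily_cs hf ρ π).continuousOn
  have h2 := hw.intervalIntegrable (a := 0) (b := π) |>.mul_continuousOn
    (continuous_kernel (a := a) isEntireFamily_sn hf ρ π).continuousOn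
  have h3 : ∫ t in (0 : ℝ)..π, w t * (wave ρ (t - π) * firstApprox a w ρ (t - a))
      = delayConv a w cs (firstApprox a w) ρ π
        - Complex.I * ρ * delayConv a w sn (firstApprox a w) ρ π := by
    rw [delayConv, delayConv, ← intervalIntegral.integral_const_mul,
      ← intervalIntegral.integral_sub h1 (h2.const_mul _)]
    refine intervalIntegral.integral_congr fun t _ => ?_
    have := cs_sub_I_mul_sn ρ (π - t)
    rw [neg_sub] at this
    rw [← this]
    ring
  rw [h3, solDY, solY, ← cs_sub_I_mul_sn]
  ring

/-- The combination `Y'(π) - iρ Y(π)` of the two characteristic functions, written with the Fourier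
transforms of the potential and of its quadratic part. -/
theorem sol_identity (hw0 : ∀ x ≤ a, w x = 0) (ha : 0 ≤ a) (ha2 : 2 * a ≤ π) (hw : Integrable w)
    (ρ : ℂ) :
    8 * ρ ^ 2 * (solDY a w ρ π - Complex.I * (ρ * solY a w ρ π) - wave ρ (-π))
      = 4 * Complex.I * ρ * (∫ t in a..π, w t) * wave ρ (a - π)
        - 4 * Complex.I * ρ * (∫ t in a..π, w t * wave ρ (2 * t - π - a))
        - (∫ ξ in -(π - a)..(π - a), quadraticPart a w ξ * wave ρ ξ)
        - 2 * (∫ t in (2 * a)..π, w t * ∫ s in a..(t - a), w s) * wave ρ (2 * a - π) := by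
  have hwc := continuous_wave ρ
  have hsc := continuous_sn ρ
  have hf := isEntireFamily_firstApprox (a := a) hw
  rw [sol_combination hw, integral_zero_eq_integral_of_zero hw0 ha hw
    (h := fun t => wave ρ (t - π) * firstApprox a w ρ (t - a))
    ((hwc.comp (by fun_prop)).mul ((hf.continuous ρ).comp (by fun_prop)))]
  have hi : ∀ {h : ℝ → ℂ}, Continuous h → ∀ u v,
      IntervalIntegrable (fun t => w t * h t) volume u v := fun {h} hh u v =>
    hw.intervalIntegrable.mul_continuousOn hh.continuousOn
  set k : ℝ → ℝ → ℂ := fun x t => wave ρ (x + a - π) * (sn ρ (x - t) * sn ρ (t - a)) with hk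
  -- the second iterate contributes an integral over a triangle
  have hc1 : Continuous fun t => wave ρ (t - π) * (firstApprox a w ρ (t - a) - sn ρ (t - a)) :=
    (hwc.comp (by fun_prop)).mul (((hf.continuous ρ).comp (by fun_prop)).sub (by fun_prop))
  have e1 : ∫ t in a..π, w t * (wave ρ (t - π) * firstApprox a w ρ (t - a))
      = (∫ t in a..π, w t * (wave ρ (t - π) * sn ρ (t - a))) + triangleIntegral a w k := by
    have e2 : ∫ t in a..π, w t * (wave ρ (t - π) * (firstApprox a w ρ (t - a) - sn ρ (t - a)))
        = ∫ t in (2 * a)..π, w t * ∫ s in a..(t - a), w s * k (t - a) s := by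
      rw [← intervalIntegral.integral_add_adjacent_intervals (b := 2 * a) (hi hc1 _ _)
        (hi hc1 _ _), intervalIntegral.integral_zero_ae (ae_of_all _ fun t ht => ?_), zero_add]
      · refine intervalIntegral.integral_congr fun t _ => ?_
        rw [firstApprox_eq hw0 ha hw, add_sub_cancel_left, ← intervalIntegral.integral_const_mul]
        congr 1
        refine intervalIntegral.integral_congr fun s _ => ?_
        simp only [hk, sub_add_cancel]
        ring
      · rw [uIoc_of_le (by linarith)] at ht
        rw [firstApprox, delayConv_eq_zero hw0 _ _ _ (by linarith [ht.1]) (by linarith [ht.2])]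
        ring
    rw [← integral_eq_triangleIntegral, ← e2,
      ← intervalIntegral.integral_add (hi (by fun_prop) _ _) (hi hc1 _ _)]
    refine intervalIntegral.integral_congr fun t _ => ?_
    ring
  have e3 : 8 * ρ ^ 2 * ∫ t in a..π, w t * (wave ρ (t - π) * sn ρ (t - a))
      = 4 * Complex.I * ρ * (∫ t in a..π, w t) * wave ρ (a - π)
        - 4 * Complex.I * ρ * (∫ t in a..π, w t * wave ρ (2 * t - π - a)) := by
    have hi1 : IntervalIntegrable (fun t => w t * wave ρ (2 * t - π - a)) volume a π :=
      hi (by fun_prop) _ _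
    have hi2 : IntervalIntegrable w volume a π := hw.intervalIntegrable
    rw [mul_right_comm (4 * Complex.I * ρ), ← intervalIntegral.integral_const_mul,
      ← intervalIntegral.integral_const_mul (4 * Complex.I * ρ * wave ρ (a - π)),
      ← intervalIntegral.integral_const_mul, ← intervalIntegral.integral_sub
        (hi2.const_mul _) (hi1.const_mul _)]
    refine intervalIntegral.integral_congr fun t _ => ?_
    linear_combination w t * eight_mul_sn_wave (a := a) ρ t
  have e4 : 8 * ρ ^ 2 * triangleIntegral a w k
      = -(∫ ξ in -(π - a)..(π - a), quadraticPart a w ξ * wave ρ ξ)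
        - 2 * (∫ t in (2 * a)..π, w t * ∫ s in a..(t - a), w s) * wave ρ (2 * a - π) := by
    have hA : ∫ t in (2 * a)..π, w t * ∫ s in a..(t - a), w s
        = triangleIntegral a w fun _ _ => 1 := by
      rw [← integral_eq_triangleIntegral]
      simp
    have hk' : (fun x t => 8 * ρ ^ 2 * k x t) = fun x t =>
        (-2 * wave ρ (2 * x - π) + 2 * wave ρ (2 * t - π))
          + (2 * wave ρ (2 * (x + a - t) - π) + -2 * wave ρ (2 * a - π) * 1) := by
      funext x t
      simp only [hk]
      rw [eight_mul_sn_sn_wave]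
      ring
    rw [← triangleIntegral_const_mul, hk', triangleIntegral_add ha2 hw (by fun_prop) (by fun_prop),
      triangleIntegral_add ha2 hw (by fun_prop) (by fun_prop),
      triangleIntegral_add ha2 hw (by fun_prop) (by fun_prop),
      integral_quadraticPart_mul_wave ha2 ha hw, hA]
    simp only [triangleIntegral_const_mul]
    ring
  rw [e1, mul_add, e3, e4]
  ring

end identity

/-! ### Estimates for the sine -/

lemma cos_int_mul_pi (m : ℤ) : Complex.cos (m * π) = (-1) ^ m := by
  have : Complex.cos (m * π) = ((Real.cos (m * π) : ℝ) : ℂ) := by push_cast; rfl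
  rw [this, Real.cos_int_mul_pi]
  push_cast
  rfl

lemma sin_pi_mul_add_int (w : ℂ) (m : ℤ) :
    Complex.sin (π * (w + m)) = (-1) ^ m * Complex.sin (π * w) := by
  rw [mul_add, Complex.sin_add, mul_comm (π : ℂ) (m : ℂ), Complex.sin_int_mul_pi]
  rw [cos_int_mul_pi]
  ring

lemma cos_pi_mul_int_add (z : ℂ) (m : ℤ) :
    Complex.cos (π * m + z) = (-1) ^ m * Complex.cos z := by
  rw [Complex.cos_add, mul_comm (π : ℂ) (m : ℂ), Complex.sin_int_mul_pi]
  rw [cos_int_mul_pi]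
  ring

lemma normSq_sin_eq (x y : ℝ) :
    ‖Complex.sin (x + y * Complex.I)‖ ^ 2 = Real.sin x ^ 2 + Real.sinh y ^ 2 := by
  rw [Complex.sin_add_mul_I, ← Complex.normSq_eq_norm_sq, ← Complex.ofReal_sin,
    ← Complex.ofReal_cosh, ← Complex.ofReal_cos, ← Complex.ofReal_sinh, ← Complex.ofReal_mul,
    ← Complex.ofReal_mul, Complex.normSq_add_mul_I]
  have h1 := Real.cosh_sq y
  have h2 := Real.sin_sq_add_cos_sq x
  linear_combination Real.sin x ^ 2 * h1 + Real.sinh y ^ 2 * h2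

/-- Away from the integers, `|sin πz|` is comparable with `e^{π |Im z|}`. -/
lemma le_norm_sin_pi_mul {z : ℂ} {δ : ℝ} (hδ0 : 0 ≤ δ) (hδ : δ ≤ 1 / 4)
    (hz : ∀ m : ℤ, δ ≤ ‖z - m‖) : δ * Real.exp (π * |z.im|) ≤ ‖Complex.sin (π * z)‖ := by
  set m := round z.re
  set u := z.re - m with hu
  set v := z.im with hv
  have hu2 : |u| ≤ 1 / 2 := abs_sub_round z.re
  have hzw : z = ((u : ℂ) + v * Complex.I) + m := by
    apply Complex.ext <;> simp [hu, hv]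
  have hw : δ ^ 2 ≤ u ^ 2 + v ^ 2 := by
    have h1 := hz m
    have h2 : ‖z - m‖ ^ 2 = u ^ 2 + v ^ 2 := by
      rw [← Complex.normSq_eq_norm_sq, Complex.normSq_apply]
      simp [hu, hv]
      ring
    nlinarith
  have hsin : ‖Complex.sin (π * z)‖ ^ 2 = Real.sin (π * u) ^ 2 + Real.sinh (π * v) ^ 2 := by
    rw [hzw, sin_pi_mul_add_int, norm_mul, norm_zpow, norm_neg, norm_one, one_zpow, one_mul,
      ← normSq_sin_eq]
    push_cast
    ring_nf
  have hs1 : 4 * u ^ 2 ≤ Real.sin (π * u) ^ 2 := by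
    have h := Real.mul_abs_le_abs_sin (x := π * u) (by
      rw [abs_mul, abs_of_pos pi_pos]; nlinarith [pi_pos])
    rw [abs_mul, abs_of_pos pi_pos, ← mul_assoc, div_mul_cancel₀ _ pi_ne_zero] at h
    rw [← sq_abs (Real.sin _), ← sq_abs u]
    nlinarith [abs_nonneg u]
  set T := Real.exp (π * |v|) with hT
  have hT1 : 1 ≤ T := Real.one_le_exp (by positivity)
  have hsh : Real.sinh (π * v) ^ 2 = ((T - T⁻¹) / 2) ^ 2 := by
    rw [← sq_abs, Real.abs_sinh, abs_mul, abs_of_pos pi_pos, Real.sinh_eq, hT, Real.exp_neg]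
  have hs2 : v ^ 2 * 9 ≤ Real.sinh (π * v) ^ 2 := by
    rw [← sq_abs (Real.sinh _), Real.abs_sinh, abs_mul, abs_of_pos pi_pos]
    have h1 : π * |v| ≤ Real.sinh (π * |v|) := Real.self_le_sinh_iff.2 (by positivity)
    have h2 : 3 * |v| ≤ π * |v| := by gcongr; exact pi_gt_three.le
    rw [← sq_abs v]
    nlinarith [abs_nonneg v]
  refine le_of_sq_le_sq ?_ (norm_nonneg _)
  rw [hsin, mul_pow]
  rcases le_total (T ^ 2) 2 with h | h
  · nlinarith [sq_nonneg u, sq_nonneg v, mul_le_mul_of_nonneg_right hw (sq_nonneg T)]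
  · have hTi : T⁻¹ ≤ T / 2 := by
      rw [inv_le_iff_one_le_mul₀ (by positivity)]
      nlinarith
    have h3 : T ^ 2 / 16 ≤ Real.sinh (π * v) ^ 2 := by
      rw [hsh]
      nlinarith
    have h4 : δ ^ 2 ≤ 1 / 16 := by nlinarith
    nlinarith [sq_nonneg u, sq_nonneg (Real.sin (π * u)), sq_nonneg T]

/-! ### Asymptotics of the characteristic functions -/

/-- The shift that turns `sin πρ` into the leading term of the `j`-th characteristic function:
`sin π(ρ + 0) = sin πρ`, `sin π(ρ + 1/2) = cos πρ`. -/
noncomputable def shift (j : Fin 2) : ℝ := ![0, 1 / 2] j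

/-- The characteristic functions in the variable `ρ`, normalized to have the leading terms `sin πρ`,
`cos πρ`. -/
noncomputable def charSol (a : ℝ) (w : ℝ → ℂ) (j : Fin 2) (ρ : ℂ) : ℂ :=
  ![ρ * solY a w ρ π, solDY a w ρ π] j

/-- The combination `Y'(π) - iρ Y(π)` minus its leading term. -/
noncomputable def solDefect (a : ℝ) (w : ℝ → ℂ) (ρ : ℂ) : ℂ :=
  solDY a w ρ π - Complex.I * (ρ * solY a w ρ π) - wave ρ (-π)

lemma sn_neg (ρ : ℂ) (x : ℝ) : sn (-ρ) x = sn ρ x := by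
  simp only [sn, neg_eq_zero, neg_mul, Complex.sin_neg, neg_div_neg_eq]

lemma cs_neg (ρ : ℂ) (x : ℝ) : cs (-ρ) x = cs ρ x := by
  simp [cs]

section

variable {a : ℝ} {w : ℝ → ℂ}

lemma firstApprox_neg (ρ : ℂ) (x : ℝ) : firstApprox a w (-ρ) x = firstApprox a w ρ x := by
  simp only [firstApprox, delayConv, sn_neg]

lemma solY_neg (ρ : ℂ) (x : ℝ) : solY a w (-ρ) x = solY a w ρ x := by
  simp only [solY, delayConv, sn_neg, firstApprox_neg]

lemma solDY_neg (ρ : ℂ) (x : ℝ) : solDY a w (-ρ) x = solDY a w ρ x := by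
  simp only [solDY, delayConv, cs_neg, firstApprox_neg]

lemma charSol_sub_sin (j : Fin 2) (ρ : ℂ) :
    charSol a w j ρ - Complex.sin (π * (ρ + shift j))
      = ![(solDefect a w (-ρ) - solDefect a w ρ) / (2 * Complex.I),
          (solDefect a w (-ρ) + solDefect a w ρ) / 2] j := by
  have h1 : Complex.sin (π * (ρ + 1 / 2)) = Complex.cos (ρ * π) := by
    rw [← Complex.sin_add_pi_div_two]
    ring_nf
  fin_cases j
  · simp only [charSol, solDefect, solY_neg, solDY_neg, shift, Fin.zero_eta, Matrix.cons_val_zero,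
      wave_eq_cos_add_sin]
    rw [eq_div_iff (by simp)]
    simp only [neg_mul, Complex.sin_neg, Complex.cos_neg, Complex.ofReal_neg, mul_neg,
      Complex.ofReal_zero, add_zero, mul_comm (π : ℂ)]
    ring
  · simp only [charSol, solDefect, solY_neg, solDY_neg, shift, Fin.mk_one, Matrix.cons_val_one,
      wave_eq_cos_add_sin, Matrix.cons_val_fin_one]
    push_cast
    rw [h1]
    simp only [neg_mul, Complex.sin_neg, Complex.cos_neg, mul_neg]
    ring

lemma exists_bound_solDefect (hw0 : ∀ x ≤ a, w x = 0) (ha : 0 ≤ a) (ha2 : 2 * a ≤ π)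
    (hw : Integrable w) :
    ∃ C, 0 < C ∧ ∀ ρ : ℂ, 1 ≤ ‖ρ‖ → ‖ρ‖ * ‖solDefect a w ρ‖ ≤ C * Real.exp (π * |ρ.im|) := by
  set A₀ := ∫ t in a..π, w t
  set A := ∫ t in (2 * a)..π, w t * ∫ s in a..(t - a), w s
  set N := ∫ t in a..π, ‖w t‖
  set M := ∫ ξ in -(π - a)..(π - a), ‖quadraticPart a w ξ‖
  have hN : 0 ≤ N := intervalIntegral.integral_nonneg (by linarith) fun t _ => norm_nonneg _
  have hM : 0 ≤ M := intervalIntegral.integral_nonneg (by linarith) fun t _ => norm_nonneg _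
  refine ⟨4 * ‖A₀‖ + 4 * N + M + 2 * ‖A‖ + 1, by positivity, fun ρ hρ => ?_⟩
  set E := Real.exp (π * |ρ.im|) with hE
  have hE0 : 0 < E := Real.exp_pos _
  have h1 : ‖wave ρ (a - π)‖ ≤ E := norm_wave_le ρ (abs_le.2 ⟨by linarith, by linarith [pi_pos]⟩)
  have h2 : ‖wave ρ (2 * a - π)‖ ≤ E :=
    norm_wave_le ρ (abs_le.2 ⟨by linarith, by linarith [pi_pos]⟩)
  have h3 : ‖∫ t in a..π, w t * wave ρ (2 * t - π - a)‖ ≤ N * E := by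
    rw [← intervalIntegral.integral_mul_const]
    refine intervalIntegral.norm_integral_le_of_norm_le (by linarith) (ae_of_all _ fun t ht => ?_)
      (hw.norm.intervalIntegrable.mul_const _)
    rw [norm_mul]
    gcongr
    exact norm_wave_le ρ (abs_le.2 ⟨by linarith [ht.1], by linarith [ht.2]⟩)
  have h4 : ‖∫ ξ in -(π - a)..(π - a), quadraticPart a w ξ * wave ρ ξ‖ ≤ M * E :=
    norm_integral_mul_wave_le (by linarith) (intervalIntegrable_quadraticPart ha2 ha hw)
      (by linarith) (by linarith) ρ
  have key := congrArg norm (sol_identity hw0 ha ha2 hw ρ)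
  have h5 : ‖ρ‖ * (8 * (‖ρ‖ * ‖solDefect a w ρ‖)) ≤ ‖ρ‖ * ((4 * ‖A₀‖ + 4 * N + M + 2 * ‖A‖) * E) := by
    have : ‖ρ‖ * (8 * (‖ρ‖ * ‖solDefect a w ρ‖))
        = ‖8 * ρ ^ 2 * (solDY a w ρ π - Complex.I * (ρ * solY a w ρ π) - wave ρ (-π))‖ := by
      rw [norm_mul, norm_mul, norm_pow, solDefect]
      simp
      ring
    rw [this, key]
    calc _ ≤ ‖4 * Complex.I * ρ * A₀ * wave ρ (a - π)‖
          + ‖4 * Complex.I * ρ * ∫ t in a..π, w t * wave ρ (2 * t - π - a)‖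
          + ‖∫ ξ in -(π - a)..(π - a), quadraticPart a w ξ * wave ρ ξ‖
          + ‖2 * A * wave ρ (2 * a - π)‖ :=
        (norm_sub_le _ _).trans (by gcongr; exact (norm_sub_le _ _).trans (by
          gcongr; exact norm_sub_le _ _))
      _ ≤ 4 * ‖ρ‖ * ‖A₀‖ * E + 4 * ‖ρ‖ * (N * E) + M * E + 2 * ‖A‖ * E := by
        simp only [norm_mul, Complex.norm_I, Complex.norm_ofNat, mul_one]
        gcongr
      _ ≤ _ := by nlinarith [mul_nonneg hM hE0.le, mul_nonneg (norm_nonneg A) hE0.le]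
  have h6 := le_of_mul_le_mul_left h5 (by linarith)
  nlinarith [mul_nonneg (norm_nonneg ρ) (norm_nonneg (solDefect a w ρ))]

lemma exists_bound_charSol (hw0 : ∀ x ≤ a, w x = 0) (ha : 0 ≤ a) (ha2 : 2 * a ≤ π)
    (hw : Integrable w) (j : Fin 2) :
    ∃ C, 0 < C ∧ ∀ ρ : ℂ, 1 ≤ ‖ρ‖ →
      ‖ρ‖ * ‖charSol a w j ρ - Complex.sin (π * (ρ + shift j))‖ ≤ C * Real.exp (π * |ρ.im|) := by
  obtain ⟨C, hC, h⟩ := exists_bound_solDefect hw0 ha ha2 hw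
  refine ⟨C, hC, fun ρ hρ => ?_⟩
  have h1 := h ρ hρ
  have h2 := h (-ρ) (by rwa [norm_neg])
  rw [Complex.neg_im, abs_neg, norm_neg] at h2
  have h3 : ‖charSol a w j ρ - Complex.sin (π * (ρ + shift j))‖
      ≤ (‖solDefect a w (-ρ)‖ + ‖solDefect a w ρ‖) / 2 := by
    rw [charSol_sub_sin]
    fin_cases j
    · simp only [Fin.zero_eta, Matrix.cons_val_zero, norm_div, norm_mul, Complex.norm_I,
        Complex.norm_ofNat, mul_one]
      gcongr
      exact norm_sub_le _ _
    · simp only [Fin.mk_one, Matrix.cons_val_one, Matrix.cons_val_fin_one, norm_div,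
        Complex.norm_ofNat]
      gcongr
      exact norm_add_le _ _
  nlinarith [norm_nonneg ρ]

/-- The second term of the asymptotics along a sequence that approaches the real axis. -/
lemma tendsto_solDefect {ι : Type*} {l : Filter ι} (hw0 : ∀ x ≤ a, w x = 0) (ha : 0 ≤ a)
    (ha2 : 2 * a ≤ π) (hw : Integrable w) {m : ι → ℝ} (hm : Tendsto m l (cocompact ℝ)) {ε : ι → ℂ}
    (hε : Tendsto ε l (𝓝 0)) :
    Tendsto (fun i => 2 * (m i + ε i) * solDefect a w (m i + ε i)
      - Complex.I * (∫ t in a..π, w t) * wave (m i + ε i) (a - π)) l (𝓝 0) := by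
  set A₀ := ∫ t in a..π, w t
  set A := ∫ t in (2 * a)..π, w t * ∫ s in a..(t - a), w s
  set ρ : ι → ℂ := fun i => m i + ε i with hρ
  have hQi := intervalIntegrable_quadraticPart ha2 ha hw
  have hwb : ∀ c : ℝ, ∀ᶠ i in l, ‖wave (ρ i) c‖ ≤ Real.exp |c| := by
    intro c
    filter_upwards [hε.norm.eventually_le_const (by simp : ‖(0 : ℂ)‖ < 1)] with i hi
    refine (norm_wave_le _ le_rfl).trans (Real.exp_le_exp.2 ?_)
    have : |(ρ i).im| ≤ 1 := by
      simp only [hρ, Complex.add_im, Complex.ofReal_im, zero_add]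
      exact (Complex.abs_im_le_norm _).trans hi
    nlinarith [abs_nonneg c]
  have hρinf : Tendsto (fun i => ‖ρ i‖) l atTop := by
    have h1 : Tendsto (fun i => ‖m i‖ - ‖ε i‖) l atTop := by
      have := tendsto_norm_cocompact_atTop.comp hm
      exact this.atTop_add (C := -0) (by simpa using hε.norm.neg)
    refine tendsto_atTop_mono (fun i => ?_) h1
    have := norm_sub_norm_le (m i : ℂ) (-ε i)
    simpa [hρ] using this
  -- the linear term tends to zero by the Riemann-Lebesgue lemma
  have hF : Tendsto (fun i => ∫ t in a..π, w t * wave (ρ i) (2 * t - π - a)) l (𝓝 0) := by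
    have hc : Tendsto (fun i => 2 * m i) l (cocompact ℝ) :=
      (Homeomorph.mulLeft₀ (2 : ℝ) two_ne_zero).isClosedEmbedding.tendsto_cocompact.comp hm
    have h1 := tendsto_integral_mul_wave (by linarith : a ≤ π) (hw.intervalIntegrable) hc
      (by simpa using hε.const_mul 2 : Tendsto (fun i => 2 * ε i) l (𝓝 0))
    have h2 := h1.zero_mul_isBoundedUnder_le (g := fun i => wave (ρ i) (-(π + a)))
      ⟨_, (hwb (-(π + a)))⟩
    refine h2.congr fun i => ?_
    rw [← intervalIntegral.integral_mul_const]
    refine intervalIntegral.integral_congr fun t _ => ?_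
    have : wave (ρ i) (2 * t - π - a) = wave (((2 * m i : ℝ) : ℂ) + 2 * ε i) t
        * wave (ρ i) (-(π + a)) := by
      simp only [wave, ← Complex.exp_add, hρ]
      push_cast
      ring_nf
    simp only [this, mul_assoc]
  have hB : Tendsto (fun i => (ρ i)⁻¹ *
      ((∫ ξ in -(π - a)..(π - a), quadraticPart a w ξ * wave (ρ i) ξ)
        + 2 * A * wave (ρ i) (2 * a - π))) l (𝓝 0) := by
    refine (tendsto_inv₀_cobounded.comp (tendsto_norm_atTop_iff_cobounded.1 hρinf)
      ).zero_mul_isBoundedUnder_le ?_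
    refine ⟨(∫ ξ in -(π - a)..(π - a), ‖quadraticPart a w ξ‖) * Real.exp (π * 1)
      + ‖2 * A‖ * Real.exp |2 * a - π|, ?_⟩
    simp only [eventually_map]
    filter_upwards [hwb (2 * a - π), hε.norm.eventually_le_const (by simp : ‖(0 : ℂ)‖ < 1)]
      with i h1 hi
    refine (norm_add_le _ _).trans (add_le_add ?_ ?_)
    · refine (norm_integral_mul_wave_le (b := π) (by linarith) hQi (by linarith) (by linarith)
        _).trans ?_
      have : |(ρ i).im| ≤ 1 := by
        simp only [hρ, Complex.add_im, Complex.ofReal_im, zero_add]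
        exact (Complex.abs_im_le_norm _).trans hi
      gcongr
      exact intervalIntegral.integral_nonneg (by linarith) fun t _ => norm_nonneg _
    · rw [norm_mul]
      gcongr
  have hsum := (hF.const_mul (-Complex.I)).sub (hB.const_mul (1 / 4))
  rw [mul_zero, mul_zero, sub_zero] at hsum
  refine hsum.congr' ?_
  filter_upwards [hρinf.eventually_gt_atTop 0] with i hi
  have hne : ρ i ≠ 0 := norm_pos_iff.1 hi
  have key := sol_identity hw0 ha ha2 hw (ρ i)
  change 8 * ρ i ^ 2 * solDefect a w (ρ i) = _ at key
  have h4 : 2 * ρ i * solDefect a w (ρ i)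
      = (4 * ρ i)⁻¹ * (8 * ρ i ^ 2 * solDefect a w (ρ i)) := by
    field_simp
    ring
  change _ = 2 * ρ i * solDefect a w (ρ i) - _
  rw [h4, key]
  field_simp
  ring

/-- `2ρ (Δ(ρ²) - leading term) + A₀ cos(...)` tends to zero, for both characteristic functions. -/
lemma tendsto_charSol {ι : Type*} {l : Filter ι} (hw0 : ∀ x ≤ a, w x = 0) (ha : 0 ≤ a)
    (ha2 : 2 * a ≤ π) (hw : Integrable w) {m : ι → ℝ} (hm : Tendsto m l (cocompact ℝ)) {ε : ι → ℂ}
    (hε : Tendsto ε l (𝓝 0)) (j : Fin 2) :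
    Tendsto (fun i => 2 * (m i + ε i) * (charSol a w j (m i + ε i)
        - Complex.sin (π * (m i + ε i + shift j)))
      + (∫ t in a..π, w t) * Complex.cos (π * (m i + ε i + shift j) - (m i + ε i) * a)) l
      (𝓝 0) := by
  have h1 := tendsto_solDefect hw0 ha ha2 hw hm hε
  have hm' : Tendsto (fun i => -m i) l (cocompact ℝ) :=
    (Homeomorph.neg ℝ).isClosedEmbedding.tendsto_cocompact.comp hm
  have h2 := tendsto_solDefect hw0 ha ha2 hw hm' (by simpa using hε.neg)
  have hneg : ∀ i, ((-m i : ℝ) : ℂ) + -ε i = -(m i + ε i) := fun i => by push_cast; ring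
  simp only [hneg, wave_neg, neg_sub] at h2
  simp only [charSol_sub_sin]
  set A₀ := ∫ t in a..π, w t
  have hw1 : ∀ ρ : ℂ, wave ρ (π - a)
      = Complex.cos (ρ * (π - a)) + Complex.I * Complex.sin (ρ * (π - a)) := fun ρ => by
    rw [wave_eq_cos_add_sin]; push_cast; rfl
  have hw2 : ∀ ρ : ℂ, wave ρ (a - π)
      = Complex.cos (ρ * (π - a)) - Complex.I * Complex.sin (ρ * (π - a)) := fun ρ => by
    rw [wave_eq_cos_add_sin]
    have : ρ * ((a - π : ℝ) : ℂ) = -(ρ * (π - a)) := by push_cast; ring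
    rw [this, Complex.cos_neg, Complex.sin_neg]; ring
  simp only [hw1] at h2
  simp only [hw2] at h1
  fin_cases j
  · have h3 := (h2.add h1).mul_const (-1 / (2 * Complex.I))
    rw [add_zero, zero_mul] at h3
    refine h3.congr fun i => ?_
    have e : π * (m i + ε i + ((shift 0 : ℝ) : ℂ)) - (m i + ε i) * a = (m i + ε i) * (π - a) := by
      simp [shift]; ring
    simp only [Fin.zero_eta, Matrix.cons_val_zero, e]
    field_simp
    ring
  · have h3 := (h1.sub h2).mul_const (1 / 2)
    rw [sub_zero, zero_mul] at h3
    refine h3.congr fun i => ?_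
    have e : π * (m i + ε i + ((shift 1 : ℝ) : ℂ)) - (m i + ε i) * a
        = (m i + ε i) * (π - a) + π / 2 := by
      simp [shift]; ring
    simp only [Fin.mk_one, Matrix.cons_val_one, Matrix.cons_val_fin_one, e,
      Complex.cos_add_pi_div_two]
    linear_combination (A₀ * Complex.sin ((m i + ε i) * (π - a))) * Complex.I_sq

end

/-! ### Zeros of entire functions -/

lemma analyticOrderAt_ne_top_of_entire {f : ℂ → ℂ} (hf : Differentiable ℂ f) {z₀ : ℂ}
    (h0 : f z₀ ≠ 0) (z : ℂ) : analyticOrderAt f z ≠ ⊤ := by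
  intro h
  have h1 := (AnalyticOnNhd.analyticOrderAt_eq_top_iff_eq_zero (f := f) z
    (fun z => hf.analyticAt z)).1 h
  exact h0 (by rw [h1]; rfl)

/-- Entire functions with the same zeros, multiplicities included, have an entire quotient. -/
lemma exists_entire_quotient {f g : ℂ → ℂ} (hf : Differentiable ℂ f) (hg : Differentiable ℂ g)
    (hord : ∀ z, analyticOrderAt f z = analyticOrderAt g z)
    (htop : ∀ z, analyticOrderAt g z ≠ ⊤) :
    ∃ h : ℂ → ℂ, Differentiable ℂ h ∧ ∀ z, f z = h z * g z := by
  have key : ∀ z₀ : ℂ, ∃ F G : ℂ → ℂ, AnalyticAt ℂ F z₀ ∧ AnalyticAt ℂ G z₀ ∧ G z₀ ≠ 0 ∧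
      (∃ n : ℕ, (∀ᶠ z in 𝓝 z₀, f z = (z - z₀) ^ n * F z) ∧
        ∀ᶠ z in 𝓝 z₀, g z = (z - z₀) ^ n * G z) := by
    intro z₀
    obtain ⟨n, hn⟩ := ENat.ne_top_iff_exists.1 (htop z₀)
    obtain ⟨F, hF, hF0, hFe⟩ := ((hf.analyticAt z₀).analyticOrderAt_eq_natCast (n := n)).1
      (by rw [hord, hn])
    obtain ⟨G, hG, hG0, hGe⟩ := ((hg.analyticAt z₀).analyticOrderAt_eq_natCast (n := n)).1 hn.symm
    exact ⟨F, G, hF, hG, hG0, n, hFe, hGe⟩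
  set h : ℂ → ℂ := fun z => limUnder (𝓝[≠] z) fun u => f u / g u with hh
  have hloc : ∀ z₀ : ℂ, ∃ F G : ℂ → ℂ, AnalyticAt ℂ F z₀ ∧ AnalyticAt ℂ G z₀ ∧ G z₀ ≠ 0 ∧
      (∃ n : ℕ, (∀ᶠ z in 𝓝 z₀, f z = (z - z₀) ^ n * F z) ∧
        ∀ᶠ z in 𝓝 z₀, g z = (z - z₀) ^ n * G z) ∧ h =ᶠ[𝓝 z₀] fun z => F z / G z := by
    intro z₀
    obtain ⟨F, G, hF, hG, hG0, n, hFe, hGe⟩ := key z₀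
    refine ⟨F, G, hF, hG, hG0, ⟨n, hFe, hGe⟩, ?_⟩
    have hGne := hG.continuousAt.eventually_ne hG0
    filter_upwards [hFe.eventually_nhds, hGe.eventually_nhds, hGne.eventually_nhds,
      hF.eventually_analyticAt, hG.eventually_analyticAt] with z h1 h2 h3 h4 h5
    refine Tendsto.limUnder_eq ?_
    have hc : Tendsto (fun u => F u / G u) (𝓝[≠] z) (𝓝 (F z / G z)) :=
      ((h4.continuousAt.div h5.continuousAt h3.self_of_nhds).tendsto).mono_left nhdsWithin_le_nhds
    refine hc.congr' ?_
    have hne : ∀ᶠ u in 𝓝[≠] z, u ≠ z₀ := by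
      by_cases hz : z = z₀
      · rw [hz]; exact self_mem_nhdsWithin
      · exact nhdsWithin_le_nhds (isOpen_ne.mem_nhds hz)
    filter_upwards [nhdsWithin_le_nhds h1, nhdsWithin_le_nhds h2, hne] with u e1 e2 e3
    rw [e1, e2, mul_div_mul_left _ _ (pow_ne_zero _ (sub_ne_zero.2 e3))]
  refine ⟨h, fun z₀ => ?_, fun z₀ => ?_⟩
  · obtain ⟨F, G, hF, hG, hG0, -, he⟩ := hloc z₀
    exact (hF.differentiableAt.div hG.differentiableAt hG0).congr_of_eventuallyEq he
  · obtain ⟨F, G, hF, hG, hG0, ⟨n, h1, h2⟩, he⟩ := hloc z₀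
    rw [h1.self_of_nhds, h2.self_of_nhds, he.self_of_nhds]
    field_simp

lemma norm_sub_one_le_of_sphere {h : ℂ → ℂ} (hh : Differentiable ℂ h) {r ε : ℝ} (hr : 0 < r)
    (hs : ∀ z, ‖z‖ = r → ‖h z - 1‖ ≤ ε) {z : ℂ} (hz : ‖z‖ ≤ r) : ‖h z - 1‖ ≤ ε := by
  refine Complex.norm_le_of_forall_mem_frontier_norm_le (U := Metric.ball 0 r)
    Metric.isBounded_ball (f := fun z => h z - 1) (hh.sub_const 1).diffContOnCl (fun w hw => ?_) ?_
  · rw [frontier_ball _ hr.ne'] at hw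
    exact hs w (by simpa using hw)
  · rw [closure_ball _ hr.ne']
    simpa using hz

/-- Entire functions with the same zeros that are asymptotic on large circles coincide: their
quotient is entire and close to `1` on the circles. -/
lemma eq_of_order_eq_of_asymptotic {f g : ℂ → ℂ} (hf : Differentiable ℂ f)
    (hg : Differentiable ℂ g) (hord : ∀ z, analyticOrderAt f z = analyticOrderAt g z)
    {r : ℕ → ℝ} (hr : Tendsto r atTop atTop)
    (hfg : ∀ ε > 0, ∀ᶠ N in atTop, ∀ z, ‖z‖ = r N → g z ≠ 0 ∧ ‖f z - g z‖ ≤ ε * ‖g z‖) :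
    f = g := by
  obtain ⟨N, hN, hN1⟩ := ((hfg 1 one_pos).and (hr.eventually_ge_atTop 0)).exists
  have hg0 : g (r N) ≠ 0 := (hN (r N) (by simpa using abs_of_nonneg hN1)).1
  obtain ⟨h, hh, he⟩ := exists_entire_quotient hf hg hord
    (analyticOrderAt_ne_top_of_entire hg hg0)
  funext z
  have : ‖h z - 1‖ ≤ 0 := by
    refine le_of_forall_pos_le_add fun ε hε => ?_
    obtain ⟨N, hN, hN1, hN2⟩ := ((hfg ε hε).and ((hr.eventually_ge_atTop ‖z‖).and
      (hr.eventually_gt_atTop 0))).exists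
    rw [zero_add]
    refine norm_sub_one_le_of_sphere hh hN2 (fun u hu => ?_) hN1
    obtain ⟨h1, h2⟩ := hN u hu
    have h3 : f u - g u = (h u - 1) * g u := by rw [he]; ring
    rw [h3, norm_mul] at h2
    exact le_of_mul_le_mul_right h2 (norm_pos_iff.2 h1)
  have h1 : h z = 1 := by
    rw [norm_le_zero_iff, sub_eq_zero] at this
    exact this
  rw [he, h1, one_mul]

/-- The sequence `c` lists the zeros of `f` according to multiplicity. -/
def IsZeroSeq (f : ℂ → ℂ) (c : ℕ → ℂ) : Prop :=
  ∀ z, {n | c n = z}.encard = analyticOrderAt f z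

/-- Splitting off finitely many zeros. -/
lemma IsZeroSeq.exists_factorization {f : ℂ → ℂ} (hf : Differentiable ℂ f) {c : ℕ → ℂ}
    (hc : IsZeroSeq f c) (S : Finset ℕ) :
    ∃ g : ℂ → ℂ, Differentiable ℂ g ∧ (∀ z, f z = (∏ k ∈ S, (z - c k)) * g z) ∧
      ∀ z, {n | n ∉ S ∧ c n = z}.encard = analyticOrderAt g z := by
  induction S using Finset.induction_on with
  | empty => exact ⟨f, hf, by simp, by simpa using! hc⟩
  | insert k S hk ih =>
    obtain ⟨g, hg, hfg, hord⟩ := ih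
    have hsplit : ∀ z, {n | n ∉ S ∧ c n = z}.encard
        = {n | n ∉ insert k S ∧ c n = z}.encard + {n | n = k ∧ c n = z}.encard := by
      intro z
      rw [← encard_union_eq]
      · congr 1
        ext n
        simp only [mem_ofPred_eq, Finset.mem_insert, mem_union]
        by_cases h : n = k
        · subst h; tauto
        · tauto
      · rw [disjoint_left]
        rintro n ⟨h1, -⟩ ⟨h2, -⟩
        exact h1 (by simp [h2])
    have hgk : g (c k) = 0 := by
      have h1 : analyticOrderAt g (c k) ≠ 0 := by
        rw [← hord, encard_ne_zero]
        exact ⟨k, hk, rfl⟩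
      exact apply_eq_zero_of_analyticOrderAt_ne_zero h1
    have hdd : Differentiable ℂ (dslope g (c k)) := fun z =>
      ((Complex.differentiableOn_dslope (s := univ) univ_mem).2
        hg.differentiableOn z (mem_univ z)).differentiableAt univ_mem
    have hmul : ∀ z, g z = (z - c k) * dslope g (c k) z := fun z => by
      have := sub_smul_dslope g (c k) z
      rw [hgk, sub_zero, smul_eq_mul] at this
      exact this.symm
    refine ⟨dslope g (c k), hdd, fun z => ?_, fun z => ?_⟩
    · rw [Finset.prod_insert hk, hfg, hmul z]
      ring
    · have h1 : analyticOrderAt g z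
          = analyticOrderAt (fun z => z - c k) z + analyticOrderAt (dslope g (c k)) z := by
        rw [← analyticOrderAt_mul (by fun_prop) (hdd.analyticAt z)]
        exact analyticOrderAt_congr (Eventually.of_forall hmul)
      have h2 : analyticOrderAt (fun z => z - c k) z = {n | n = k ∧ c n = z}.encard := by
        by_cases hz : c k = z
        · have : {n | n = k ∧ c n = z} = {k} := by ext n; simp; rintro rfl; exact hz
          rw [this, encard_singleton, ← hz]
          exact analyticOrderAt_id_sub_const_self
        · have : {n | n = k ∧ c n = z} = ∅ := by
            ext n; simp; rintro rfl; exact hz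
          rw [this, encard_empty]
          exact analyticOrderAt_id_sub_const_of_ne (Ne.symm hz)
      have h3 := hsplit z
      rw [hord, h1, h2, add_comm] at h3
      refine (WithTop.add_right_cancel ?_ h3).symm
      refine ne_top_of_le_ne_top ENat.one_ne_top (encard_le_one_iff.2 ?_)
      rintro x y ⟨h, -⟩ ⟨h', -⟩
      rw [h, h']

lemma finite_zeros_closedBall {f : ℂ → ℂ} (hf : Differentiable ℂ f) {z₀ : ℂ} (h0 : f z₀ ≠ 0)
    (r : ℝ) : ({z | f z = 0} ∩ Metric.closedBall 0 r).Finite := by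
  by_contra hinf
  obtain ⟨x, -, hx⟩ := Set.Infinite.exists_accPt_of_subset_isCompact hinf
    (isCompact_closedBall (0 : ℂ) r) inter_subset_right
  have h1 : ∃ᶠ z in 𝓝[≠] x, f z = 0 :=
    (accPt_iff_frequently_nhdsNE.1 hx).mono fun z hz => hz.1
  have h2 := (hf.analyticAt x).frequently_zero_iff_eventually_zero.1 h1
  exact analyticOrderAt_ne_top_of_entire hf h0 x (analyticOrderAt_eq_top.2 h2)

lemma IsZeroSeq.apply_eq_zero {f : ℂ → ℂ} {c : ℕ → ℂ} (hc : IsZeroSeq f c) (n : ℕ) :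
    f (c n) = 0 := by
  refine apply_eq_zero_of_analyticOrderAt_ne_zero (𝕜 := ℂ) ?_
  rw [← hc, encard_ne_zero]
  exact ⟨n, rfl⟩

lemma IsZeroSeq.finite {f : ℂ → ℂ} (hf : Differentiable ℂ f) {z₀ : ℂ} (h0 : f z₀ ≠ 0)
    {c : ℕ → ℂ} (hc : IsZeroSeq f c) (r : ℝ) : {n | ‖c n‖ < r}.Finite := by
  refine ((finite_zeros_closedBall hf h0 r).biUnion (t := fun z => {n | c n = z})
    fun z _ => ?_).subset fun n hn => ?_
  · rw [← encard_ne_top_iff, hc]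
    exact analyticOrderAt_ne_top_of_entire hf h0 z
  · simp only [mem_iUnion, mem_ofPred_eq]
    exact ⟨c n, ⟨hc.apply_eq_zero n, by simpa using (show ‖c n‖ < r from hn).le⟩, rfl⟩

lemma circleIntegral_logDeriv_prod {g : ℂ → ℂ} (hg : Differentiable ℂ g) {r : ℝ} (hr : 0 < r)
    (hg0 : ∀ z, ‖z‖ ≤ r → g z ≠ 0) (c : ℕ → ℂ) (S : Finset ℕ) (hS : ∀ k ∈ S, ‖c k‖ < r) :
    (∮ z in C(0, r), logDeriv (fun z => (∏ k ∈ S, (z - c k)) * g z) z)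
      = S.card * (2 * π * Complex.I) := by
  induction S using Finset.induction_on with
  | empty =>
    have : (∮ z in C(0, r), logDeriv g z) = 0 := by
      refine DiffContOnCl.circleIntegral_eq_zero hr.le ?_
      refine DifferentiableOn.diffContOnCl_ball (U := {z | g z ≠ 0}) ?_ fun z hz => hg0 z (by
        simpa using hz)
      intro z hz
      exact (((hg.analyticAt z).deriv.differentiableAt).div (hg z) hz).differentiableWithinAt
    simpa using this
  | insert k S hk ih =>
    have hkr := hS k (Finset.mem_insert_self _ _)
    have hS' : ∀ i ∈ S, ‖c i‖ < r := fun i hi => hS i (Finset.mem_insert_of_mem hi)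
    set F : ℂ → ℂ := fun z => (∏ k ∈ S, (z - c k)) * g z with hF
    have hFd : Differentiable ℂ F := by
      refine Differentiable.mul ?_ hg
      fun_prop
    have hne : ∀ i, ‖c i‖ < r → ∀ z : ℂ, ‖z‖ = r → z - c i ≠ 0 := by
      intro i hi z hz h
      rw [sub_eq_zero] at h
      rw [h] at hz
      exact hi.ne hz
    have hF0 : ∀ z : ℂ, ‖z‖ = r → F z ≠ 0 := fun z hz =>
      mul_ne_zero (Finset.prod_ne_zero_iff.2 fun i hi => hne i (hS' i hi) z hz) (hg0 z hz.le)
    have h1 : (∮ z in C(0, r), logDeriv (fun z => (∏ k ∈ insert k S, (z - c k)) * g z) z)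
        = ∮ z in C(0, r), ((z - c k)⁻¹ + logDeriv F z) := by
      refine circleIntegral.integral_congr hr.le fun z hz => ?_
      have hz' : ‖z‖ = r := by simpa using hz
      have : (fun z => (∏ k ∈ insert k S, (z - c k)) * g z) = fun z => (z - c k) * F z := by
        funext z
        rw [Finset.prod_insert hk, mul_assoc]
      simp only [this]
      rw [logDeriv_mul z (hne k hkr z hz') (hF0 z hz') (by fun_prop) (hFd z)]
      congr 1
      simp [logDeriv_apply]
    rw [h1, circleIntegral.integral_add, ih hS', circleIntegral.integral_sub_inv_of_mem_ball
      (by simpa using hkr), Finset.card_insert_of_notMem hk]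
    · push_cast; ring
    · refine ContinuousOn.circleIntegrable hr.le ?_
      refine ContinuousOn.inv₀ (by fun_prop) fun z hz => hne k hkr z (by simpa using hz)
    · refine ContinuousOn.circleIntegrable hr.le fun z hz => ?_
      exact (((hFd.analyticAt z).deriv.continuousAt).div hFd.continuous.continuousAt
        (hF0 z (by simpa using hz))).continuousWithinAt

/-- The argument principle. -/
lemma IsZeroSeq.circleIntegral_logDeriv {f : ℂ → ℂ} (hf : Differentiable ℂ f) {c : ℕ → ℂ}
    (hc : IsZeroSeq f c) {r : ℝ} (hr : 0 < r) (h0 : ∀ z, ‖z‖ = r → f z ≠ 0) :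
    (∮ z in C(0, r), logDeriv f z) = {n | ‖c n‖ < r}.ncard * (2 * π * Complex.I) := by
  have hfin := hc.finite hf (h0 r (by simpa using hr.le)) r
  obtain ⟨g, hg, hfg, hord⟩ := hc.exists_factorization hf hfin.toFinset
  rw [Set.ncard_eq_toFinset_card _ hfin, funext hfg]
  refine circleIntegral_logDeriv_prod hg hr (fun z hz => ?_) c _ fun k hk => by simpa using hk
  rcases hz.lt_or_eq with h | h
  · rw [← (hg.analyticAt z).analyticOrderAt_eq_zero, ← hord, encard_eq_zero]
    ext n
    simp only [Finite.mem_toFinset, mem_ofPred_eq, mem_empty_iff_false, iff_false, not_and]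
    rintro h1 rfl
    exact h1 h
  · intro h1
    exact h0 z h (by rw [hfg, h1, mul_zero])

/-- Rouché's theorem, in terms of enumerations of the zeros. -/
lemma IsZeroSeq.ncard_eq {f g : ℂ → ℂ} (hf : Differentiable ℂ f) (hg : Differentiable ℂ g)
    {c d : ℕ → ℂ} (hc : IsZeroSeq f c) (hd : IsZeroSeq g d) {r : ℝ} (hr : 0 < r)
    (h : ∀ z, ‖z‖ = r → ‖f z - g z‖ < ‖g z‖) :
    {n | ‖c n‖ < r}.ncard = {n | ‖d n‖ < r}.ncard := by
  have hg0 : ∀ z, ‖z‖ = r → g z ≠ 0 := fun z hz h0 => by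
    have := h z hz
    rw [h0, norm_zero] at this
    exact this.not_ge (norm_nonneg _)
  have hf0 : ∀ z, ‖z‖ = r → f z ≠ 0 := fun z hz h0 => by
    have := h z hz
    rw [h0, zero_sub, norm_neg] at this
    exact this.false
  -- `f'/f - g'/g` is the derivative of `log (f / g)`
  have hdiff : (∮ z in C(0, r), (logDeriv f z - logDeriv g z)) = 0 := by
    refine circleIntegral.integral_eq_zero_of_hasDerivWithinAt hr.le
      (f := fun z => Complex.log (f z / g z)) fun z hz => ?_
    have hz' : ‖z‖ = r := by simpa using hz
    have hslit : f z / g z ∈ Complex.slitPlane := by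
      refine Complex.mem_slitPlane_of_norm_lt_one (z := f z / g z - 1) ?_ |> fun h => by simpa using h
      rw [div_sub_one (hg0 z hz'), norm_div, div_lt_one (norm_pos_iff.2 (hg0 z hz'))]
      exact h z hz'
    have h1 := (((hf z).hasDerivAt.div (hg z).hasDerivAt (hg0 z hz')).clog hslit)
    refine (h1.congr_deriv ?_).hasDerivWithinAt
    have := hf0 z hz'
    have := hg0 z hz'
    simp only [logDeriv_apply, Pi.div_apply]
    field_simp
  have hci : ∀ {F : ℂ → ℂ}, Differentiable ℂ F → (∀ z, ‖z‖ = r → F z ≠ 0) →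
      CircleIntegrable (logDeriv F) 0 r := fun {F} hF hF0 =>
    ContinuousOn.circleIntegrable hr.le fun z hz =>
      (((hF.analyticAt z).deriv.continuousAt).div hF.continuous.continuousAt
        (hF0 z (by simpa using hz))).continuousWithinAt
  rw [circleIntegral.integral_sub (hci hf hf0) (hci hg hg0),
    hc.circleIntegral_logDeriv hf hr hf0, hd.circleIntegral_logDeriv hg hr hg0, ← sub_mul,
    mul_eq_zero, sub_eq_zero] at hdiff
  rcases hdiff with h1 | h1
  · exact_mod_cast h1
  · exact absurd h1 Complex.two_pi_I_ne_zero

/-! ### Comparison with the zero potential on large circles -/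

section comparison

variable {a : ℝ} {q : ℝ → ℂ}

lemma isPotential_zero (a : ℝ) : IsPotential a 0 :=
  ⟨integrableOn_zero, fun _ _ => rfl⟩

lemma charSol_eq (ha : 0 < a) (ha3 : π ≤ 3 * a) (hq : IsPotential a q) (j : Fin 2) (ρ : ℂ) :
    charSol a (cutoff a q) j ρ = ![ρ, 1] j * characteristicFn a q j (ρ ^ 2) := by
  rw [characteristicFn_sq ha ha3 hq, charSol]
  fin_cases j <;> simp

lemma charSol_zero (j : Fin 2) (ρ : ℂ) :
    charSol a (cutoff a 0) j ρ = Complex.sin (π * (ρ + shift j)) := by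
  have h0 : cutoff a 0 = 0 := by
    funext x
    simp [cutoff]
  have h1 : Complex.sin (π * (ρ + 1 / 2)) = Complex.cos (ρ * π) := by
    rw [← Complex.sin_add_pi_div_two]
    ring_nf
  fin_cases j
  · simp [charSol, solY, delayConv, h0, mul_sn, shift, mul_comm]
  · simp only [charSol, solDY, delayConv, h0, shift, Fin.mk_one, Matrix.cons_val_one,
      Matrix.cons_val_fin_one]
    push_cast
    rw [h1]
    simp [cs]

lemma weight_mul_characteristicFn_zero (ha : 0 < a) (ha3 : π ≤ 3 * a) (j : Fin 2) (ρ : ℂ) :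
    ![ρ, 1] j * characteristicFn a 0 j (ρ ^ 2) = Complex.sin (π * (ρ + shift j)) := by
  rw [← charSol_eq ha ha3 (isPotential_zero a), charSol_zero]

/-- Radii of circles that stay away from the zeros `(n - shift j)²` of the characteristic function of
the zero potential. -/
noncomputable def radius (j : Fin 2) (N : ℕ) : ℝ := (N + 1 / 2 - shift j) ^ 2

lemma shift_eq (j : Fin 2) : shift j = 0 ∨ shift j = 1 / 2 := by
  fin_cases j <;> simp [shift]

lemma shift_nonneg (j : Fin 2) : 0 ≤ shift j := by
  rcases shift_eq j with h | h <;> rw [h]; norm_num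

lemma shift_le (j : Fin 2) : shift j ≤ 1 / 2 := by
  rcases shift_eq j with h | h <;> rw [h]; norm_num

lemma tendsto_radius (j : Fin 2) : Tendsto (radius j) atTop atTop := by
  have h1 : Tendsto (fun N : ℕ => (N : ℝ) + (1 / 2 - shift j)) atTop atTop :=
    tendsto_atTop_add_const_right _ _ tendsto_natCast_atTop_atTop
  refine ((tendsto_pow_atTop two_ne_zero).comp h1).congr fun N => ?_
  simp only [Function.comp, radius]
  ring

lemma quarter_le_norm_add_shift_sub_int {j : Fin 2} {N : ℕ} {ρ : ℂ}
    (hρ : ‖ρ‖ = N + 1 / 2 - shift j) (m : ℤ) : 1 / 4 ≤ ‖ρ + shift j - m‖ := by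
  have h1 : |‖ρ‖ - ‖((m - shift j : ℝ) : ℂ)‖| ≤ ‖ρ + shift j - m‖ := by
    refine (abs_norm_sub_norm_le ρ _).trans (le_of_eq ?_)
    congr 1
    push_cast
    ring
  refine le_trans ?_ h1
  rw [hρ, Complex.norm_real, Real.norm_eq_abs]
  have key : ∀ k : ℤ, (1 : ℝ) / 2 ≤ |(k : ℝ) + 1 / 2| := by
    intro k
    rcases le_or_gt 0 k with hk | hk
    · have : (0 : ℝ) ≤ k := by exact_mod_cast hk
      rw [abs_of_nonneg (by linarith)]
      linarith
    · have : (k : ℝ) ≤ -1 := by exact_mod_cast Int.le_sub_one_of_lt hk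
      rw [abs_of_nonpos (by linarith)]
      linarith
  rcases shift_eq j with h | h <;> rw [h]
  · obtain ⟨k, hk⟩ : ∃ k : ℤ, (N : ℝ) + 1 / 2 - 0 - |(m : ℝ) - 0| = k + 1 / 2 :=
      ⟨N - |m|, by push_cast; ring_nf⟩
    rw [hk]
    linarith [key k]
  · obtain ⟨k, hk⟩ : ∃ k : ℤ, (N : ℝ) + 1 / 2 - 1 / 2 - |(m : ℝ) - 1 / 2| = k + 1 / 2 := by
      rcases le_or_gt 1 m with hm | hm
      · refine ⟨N - m, ?_⟩
        have : (1 : ℝ) ≤ m := by exact_mod_cast hm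
        rw [abs_of_nonneg (by linarith)]
        push_cast
        ring
      · refine ⟨N + m - 1, ?_⟩
        have : (m : ℝ) ≤ 0 := by exact_mod_cast Int.le_of_lt_add_one hm
        rw [abs_of_nonpos (by linarith)]
        push_cast
        ring
    rw [hk]
    linarith [key k]

/-- On large circles the characteristic function is asymptotic to that of the zero potential. -/
lemma characteristicFn_asymptotic (ha : 0 < a) (ha2 : 2 * a ≤ π) (ha3 : π ≤ 3 * a)
    (hq : IsPotential a q) (j : Fin 2) {ε : ℝ} (hε : 0 < ε) :
    ∀ᶠ N in atTop, ∀ μ : ℂ, ‖μ‖ = radius j N → characteristicFn a 0 j μ ≠ 0 ∧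
      ‖characteristicFn a q j μ - characteristicFn a 0 j μ‖ ≤ ε * ‖characteristicFn a 0 j μ‖ := by
  obtain ⟨C, hC, hbound⟩ := exists_bound_charSol (a := a) (w := cutoff a q)
    (fun x hx => cutoff_of_le hx) ha.le ha2 (integrable_cutoff hq) j
  filter_upwards [eventually_ge_atTop (max 1 ⌈4 * C / ε⌉₊)] with N hN μ hμ
  obtain ⟨ρ, rfl⟩ : ∃ ρ : ℂ, ρ ^ 2 = μ := IsAlgClosed.exists_pow_nat_eq μ two_pos
  have hN1 : (1 : ℝ) ≤ N := by exact_mod_cast (le_max_left _ _).trans hN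
  have hNC : 4 * C / ε ≤ N := (Nat.le_ceil _).trans (by exact_mod_cast (le_max_right _ _).trans hN)
  have hsh := shift_le j
  have hρ : ‖ρ‖ = N + 1 / 2 - shift j := by
    rw [norm_pow, radius] at hμ
    exact (sq_eq_sq₀ (norm_nonneg _) (by linarith)).1 hμ
  have hρN : (N : ℝ) ≤ ‖ρ‖ := by rw [hρ]; linarith
  have hρ1 : 1 ≤ ‖ρ‖ := hN1.trans hρN
  have hlow := le_norm_sin_pi_mul (z := ρ + shift j) (by norm_num : (0 : ℝ) ≤ 1 / 4) le_rfl
    (quarter_le_norm_add_shift_sub_int hρ)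
  have him : (ρ + (shift j : ℂ)).im = ρ.im := by simp
  rw [him] at hlow
  have hb := hbound ρ hρ1
  set E := Real.exp (π * |ρ.im|) with hE
  have hE0 : 0 < E := Real.exp_pos _
  have hsin : 0 < ‖Complex.sin (π * (ρ + shift j))‖ := lt_of_lt_of_le (by positivity) hlow
  rw [charSol_eq ha ha3 hq, ← weight_mul_characteristicFn_zero ha ha3 j ρ, ← mul_sub, norm_mul] at hb
  rw [← weight_mul_characteristicFn_zero ha ha3 j ρ] at hsin hlow
  rw [norm_mul] at hlow hsin
  have hw0 : 0 < ‖(![ρ, 1] j : ℂ)‖ := pos_of_mul_pos_left hsin (norm_nonneg _)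
  refine ⟨fun h => ?_, ?_⟩
  · rw [h, norm_zero, mul_zero] at hsin
    exact hsin.false
  · have hCε : 4 * C ≤ ε * ‖ρ‖ := by
      rw [div_le_iff₀ hε] at hNC
      nlinarith
    set W := ‖(![ρ, 1] j : ℂ)‖
    set X := ‖characteristicFn a q j (ρ ^ 2) - characteristicFn a 0 j (ρ ^ 2)‖
    set Y := ‖characteristicFn a 0 j (ρ ^ 2)‖
    have h1 : ‖ρ‖ * (W * X) ≤ ‖ρ‖ * (W * (ε * Y)) := by
      calc ‖ρ‖ * (W * X) ≤ C * E := hb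
        _ = 4 * C * (1 / 4 * E) := by ring
        _ ≤ (ε * ‖ρ‖) * (W * Y) := by gcongr
        _ = _ := by ring
    exact le_of_mul_le_mul_left (le_of_mul_le_mul_left h1 (by linarith)) hw0

/-- The eigenvalues with their multiplicities determine the characteristic function. -/
lemma characteristicFn_eq_of_multiplicity_eq (ha : 0 < a) (ha2 : 2 * a ≤ π) (ha3 : π ≤ 3 * a)
    {q' : ℝ → ℂ} (hq : IsPotential a q) (hq' : IsPotential a q') (j : Fin 2)
    (h : ∀ μ, eigenvalueMultiplicity a q j μ = eigenvalueMultiplicity a q' j μ) :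
    characteristicFn a q j = characteristicFn a q' j := by
  refine eq_of_order_eq_of_asymptotic (differentiable_characteristicFn ha ha3 hq j)
    (differentiable_characteristicFn ha ha3 hq' j) (fun μ => ?_) (tendsto_radius j) fun ε hε => ?_
  · rw [← eigenvalueMultiplicity_eq ha ha3 hq, ← eigenvalueMultiplicity_eq ha ha3 hq', h]
  · set δ := min (ε / 4) (1 / 2)
    have hδ0 : 0 < δ := by positivity
    have hδ1 : δ ≤ ε / 4 := min_le_left _ _
    have hδ2 : δ ≤ 1 / 2 := min_le_right _ _
    filter_upwards [characteristicFn_asymptotic ha ha2 ha3 hq j hδ0,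
      characteristicFn_asymptotic ha ha2 ha3 hq' j hδ0] with N h1 h2 μ hμ
    obtain ⟨h0, h3⟩ := h1 μ hμ
    obtain ⟨-, h4⟩ := h2 μ hμ
    set f := characteristicFn a q j μ
    set g := characteristicFn a q' j μ
    set f₀ := characteristicFn a 0 j μ
    have hf₀ : 0 < ‖f₀‖ := norm_pos_iff.2 h0
    have h5 : ‖f₀‖ ≤ ‖g‖ + ‖g - f₀‖ := by
      have := norm_sub_le g (g - f₀)
      rwa [sub_sub_cancel] at this
    have h6 : ‖f₀‖ ≤ 2 * ‖g‖ := by nlinarith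
    have h7 : ‖f - g‖ ≤ ‖f - f₀‖ + ‖g - f₀‖ := by
      have := norm_sub_le (f - f₀) (g - f₀)
      rwa [sub_sub_sub_cancel_right] at this
    refine ⟨fun h => ?_, ?_⟩
    · rw [h, norm_zero] at h6
      linarith
    · nlinarith

end comparison

/-! ### Uniqueness of the potential -/

lemma ae_comp_affine {P : ℝ → Prop} (h : ∀ᵐ x, P x) {c : ℝ} (hc : c ≠ 0) (d : ℝ) :
    ∀ᵐ x, P (c * x + d) := by
  have h1 : ∀ᵐ x, P (x + d) :=
    (measurePreserving_add_right volume d).quasiMeasurePreserving.ae h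
  have h2 : Measure.QuasiMeasurePreserving (fun x : ℝ => c * x) volume volume := by
    refine ⟨measurable_const_mul c, ?_⟩
    rw [Real.map_volume_mul_left hc]
    exact Measure.smul_absolutelyContinuous
  exact h2.ae h1

section dependence

variable {a : ℝ} {w w' : ℝ → ℂ}

/-- The quadratic part depends only on the potential near the two ends of the interval. -/
lemma quadraticPart_ae_eq
    (h : ∀ᵐ x : ℝ, x ∈ Ioo a (π - a) ∪ Ioo (2 * a) π → w x = w' x) :
    quadraticPart a w =ᵐ[volume] quadraticPart a w' := by
  have h1 := ae_comp_affine h (c := 1 / 2) (by norm_num) (π / 2 + a)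
  have h2 := ae_comp_affine h (c := 1 / 2) (by norm_num) (π / 2)
  filter_upwards [h1, h2] with ξ h1 h2
  unfold quadraticPart
  split_ifs with hξ
  · rw [abs_lt] at hξ
    set x := ξ / 2 + π / 2 with hx
    have hxa : a < x := by linarith [hξ.1]
    have hxπ : x < π - a := by linarith [hξ.2]
    have e1 : w (x + a) = w' (x + a) := by
      have := h1 (Or.inr ⟨by linarith, by linarith⟩)
      convert this using 2 <;> ring
    have e2 : w x = w' x := by
      have := h2 (Or.inl ⟨by linarith, by linarith⟩)
      convert this using 2 <;> ring
    have e3 : ∫ s in a..(x + a) - a, w s = ∫ s in a..(x + a) - a, w' s := by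
      refine intervalIntegral.integral_congr_ae ?_
      filter_upwards [h] with s hs hsm
      rw [uIoc_of_le (by linarith)] at hsm
      exact hs (Or.inl ⟨hsm.1, by linarith [hsm.2]⟩)
    have e4 : ∫ s in (x + a)..π, w s = ∫ s in (x + a)..π, w' s := by
      refine intervalIntegral.integral_congr_ae ?_
      filter_upwards [h, compl_mem_ae_iff.2 (measure_singleton π)] with s hs hsπ hsm
      rw [uIoc_of_le (by linarith)] at hsm
      exact hs (Or.inr ⟨by linarith [hsm.1], lt_of_le_of_ne hsm.2 hsπ⟩)
    have e5 : ∫ s in (x + a)..π, w s * w (s - x) = ∫ s in (x + a)..π, w' s * w' (s - x) := by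
      refine intervalIntegral.integral_congr_ae ?_
      filter_upwards [h, compl_mem_ae_iff.2 (measure_singleton π),
        ae_comp_affine h one_ne_zero (-x)] with s hs hsπ hsx hsm
      rw [uIoc_of_le (by linarith)] at hsm
      have hsπ' : s < π := lt_of_le_of_ne hsm.2 hsπ
      rw [hs (Or.inr ⟨by linarith [hsm.1], hsπ'⟩), sub_eq_add_neg, ← one_mul s,
        hsx (Or.inl ⟨by linarith [hsm.1], by linarith⟩)]
    rw [e1, e2, e3, e4, e5]
  · rfl

lemma quadraticConst_eq (h : ∀ᵐ x : ℝ, x ∈ Ioo a (π - a) ∪ Ioo (2 * a) π → w x = w' x)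
    (ha2 : 2 * a ≤ π) :
    ∫ t in (2 * a)..π, w t * ∫ s in a..(t - a), w s
      = ∫ t in (2 * a)..π, w' t * ∫ s in a..(t - a), w' s := by
  refine intervalIntegral.integral_congr_ae ?_
  filter_upwards [h, compl_mem_ae_iff.2 (measure_singleton π)] with t ht htπ htm
  rw [uIoc_of_le ha2] at htm
  have htπ' : t < π := lt_of_le_of_ne htm.2 htπ
  rw [ht (Or.inr ⟨htm.1, htπ'⟩)]
  congr 1
  refine intervalIntegral.integral_congr_ae ?_
  filter_upwards [h] with s hs hsm
  rw [uIoc_of_le (by linarith [htm.1])] at hsm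
  exact hs (Or.inl ⟨hsm.1, by linarith [hsm.2]⟩)

end dependence

/-- An integrable function on an interval whose Fourier transform, multiplied by the frequency, is
the transform of an integrable function plus a point mass at `b`, is a primitive of them. -/
lemma ae_eq_primitive_of_fourier {L b : ℝ} (hb : |b| ≤ L) {f g : ℝ → ℂ}
    (hf : IntervalIntegrable f volume (-L) L) (hg : IntervalIntegrable g volume (-L) L) (c : ℂ)
    (h : ∀ ρ : ℝ, -(Complex.I * ρ) * (∫ x in -L..L, f x * wave ρ x)
      = (∫ x in -L..L, g x * wave ρ x) + c * wave ρ b) :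
    ∀ᵐ x ∂(volume.restrict (Ioc (-L) L)),
      f x = (∫ t in -L..x, g t) + if b < x then c else 0 := by
  rw [abs_le] at hb
  have hLL : -L ≤ L := by linarith
  set H : ℝ → ℂ := fun x => (Ioi b).indicator (fun _ => c) x with hH
  set G : ℝ → ℂ := fun x => ∫ t in -L..x, g t with hG
  have hHi : ∀ u v, IntervalIntegrable H volume u v := fun u v => by
    rw [intervalIntegrable_iff]
    exact (integrableOn_const (by simp)).indicator measurableSet_Ioi
  have hGi : IntervalIntegrable G volume (-L) L :=
    (intervalIntegral.continuousOn_primitive_interval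
      (hg.def'.mono_set_ae (by rw [uIoc_of_le hLL, uIcc_of_le hLL]; exact
        Ioc_ae_eq_Icc.symm.le))).intervalIntegrable
  have htot : ∫ x in -L..L, g x = -c := by
    have := h 0
    simp only [Complex.ofReal_zero, mul_zero, neg_zero, zero_mul, wave_zero, mul_one] at this
    linear_combination -this
  have hK : IntervalIntegrable (fun x => f x - (G x + H x)) volume (-L) L :=
    hf.sub (hGi.add (hHi _ _))
  have hne : ∀ ρ : ℝ, ρ ≠ 0 → ∫ x in -L..L, (f x - (G x + H x)) * wave ρ x = 0 := by
    intro ρ hρ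
    have h1 := integral_primitive_mul_deriv hLL hg (fun x => hasDerivAt_wave ρ x)
      (continuous_const.mul (continuous_wave ρ))
    have h2 : ∫ x in -L..L, H x * (Complex.I * ρ * wave ρ x) = c * (wave ρ L - wave ρ b) := by
      have hi : ∀ u v, IntervalIntegrable (fun x => H x * (Complex.I * ρ * wave ρ x)) volume u v :=
        fun u v => (hHi u v).mul_continuousOn
          (continuous_const.mul (continuous_wave ρ)).continuousOn
      rw [← intervalIntegral.integral_add_adjacent_intervals (hi (-L) b) (hi b L)]
      have e1 : ∫ x in -L..b, H x * (Complex.I * ρ * wave ρ x) = 0 := by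
        refine intervalIntegral.integral_zero_ae (ae_of_all _ fun x hx => ?_)
        rw [uIoc_of_le hb.1] at hx
        simp [hH, hx.2]
      have e2 : ∫ x in b..L, H x * (Complex.I * ρ * wave ρ x)
          = ∫ x in b..L, c * (Complex.I * ρ * wave ρ x) := by
        refine intervalIntegral.integral_congr_ae (ae_of_all _ fun x hx => ?_)
        rw [uIoc_of_le hb.2] at hx
        simp [hH, hx.1]
      rw [e1, e2, intervalIntegral.integral_const_mul, intervalIntegral.integral_eq_sub_of_hasDerivAt
        (fun x _ => hasDerivAt_wave ρ x)
        ((continuous_const.mul (continuous_wave ρ)).intervalIntegrable _ _), zero_add]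
    have h3 : ∫ t in -L..L, g t * (wave ρ L - wave ρ t)
        = -c * wave ρ L - ∫ t in -L..L, g t * wave ρ t := by
      rw [← htot, ← intervalIntegral.integral_mul_const, ← intervalIntegral.integral_sub
        (hg.mul_const _) (intervalIntegrable_mul_wave hg _)]
      refine intervalIntegral.integral_congr fun t _ => ?_
      ring
    have hGw := intervalIntegrable_mul_wave hGi ρ
    have hHw := intervalIntegrable_mul_wave (hHi (-L) L) ρ
    have hfw := intervalIntegrable_mul_wave hf ρ
    have h4 : ∫ x in -L..L, (f x - (G x + H x)) * wave ρ x
        = (∫ x in -L..L, f x * wave ρ x)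
          - ((∫ x in -L..L, G x * wave ρ x) + ∫ x in -L..L, H x * wave ρ x) := by
      rw [← intervalIntegral.integral_add hGw hHw, ← intervalIntegral.integral_sub hfw
        (hGw.add hHw)]
      refine intervalIntegral.integral_congr fun x _ => ?_
      ring
    have h5 : ∀ F : ℝ → ℂ, ∫ x in -L..L, F x * (Complex.I * ρ * wave ρ x)
        = Complex.I * ρ * ∫ x in -L..L, F x * wave ρ x := by
      intro F
      rw [← intervalIntegral.integral_const_mul]
      refine intervalIntegral.integral_congr fun x _ => ?_
      ring
    rw [h5] at h1 h2
    have h6 := h ρ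
    have hIρ : Complex.I * (ρ : ℂ) ≠ 0 :=
      mul_ne_zero Complex.I_ne_zero (Complex.ofReal_ne_zero.2 hρ)
    refine (mul_eq_zero.1 ?_).resolve_left hIρ
    rw [h4]
    rw [h3] at h1
    linear_combination -h1 - h2 - h6
  have hall : ∀ ρ : ℝ, ∫ x in -L..L, (f x - (G x + H x)) * wave ρ x = 0 := by
    have hd : Differentiable ℂ fun ρ : ℂ => ∫ x in -L..L, (f x - (G x + H x)) * wave ρ x := by
      refine differentiable_integral_mul hK (F := fun x ρ => wave ρ x) continuous_wave
        differentiable_wave fun r => ⟨Real.exp (L * r), fun t ht ρ hρ => ?_⟩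
      rw [uIcc_of_le hLL] at ht
      refine (norm_wave_le ρ (abs_le.2 ht)).trans (Real.exp_le_exp.2 ?_)
      exact mul_le_mul_of_nonneg_left ((Complex.abs_im_le_norm ρ).trans hρ) (by linarith)
    intro ρ
    by_cases hρ : ρ = 0
    · subst hρ
      have hc : Continuous fun ρ : ℝ => ∫ x in -L..L, (f x - (G x + H x)) * wave ρ x :=
        hd.continuous.comp Complex.continuous_ofReal
      have h1 := (hc.tendsto 0).mono_left (nhdsWithin_le_nhds (s := {0}ᶜ))
      refine tendsto_nhds_unique h1 (tendsto_const_nhds.congr' ?_)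
      filter_upwards [self_mem_nhdsWithin] with x hx using (hne x hx).symm
    · exact hne ρ hρ
  filter_upwards [ae_eq_zero_of_integral_mul_wave_eq_zero hLL hK hall] with x hx
  rw [sub_eq_zero] at hx
  rw [hx]
  simp [hG, hH, indicator]

lemma integral_comp_affine_mul_wave {a : ℝ} (f : ℝ → ℂ) (ρ : ℂ) :
    ∫ ξ in -(π - a)..(π - a), f (ξ / 2 + π / 2 + a / 2) * wave ρ ξ
      = 2 * ∫ t in a..π, f t * wave ρ (2 * t - π - a) := by
  have h := intervalIntegral.integral_comp_mul_sub (a := a) (b := π)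
    (fun ξ => f (ξ / 2 + π / 2 + a / 2) * wave ρ ξ) two_ne_zero (π + a)
  have e : ∀ t : ℝ, (2 * t - (π + a)) / 2 + π / 2 + a / 2 = t := fun t => by ring
  have e1 : 2 * a - (π + a) = -(π - a) := by ring
  have e2 : 2 * π - (π + a) = π - a := by ring
  have e3 : ∀ t : ℝ, 2 * t - (π + a) = 2 * t - π - a := fun t => by ring
  simp only [e, e1, e2] at h
  simp only [e3] at h
  rw [h, Complex.real_smul]
  push_cast
  ring

lemma intervalIntegrable_comp_affine {a : ℝ} {f : ℝ → ℂ} (hf : IntervalIntegrable f volume a π) :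
    IntervalIntegrable (fun ξ => f (ξ / 2 + π / 2 + a / 2)) volume (-(π - a)) (π - a) := by
  have h' := (hf.comp_add_right (π / 2 + a / 2)).comp_mul_left (c := 1 / 2)
  convert h' using 1
  · funext ξ
    ring_nf
  · ring
  · ring

/-- The identity of characteristic functions for two potentials with the same spectra yields the
equality of the potentials. -/
lemma cutoff_ae_eq {a : ℝ} {w w' : ℝ → ℂ} (ha : 0 < a) (ha2 : 2 * a < π) (ha5 : 2 * π ≤ 5 * a)
    (hw : Integrable w) (hw' : Integrable w') (hw0 : ∀ x ≤ a, w x = 0) (hw0' : ∀ x ≤ a, w' x = 0)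
    (h : ∀ ρ, solDefect a w ρ = solDefect a w' ρ) :
    ∀ᵐ x, x ∈ Ioo a π → w x = w' x := by
  set A := ∫ t in (2 * a)..π, w t * ∫ s in a..(t - a), w s with hA
  set A' := ∫ t in (2 * a)..π, w' t * ∫ s in a..(t - a), w' s with hA'
  have hA0 : ∫ t in a..π, w t = ∫ t in a..π, w' t := by
    have hcoc : Tendsto (fun ρ : ℝ => ρ) atTop (cocompact ℝ) :=
      tendsto_id.mono_right (by rw [cocompact_eq_atBot_atTop]; exact le_sup_right)
    have h1 := tendsto_solDefect hw0 ha.le ha2.le hw hcoc (tendsto_const_nhds (x := (0 : ℂ)))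
    have h2 := tendsto_solDefect hw0' ha.le ha2.le hw' hcoc (tendsto_const_nhds (x := (0 : ℂ)))
    have h3 := (h1.sub h2).norm
    simp only [h, add_zero, sub_sub_sub_cancel_left, sub_zero, ← sub_mul, ← mul_sub, norm_mul,
      norm_wave_ofReal, Complex.norm_I, one_mul, mul_one, norm_zero] at h3
    have h4 := tendsto_nhds_unique h3 tendsto_const_nhds
    rw [eq_comm, norm_eq_zero, sub_eq_zero] at h4
    exact h4.symm
  set D : ℝ → ℂ := fun ξ => quadraticPart a w ξ - quadraticPart a w' ξ with hD
  have hQ := intervalIntegrable_quadraticPart ha2.le ha.le hw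
  have hQ' := intervalIntegrable_quadraticPart ha2.le ha.le hw'
  set p : ℝ → ℂ := fun x => w x - w' x with hp
  have hpi : Integrable p := hw.sub hw'
  have hD0 : ∀ ξ, π - 2 * a ≤ |ξ| → D ξ = 0 := fun ξ hξ => by
    simp [hD, quadraticPart, hξ.not_gt]
  have hL : |2 * a - π| ≤ π - a := abs_le.2 ⟨by linarith, by linarith⟩
  have hae := ae_eq_primitive_of_fourier hL (f := fun ξ => 2 * p (ξ / 2 + π / 2 + a / 2)) (g := D)
    ((intervalIntegrable_comp_affine hpi.intervalIntegrable).const_mul 2) (hQ.sub hQ')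
    (2 * (A - A')) fun ρ => by
      have e1 : ∫ x in -(π - a)..(π - a), 2 * p (x / 2 + π / 2 + a / 2) * wave ρ x
          = 4 * ((∫ t in a..π, w t * wave ρ (2 * t - π - a))
            - ∫ t in a..π, w' t * wave ρ (2 * t - π - a)) := by
        rw [integral_comp_affine_mul_wave fun x => 2 * p x, ← intervalIntegral.integral_sub,
          ← intervalIntegral.integral_const_mul, ← intervalIntegral.integral_const_mul]
        · refine intervalIntegral.integral_congr fun t _ => ?_
          simp only [hp]
          ring
        all_goals
          refine Integrable.intervalIntegrable ?_ |>.mul_continuousOn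
            ((continuous_wave ρ).comp (by fun_prop)).continuousOn
          assumption
      have e2 : ∫ x in -(π - a)..(π - a), D x * wave ρ x
          = (∫ x in -(π - a)..(π - a), quadraticPart a w x * wave ρ x)
            - ∫ x in -(π - a)..(π - a), quadraticPart a w' x * wave ρ x := by
        rw [← intervalIntegral.integral_sub (intervalIntegrable_mul_wave hQ _)
          (intervalIntegrable_mul_wave hQ' _)]
        refine intervalIntegral.integral_congr fun t _ => ?_
        simp only [hD]
        ring
      have k1 := sol_identity hw0 ha.le ha2.le hw ρ
      have k2 := sol_identity hw0' ha.le ha2.le hw' ρ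
      have k3 := h ρ
      simp only [solDefect] at k3
      rw [k3, k2, hA0, ← hA, ← hA'] at k1
      rw [e1, e2]
      linear_combination -k1
  rw [ae_restrict_iff' measurableSet_Ioc] at hae
  have hDi : ∀ u v, -(π - a) ≤ u → u ≤ π - a → -(π - a) ≤ v → v ≤ π - a →
      IntervalIntegrable D volume u v := fun u v h1 h2 h3 h4 =>
    (hQ.sub hQ').mono_set (by
      rw [uIcc_of_le (by linarith : -(π - a) ≤ π - a)]
      exact uIcc_subset_Icc ⟨h1, h2⟩ ⟨h3, h4⟩)
  have htot : ∫ ξ in -(π - a)..(π - a), D ξ = -(2 * (A - A')) := by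
    have k1 := sol_identity hw0 ha.le ha2.le hw 0
    have k2 := sol_identity hw0' ha.le ha2.le hw' 0
    simp only [wave_zero, mul_one, mul_zero, zero_mul, ne_eq, OfNat.ofNat_ne_zero,
      not_false_eq_true, zero_pow, sub_zero, zero_sub] at k1 k2
    rw [← hA] at k1
    rw [← hA'] at k2
    simp only [hD]
    rw [intervalIntegral.integral_sub hQ hQ']
    linear_combination k1 - k2
  have hout : ∀ᵐ ξ : ℝ, ξ ∈ Ioc (-(π - a)) (π - a) → π - 2 * a < |ξ| →
      p (ξ / 2 + π / 2 + a / 2) = 0 := by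
    filter_upwards [hae] with ξ hξ hm hab
    have h1 := hξ hm
    rcases lt_abs.1 hab with h2 | h2
    · have e1 : ∫ t in ξ..(π - a), D t = 0 := by
        refine intervalIntegral.integral_zero_ae (ae_of_all _ fun t ht => hD0 t ?_)
        rw [uIoc_of_le hm.2] at ht
        exact (by linarith [ht.1] : π - 2 * a ≤ t).trans (le_abs_self t)
      have e2 := intervalIntegral.integral_add_adjacent_intervals
        (hDi (-(π - a)) ξ (by linarith) (by linarith) hm.1.le hm.2)
        (hDi ξ (π - a) hm.1.le hm.2 (by linarith) (by linarith))
      rw [e1, htot, add_zero] at e2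
      rw [e2, if_pos (by linarith), neg_add_cancel] at h1
      simpa using h1
    · have e1 : ∫ t in -(π - a)..ξ, D t = 0 := by
        refine intervalIntegral.integral_zero_ae (ae_of_all _ fun t ht => hD0 t ?_)
        rw [uIoc_of_le hm.1.le] at ht
        exact (by linarith [ht.2] : π - 2 * a ≤ -t).trans (neg_le_abs t)
      rw [e1, if_neg (by linarith), add_zero] at h1
      simpa using h1
  have hends : ∀ᵐ x : ℝ, x ∈ Ioo a (π - a) ∪ Ioo (2 * a) π → w x = w' x := by
    filter_upwards [ae_comp_affine hout two_ne_zero (-(π + a))] with x hx hm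
    have e : (2 * x + -(π + a)) / 2 + π / 2 + a / 2 = x := by ring
    rw [e] at hx
    have hxm : x ∈ Ioo a π := by
      rcases hm with h | h
      · exact ⟨h.1, by linarith [h.2]⟩
      · exact ⟨by linarith [h.1], h.2⟩
    have := hx ⟨by linarith [hxm.1], by linarith [hxm.2]⟩ (by
      rcases hm with h | h
      · exact (by linarith [h.2] : π - 2 * a < -(2 * x + -(π + a))).trans_le (neg_le_abs _)
      · exact (by linarith [h.1] : π - 2 * a < 2 * x + -(π + a)).trans_le (le_abs_self _))
    exact sub_eq_zero.1 this
  have hDz : ∀ᵐ ξ : ℝ, D ξ = 0 := by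
    filter_upwards [quadraticPart_ae_eq hends] with ξ hξ
    rw [hD, sub_eq_zero]
    exact hξ
  have hAA : A = A' := quadraticConst_eq hends ha2.le
  have hpz : ∀ᵐ ξ : ℝ, ξ ∈ Ioc (-(π - a)) (π - a) → p (ξ / 2 + π / 2 + a / 2) = 0 := by
    filter_upwards [hae] with ξ hξ hm
    have h1 := hξ hm
    rw [intervalIntegral.integral_zero_ae (hDz.mono fun t ht _ => ht), hAA] at h1
    simpa using h1
  filter_upwards [ae_comp_affine hpz two_ne_zero (-(π + a))] with x hx hm
  have e : (2 * x + -(π + a)) / 2 + π / 2 + a / 2 = x := by ring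
  rw [e] at hx
  exact sub_eq_zero.1 (hx ⟨by linarith [hm.1], by linarith [hm.2]⟩)

/-- The two spectra determine the potential. -/
theorem potential_ae_eq {a : ℝ} (ha : 0 < a) (ha2 : 2 * a < π) (ha5 : 2 * π ≤ 5 * a)
    {q q' : ℝ → ℂ} (hq : IsPotential a q) (hq' : IsPotential a q')
    (h : ∀ (j : Fin 2) (μ : ℂ),
      eigenvalueMultiplicity a q j μ = eigenvalueMultiplicity a q' j μ) :
    ∀ᵐ x ∂(volume.restrict (Ioo a π)), q x = q' x := by
  have ha3 : π ≤ 3 * a := by linarith [pi_pos]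
  have hchar := fun j => characteristicFn_eq_of_multiplicity_eq ha ha2.le ha3 hq hq' j (h j)
  have hdef : ∀ ρ, solDefect a (cutoff a q) ρ = solDefect a (cutoff a q') ρ := by
    intro ρ
    have h0 := congrFun (hchar 0) (ρ ^ 2)
    have h1 := congrFun (hchar 1) (ρ ^ 2)
    rw [characteristicFn_sq ha ha3 hq, characteristicFn_sq ha ha3 hq'] at h0 h1
    simp only [Matrix.cons_val_zero, Matrix.cons_val_one, Matrix.cons_val_fin_one] at h0 h1
    rw [solDefect, solDefect, h0, h1]
  have := cutoff_ae_eq ha ha2 ha5 (integrable_cutoff hq) (integrable_cutoff hq')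
    (fun x hx => cutoff_of_le hx) (fun x hx => cutoff_of_le hx) hdef
  rw [ae_restrict_iff' measurableSet_Ioo]
  filter_upwards [this] with x hx hm
  have := hx hm
  rwa [cutoff_of_mem hm, cutoff_of_mem hm] at this

/-! ### Localization of the eigenvalues -/

section localization

variable {a : ℝ} {q : ℝ → ℂ}

/-- The square roots of the eigenvalues of the zero potential. -/
noncomputable def freeRoot (j : Fin 2) (n : ℕ) : ℝ := n + 1 - shift j

lemma freeRoot_pos (j : Fin 2) (n : ℕ) : 0 < freeRoot j n := by
  have := shift_le j
  have : (0 : ℝ) ≤ n := n.cast_nonneg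
  unfold freeRoot
  linarith

lemma freeRoot_injective (j : Fin 2) : Function.Injective (freeRoot j) := by
  intro m n h
  simp only [freeRoot] at h
  exact_mod_cast (by linarith : (m : ℝ) = n)

lemma tendsto_freeRoot (j : Fin 2) : Tendsto (freeRoot j) atTop atTop :=
  (tendsto_atTop_add_const_right atTop (1 - shift j) tendsto_natCast_atTop_atTop).congr fun n => by
    simp only [freeRoot]
    ring

lemma characteristicFn_zero_zero (ha : 0 < a) (ha3 : π ≤ 3 * a) :
    characteristicFn a 0 0 0 = π := by
  have h := characteristicFn_sq ha ha3 (isPotential_zero a) 0 0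
  have h0 : cutoff a 0 = 0 := by
    funext x
    simp [cutoff]
  have e : (0 : ℂ) ^ 2 = 0 := by norm_num
  rw [e] at h
  simpa [h0, solY, delayConv, sn] using! h

lemma characteristicFn_zero_eq_zero_iff (ha : 0 < a) (ha3 : π ≤ 3 * a) (j : Fin 2) (μ : ℂ) :
    characteristicFn a 0 j μ = 0 ↔ ∃ n, μ = (freeRoot j n : ℂ) ^ 2 := by
  constructor
  · intro h
    obtain ⟨ρ, rfl⟩ : ∃ ρ : ℂ, ρ ^ 2 = μ := IsAlgClosed.exists_pow_nat_eq μ two_pos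
    have h1 := weight_mul_characteristicFn_zero ha ha3 j ρ
    rw [h, mul_zero, eq_comm, Complex.sin_eq_zero_iff] at h1
    obtain ⟨k, hk⟩ := h1
    have hπ : (π : ℂ) ≠ 0 := by exact_mod_cast pi_ne_zero
    have hk' : ρ = k - shift j := by
      rw [mul_comm (k : ℂ)] at hk
      exact eq_sub_of_add_eq (mul_left_cancel₀ hπ hk)
    rcases le_or_gt 1 k with hk1 | hk1
    · obtain ⟨n, hn⟩ := Int.eq_ofNat_of_zero_le (by lia : 0 ≤ k - 1)
      refine ⟨n, ?_⟩
      have : (k : ℂ) = n + 1 := by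
        rw [← Int.cast_natCast, ← hn]
        push_cast
        ring
      rw [hk', this, freeRoot]
      push_cast
      rfl
    · fin_cases j
      · have hsh : shift 0 = 0 := by simp [shift]
        simp only [Fin.zero_eta, hsh] at hk' h ⊢
        have hk0 : k ≠ 0 := by
          rintro rfl
          rw [hk'] at h
          have e : (((0 : ℤ) : ℂ) - ((0 : ℝ) : ℂ)) ^ 2 = 0 := by norm_num
          rw [e, characteristicFn_zero_zero ha ha3] at h
          exact hπ h
        obtain ⟨n, hn⟩ := Int.eq_ofNat_of_zero_le (by lia : 0 ≤ -k - 1)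
        refine ⟨n, ?_⟩
        have : (k : ℂ) = -(n + 1) := by
          rw [← Int.cast_natCast, ← hn]
          push_cast
          ring
        rw [hk', this, freeRoot, hsh]
        push_cast
        ring
      · have hsh : shift 1 = 1 / 2 := by simp [shift]
        simp only [Fin.mk_one, hsh] at hk' ⊢
        obtain ⟨n, hn⟩ := Int.eq_ofNat_of_zero_le (by lia : 0 ≤ -k)
        refine ⟨n, ?_⟩
        have : (k : ℂ) = -n := by
          rw [← Int.cast_natCast, ← hn]
          push_cast
          ring
        rw [hk', this, freeRoot, hsh]
        push_cast
        ring
  · rintro ⟨n, rfl⟩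
    have h1 := weight_mul_characteristicFn_zero ha ha3 j (freeRoot j n)
    have h2 : (π : ℂ) * ((freeRoot j n : ℂ) + shift j) = ((n + 1 : ℤ) : ℂ) * π := by
      simp only [freeRoot]
      push_cast
      ring
    rw [h2, Complex.sin_int_mul_pi] at h1
    refine (mul_eq_zero.1 h1).resolve_left ?_
    have : (freeRoot j n : ℂ) ≠ 0 := by exact_mod_cast (freeRoot_pos j n).ne'
    fin_cases j
    · simpa using this
    · simp

lemma deriv_characteristicFn_zero_ne_zero (ha : 0 < a) (ha3 : π ≤ 3 * a) (j : Fin 2) (n : ℕ) :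
    deriv (characteristicFn a 0 j) ((freeRoot j n : ℂ) ^ 2) ≠ 0 := by
  intro h
  set ρ : ℂ := (freeRoot j n : ℂ) with hρ
  have hd := (differentiable_characteristicFn ha ha3 (isPotential_zero a) j (ρ ^ 2)).hasDerivAt
  rw [h] at hd
  have hz : characteristicFn a 0 j (ρ ^ 2) = 0 :=
    (characteristicFn_zero_eq_zero_iff ha ha3 j _).2 ⟨n, rfl⟩
  have hsq : HasDerivAt (fun z : ℂ => z ^ 2) (2 * ρ) ρ := by
    simpa using! hasDerivAt_pow 2 ρ
  have hcomp : HasDerivAt (fun z => characteristicFn a 0 j (z ^ 2)) 0 ρ := by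
    have := HasDerivAt.comp ρ hd hsq
    simpa using! this
  have hw : DifferentiableAt ℂ (fun z : ℂ => (![z, 1] j : ℂ)) ρ := by
    fin_cases j
    · simp only [Fin.zero_eta, Matrix.cons_val_zero]
      exact differentiableAt_id
    · simp only [Fin.mk_one, Matrix.cons_val_one, Matrix.cons_val_fin_one]
      exact differentiableAt_const _
  have h1 := hw.hasDerivAt.mul hcomp
  rw [hz, mul_zero, mul_zero, add_zero] at h1
  have hfun : (fun z : ℂ => (![z, 1] j : ℂ)) * (fun z => characteristicFn a 0 j (z ^ 2))
      = fun z => Complex.sin (π * (z + shift j)) := by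
    funext z
    exact weight_mul_characteristicFn_zero ha ha3 j z
  rw [hfun] at h1
  have h2 : HasDerivAt (fun z : ℂ => Complex.sin (π * (z + shift j)))
      (Complex.cos (π * (ρ + shift j)) * (π * 1)) ρ :=
    (((hasDerivAt_id ρ).add_const _).const_mul (π : ℂ)).csin
  have h3 := h1.unique h2
  have e : (π : ℂ) * (ρ + shift j) = ((n + 1 : ℤ) : ℂ) * π := by
    simp only [hρ, freeRoot]
    push_cast
    ring
  rw [e, cos_int_mul_pi, mul_one, eq_comm, mul_eq_zero] at h3
  rcases h3 with h3 | h3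
  · exact zpow_ne_zero _ (by norm_num) h3
  · exact pi_ne_zero (by exact_mod_cast h3)

lemma isZeroSeq_freeRoot (ha : 0 < a) (ha3 : π ≤ 3 * a) (j : Fin 2) :
    IsZeroSeq (characteristicFn a 0 j) fun n => (freeRoot j n : ℂ) ^ 2 := by
  intro z
  have hd := differentiable_characteristicFn ha ha3 (isPotential_zero a) j
  by_cases hz : characteristicFn a 0 j z = 0
  · obtain ⟨n, rfl⟩ := (characteristicFn_zero_eq_zero_iff ha ha3 j z).1 hz
    have h1 : {m | (freeRoot j m : ℂ) ^ 2 = (freeRoot j n : ℂ) ^ 2} = {n} := by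
      ext m
      simp only [mem_ofPred_eq, mem_singleton_iff]
      refine ⟨fun h => freeRoot_injective j ?_, fun h => by rw [h]⟩
      have h' : freeRoot j m ^ 2 = freeRoot j n ^ 2 := by exact_mod_cast h
      exact (sq_eq_sq₀ (freeRoot_pos j m).le (freeRoot_pos j n).le).1 h'
    rw [h1, encard_singleton]
    exact ((hd.analyticAt _).analyticOrderAt_eq_one_of_zero_deriv_ne_zero hz
      (deriv_characteristicFn_zero_ne_zero ha ha3 j n)).symm
  · rw [(hd.analyticAt z).analyticOrderAt_eq_zero.2 hz, encard_eq_zero,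
      eq_empty_iff_forall_notMem]
    rintro n rfl
    exact hz ((characteristicFn_zero_eq_zero_iff ha ha3 j _).2 ⟨n, rfl⟩)

lemma isZeroSeq_of_isSpectrum (ha : 0 < a) (ha3 : π ≤ 3 * a) (hq : IsPotential a q) {j : Fin 2}
    {lam : ℕ → ℂ} (h : IsSpectrum a q j lam) : IsZeroSeq (characteristicFn a q j) lam := fun z => by
  rw [h.multiplicity, eigenvalueMultiplicity_eq ha ha3 hq]

lemma norm_freeRoot_sq_lt_radius_iff (j : Fin 2) (n N : ℕ) :
    ‖(freeRoot j n : ℂ) ^ 2‖ < radius j N ↔ n < N := by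
  have h1 := shift_le j
  have h2 : (0 : ℝ) ≤ N := N.cast_nonneg
  rw [norm_pow, Complex.norm_real, Real.norm_of_nonneg (freeRoot_pos j n).le, radius,
    sq_lt_sq₀ (freeRoot_pos j n).le (by linarith), freeRoot]
  constructor
  · intro h
    have : (n : ℝ) + 1 < N + 1 := by linarith
    exact_mod_cast (by linarith : (n : ℝ) < N)
  · intro h
    have : (n : ℝ) + 1 ≤ N := by exact_mod_cast h
    linarith

/-- Large circles separate the eigenvalues in the same way as those of the zero potential, by Rouché's
theorem. -/
lemma norm_lt_radius_iff (ha : 0 < a) (ha2 : 2 * a ≤ π) (ha3 : π ≤ 3 * a) (hq : IsPotential a q)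
    {j : Fin 2} {lam : ℕ → ℂ} (h : IsSpectrum a q j lam) :
    ∀ᶠ N in atTop, ∀ n, ‖lam n‖ < radius j N ↔ n < N := by
  have hf := differentiable_characteristicFn ha ha3 hq j
  have hz := isZeroSeq_of_isSpectrum ha ha3 hq h
  filter_upwards [characteristicFn_asymptotic ha ha2 ha3 hq j one_half_pos,
    (tendsto_radius j).eventually_gt_atTop 0] with N hN hr
  have hlt : ∀ z : ℂ, ‖z‖ = radius j N →
      ‖characteristicFn a q j z - characteristicFn a 0 j z‖ < ‖characteristicFn a 0 j z‖ := by
    intro z hz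
    obtain ⟨h1, h2⟩ := hN z hz
    have := norm_pos_iff.2 h1
    linarith
  have hcard := hz.ncard_eq hf
    (differentiable_characteristicFn ha ha3 (isPotential_zero a) j) (isZeroSeq_freeRoot ha ha3 j)
    hr hlt
  have h1 : {n | ‖(freeRoot j n : ℂ) ^ 2‖ < radius j N} = Iio N := by
    ext n
    exact norm_freeRoot_sq_lt_radius_iff j n N
  rw [h1, ← Finset.coe_Iio, ncard_coe_finset, Nat.card_Iio] at hcard
  have hne : characteristicFn a q j (radius j N) ≠ 0 := by
    intro h0
    have := hlt (radius j N) (by rw [Complex.norm_real, Real.norm_of_nonneg hr.le])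
    rw [h0, zero_sub, norm_neg] at this
    exact this.false
  have hfin := hz.finite hf hne (radius j N)
  intro n
  constructor
  · intro hn
    have hsub : ((Finset.Iic n : Finset ℕ) : Set ℕ) ⊆ {n | ‖lam n‖ < radius j N} := fun m hm =>
      (h.mono (by simpa using hm)).trans_lt hn
    have := ncard_le_ncard hsub hfin
    rw [hcard, ncard_coe_finset, Nat.card_Iic] at this
    exact this
  · intro hn
    by_contra hc
    have hsub : {n | ‖lam n‖ < radius j N} ⊆ ((Finset.Iio n : Finset ℕ) : Set ℕ) := by
      intro m hm
      simp only [Finset.coe_Iio, mem_Iio]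
      by_contra hmn
      exact hc ((h.mono (not_lt.1 hmn)).trans_lt hm)
    have := ncard_le_ncard hsub (Finset.finite_toSet _)
    rw [hcard, ncard_coe_finset, Nat.card_Iio] at this
    lia

lemma sq_cpow_half (z : ℂ) : (z ^ (1 / 2 : ℂ)) ^ 2 = z := by
  rw [one_div]
  exact Complex.cpow_ofNat_inv_pow z 2

lemma cpow_half_re_nonneg (z : ℂ) : 0 ≤ (z ^ (1 / 2 : ℂ)).re := by
  by_cases hz : z = 0
  · simp [hz]
  · rw [Complex.cpow_def_of_ne_zero hz, Complex.exp_re]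
    refine mul_nonneg (Real.exp_pos _).le ?_
    have e : (Complex.log z * (1 / 2)).im = Complex.arg z / 2 := by
      rw [show (1 / 2 : ℂ) = ((1 / 2 : ℝ) : ℂ) by push_cast; rfl, Complex.im_mul_ofReal,
        Complex.log_im]
      ring
    rw [e]
    have h1 := Complex.neg_pi_lt_arg z
    have h2 := Complex.arg_le_pi z
    exact Real.cos_nonneg_of_neg_pi_div_two_le_of_le (by linarith) (by linarith)

lemma charSol_cpow_half_eq_zero (ha : 0 < a) (ha3 : π ≤ 3 * a) (hq : IsPotential a q) {j : Fin 2}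
    {lam : ℕ → ℂ} (h : IsSpectrum a q j lam) (n : ℕ) :
    charSol a (cutoff a q) j ((lam n) ^ (1 / 2 : ℂ)) = 0 := by
  rw [charSol_eq ha ha3 hq, sq_cpow_half, (isZeroSeq_of_isSpectrum ha ha3 hq h).apply_eq_zero,
    mul_zero]

/-- The square roots of the eigenvalues approach those of the zero potential. -/
lemma tendsto_cpow_half_sub_freeRoot (ha : 0 < a) (ha2 : 2 * a ≤ π) (ha3 : π ≤ 3 * a)
    (hq : IsPotential a q) {j : Fin 2} {lam : ℕ → ℂ} (h : IsSpectrum a q j lam) :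
    Tendsto (fun n => (lam n) ^ (1 / 2 : ℂ) - freeRoot j n) atTop (𝓝 0) := by
  obtain ⟨C, hC, hbound⟩ := exists_bound_charSol (a := a) (w := cutoff a q)
    (fun x hx => cutoff_of_le hx) ha.le ha2 (integrable_cutoff hq) j
  rw [Metric.tendsto_nhds]
  intro ε hε
  set δ := min ε (1 / 4) with hδ
  have hδ0 : 0 < δ := by positivity
  have hδ1 : δ ≤ 1 / 4 := min_le_right _ _
  obtain ⟨N₀, hN₀⟩ := eventually_atTop.1 (norm_lt_radius_iff ha ha2 ha3 hq h)
  filter_upwards [eventually_ge_atTop N₀, eventually_ge_atTop (⌈C / δ⌉₊ + 1)] with n hn hnC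
  set ρ : ℂ := (lam n) ^ (1 / 2 : ℂ) with hρ
  have hs0 := shift_nonneg j
  have hs1 := shift_le j
  have hn1 : (1 : ℝ) ≤ n := by exact_mod_cast (Nat.le_add_left 1 _).trans hnC
  have hnC' : C / δ + 1 ≤ n := by
    have : ((⌈C / δ⌉₊ + 1 : ℕ) : ℝ) ≤ n := by exact_mod_cast hnC
    push_cast at this
    linarith [Nat.le_ceil (C / δ)]
  have hsq : ‖ρ‖ ^ 2 = ‖lam n‖ := by rw [← norm_pow, hρ, sq_cpow_half]
  have hlow : (n : ℝ) + 1 / 2 - shift j ≤ ‖ρ‖ := by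
    have := not_lt.1 (mt ((hN₀ n hn) n).1 (lt_irrefl n))
    rw [radius, ← hsq] at this
    exact (sq_le_sq₀ (by linarith) (norm_nonneg _)).1 this
  have hup : ‖ρ‖ < n + 3 / 2 - shift j := by
    have := ((hN₀ (n + 1) (by lia)) n).2 (Nat.lt_succ_self n)
    rw [radius, ← hsq] at this
    have := (sq_lt_sq₀ (norm_nonneg _) (by push_cast; linarith)).1 this
    push_cast at this
    linarith
  have hb := hbound ρ (by linarith)
  rw [charSol_cpow_half_eq_zero ha ha3 hq h, zero_sub, norm_neg] at hb
  obtain ⟨m, hm⟩ : ∃ m : ℤ, ‖ρ + shift j - m‖ < δ := by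
    by_contra! hcon
    have h1 := le_norm_sin_pi_mul hδ0.le hδ1 hcon
    have him : (ρ + (shift j : ℂ)).im = ρ.im := by simp
    rw [him] at h1
    set E := Real.exp (π * |ρ.im|)
    have hE0 : 0 < E := Real.exp_pos _
    have h2 : (‖ρ‖ * δ) * E ≤ C * E :=
      calc (‖ρ‖ * δ) * E = ‖ρ‖ * (δ * E) := by ring
        _ ≤ _ := by gcongr
        _ ≤ _ := hb
    have h3 : ‖ρ‖ * δ ≤ C := le_of_mul_le_mul_right h2 hE0
    rw [← le_div_iff₀ hδ0] at h3
    linarith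
  -- the modulus and the sign of the real part leave one integer
  have h1 : |‖ρ‖ - ‖((m - shift j : ℝ) : ℂ)‖| < δ := by
    refine lt_of_le_of_lt (abs_norm_sub_norm_le ρ _) (lt_of_eq_of_lt ?_ hm)
    congr 1
    push_cast
    ring
  have h2 : |ρ.re + shift j - m| < δ := by
    refine lt_of_le_of_lt ?_ hm
    simpa using Complex.abs_re_le_norm (ρ + shift j - m)
  have hre : 0 ≤ ρ.re := cpow_half_re_nonneg _
  rw [abs_lt] at h1 h2
  rw [Complex.norm_real, Real.norm_eq_abs] at h1
  have hm0 : (0 : ℝ) ≤ m := by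
    have : (-1 : ℝ) < m := by linarith
    have : (-1 : ℤ) < m := by exact_mod_cast this
    exact_mod_cast (by lia : 0 ≤ m)
  have hm1 : (1 : ℝ) ≤ m := by
    by_contra hc
    have : m < 1 := by exact_mod_cast not_le.1 hc
    have : m ≤ 0 := by lia
    have hm' : (m : ℝ) = 0 := le_antisymm (by exact_mod_cast this) hm0
    rw [hm', zero_sub, abs_neg, abs_of_nonneg hs0] at h1
    linarith
  rw [abs_of_nonneg (by linarith)] at h1
  have hmn : m = n + 1 := by
    have e1 : (n : ℝ) < m := by linarith
    have e2 : (m : ℝ) < n + 2 := by linarith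
    have e1' : (n : ℤ) < m := by exact_mod_cast e1
    have e2' : m < n + 2 := by exact_mod_cast e2
    lia
  rw [dist_zero_right]
  refine lt_of_lt_of_le (lt_of_eq_of_lt ?_ hm) (min_le_left _ _)
  rw [hmn, freeRoot]
  congr 1
  push_cast
  ring

end localization

/-! ### Asymptotics of the eigenvalues -/

section eigenvalueAsymptotics

variable {a : ℝ} {q : ℝ → ℂ}

lemma tendsto_cos_add_sub_cos {ι : Type*} {l : Filter ι} {u : ι → ℂ} (hu : Tendsto u l (𝓝 0))
    (x : ι → ℝ) : Tendsto (fun i => Complex.cos (u i - x i) - Complex.cos (x i)) l (𝓝 0) := by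
  have h1 : Tendsto (fun i => ‖Complex.cos (u i) - 1‖ + ‖Complex.sin (u i)‖) l (𝓝 0) := by
    have hc := (Complex.continuous_cos.tendsto 0).comp hu
    have hs := (Complex.continuous_sin.tendsto 0).comp hu
    have := (hc.sub_const 1).norm.add hs.norm
    simpa using! this
  refine squeeze_zero_norm (fun i => ?_) h1
  have e : Complex.cos (u i - x i) - Complex.cos (x i)
      = (Complex.cos (u i) - 1) * (Real.cos (x i) : ℂ) + Complex.sin (u i) * (Real.sin (x i) : ℂ) := by
    rw [Complex.cos_sub]
    push_cast
    ring
  rw [e]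
  refine (norm_add_le _ _).trans (add_le_add ?_ ?_)
  · rw [norm_mul, Complex.norm_real, Real.norm_eq_abs]
    exact mul_le_of_le_one_right (norm_nonneg _) (Real.abs_cos_le_one _)
  · rw [norm_mul, Complex.norm_real, Real.norm_eq_abs]
    exact mul_le_of_le_one_right (norm_nonneg _) (Real.abs_sin_le_one _)

lemma tendsto_freeRoot_cocompact (j : Fin 2) : Tendsto (freeRoot j) atTop (cocompact ℝ) :=
  (tendsto_freeRoot j).mono_right atTop_le_cocompact

/-- The characteristic equation, up to a null sequence. -/
lemma tendsto_two_mul_sin_pi_mul (ha : 0 < a) (ha2 : 2 * a ≤ π) (ha3 : π ≤ 3 * a)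
    (hq : IsPotential a q) {j : Fin 2} {lam : ℕ → ℂ} (h : IsSpectrum a q j lam) :
    Tendsto (fun n => 2 * (lam n) ^ (1 / 2 : ℂ)
        * Complex.sin (π * ((lam n) ^ (1 / 2 : ℂ) - freeRoot j n))
      - (∫ t in a..π, cutoff a q t) * Complex.cos (freeRoot j n * a)) atTop (𝓝 0) := by
  set A₀ := ∫ t in a..π, cutoff a q t
  set ε : ℕ → ℂ := fun n => (lam n) ^ (1 / 2 : ℂ) - freeRoot j n with hε
  have hε0 : Tendsto ε atTop (𝓝 0) := tendsto_cpow_half_sub_freeRoot ha ha2 ha3 hq h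
  have h1 := tendsto_charSol (a := a) (w := cutoff a q) (fun x hx => cutoff_of_le hx) ha.le ha2
    (integrable_cutoff hq) (tendsto_freeRoot_cocompact j) hε0 j
  have hρ : ∀ n, (freeRoot j n : ℂ) + ε n = (lam n) ^ (1 / 2 : ℂ) := fun n => by simp [hε]
  have hu : Tendsto (fun n => (π - a : ℂ) * ε n) atTop (𝓝 0) := by simpa using hε0.const_mul (π - a : ℂ)
  have h2 := (tendsto_cos_add_sub_cos hu fun n => freeRoot j n * a).const_mul A₀
  -- multiply by the sign `(-1)^(n+1)`
  have h3 : Tendsto (fun n : ℕ => (-1 : ℂ) ^ ((n : ℤ) + 1) * (2 * (freeRoot j n + ε n)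
      * (charSol a (cutoff a q) j (freeRoot j n + ε n)
        - Complex.sin (π * (freeRoot j n + ε n + shift j)))
      + A₀ * Complex.cos (π * (freeRoot j n + ε n + shift j) - (freeRoot j n + ε n) * a)))
      atTop (𝓝 0) := by
    refine squeeze_zero_norm (fun n => ?_) (by simpa using h1.norm)
    rw [norm_mul, norm_zpow, norm_neg, norm_one, one_zpow, one_mul]
  have h4 := (h2.sub h3)
  rw [mul_zero, sub_zero] at h4
  refine h4.congr fun n => ?_
  rw [hρ, charSol_cpow_half_eq_zero ha ha3 hq h]
  have e1 : (lam n) ^ (1 / 2 : ℂ) + shift j = ε n + ((n + 1 : ℤ) : ℂ) := by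
    simp only [hε, freeRoot]
    push_cast
    ring
  have e2 : (π : ℂ) * (ε n + ((n + 1 : ℤ) : ℂ)) - (lam n) ^ (1 / 2 : ℂ) * a
      = π * ((n + 1 : ℤ) : ℂ) + ((π - a : ℂ) * ε n - ((freeRoot j n * a : ℝ) : ℂ)) := by
    simp only [hε]
    push_cast
    ring
  have hsign : (-1 : ℂ) ^ ((n : ℤ) + 1) * (-1 : ℂ) ^ ((n : ℤ) + 1) = 1 := by
    rw [← mul_zpow]
    norm_num
  rw [e1, e2, sin_pi_mul_add_int, cos_pi_mul_int_add]
  have e3 : (lam n) ^ (1 / 2 : ℂ) - freeRoot j n = ε n := rfl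
  rw [e3]
  push_cast
  set s := Complex.sin (π * ε n)
  set c := Complex.cos ((π - a : ℂ) * ε n - (freeRoot j n : ℂ) * a)
  linear_combination (2 * (lam n) ^ (1 / 2 : ℂ) * s - A₀ * c) * hsign

/-- `√λ = m + A₀ cos (m a) / (2πn) + o(1/n)` with `m = n - shift j`. -/
lemma tendsto_eigenvalue_asymptotics (ha : 0 < a) (ha2 : 2 * a ≤ π) (ha3 : π ≤ 3 * a)
    (hq : IsPotential a q) {j : Fin 2} {lam : ℕ → ℂ} (h : IsSpectrum a q j lam) :
    Tendsto (fun n : ℕ => 2 * π * ((n : ℂ) + 1) * ((lam n) ^ (1 / 2 : ℂ) - freeRoot j n)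
      - (∫ t in a..π, cutoff a q t) * Complex.cos (freeRoot j n * a)) atTop (𝓝 0) := by
  set A₀ := ∫ t in a..π, cutoff a q t
  set ε : ℕ → ℂ := fun n => (lam n) ^ (1 / 2 : ℂ) - freeRoot j n with hε
  have hε0 : Tendsto ε atTop (𝓝 0) := tendsto_cpow_half_sub_freeRoot ha ha2 ha3 hq h
  have hmain := tendsto_two_mul_sin_pi_mul ha ha2 ha3 hq h
  set S : ℂ → ℂ := dslope Complex.sin 0 with hS
  have hSmul : ∀ z, Complex.sin z = z * S z := fun z => by
    have := sub_smul_dslope Complex.sin 0 z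
    simpa using this.symm
  have hSc : Tendsto (fun n => S (π * ε n)) atTop (𝓝 1) := by
    have hc : ContinuousAt S 0 := continuousAt_dslope_same.2 Complex.differentiable_sin.differentiableAt
    have h0 : S 0 = 1 := by simp [hS, dslope_same]
    have h1 : Tendsto (fun n => π * ε n) atTop (𝓝 (0 : ℂ)) := by simpa using hε0.const_mul (π : ℂ)
    rw [← h0]
    exact hc.tendsto.comp h1
  -- the factor `(n + 1) / ((m + ε) S)` tends to `1`
  have hn : Tendsto (fun n : ℕ => (1 : ℂ) / ((n : ℂ) + 1)) atTop (𝓝 0) :=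
    tendsto_one_div_add_atTop_nhds_zero_nat
  have hquot : Tendsto (fun n : ℕ => (lam n) ^ (1 / 2 : ℂ) / ((n : ℂ) + 1) * S (π * ε n)) atTop
      (𝓝 1) := by
    have h1 : Tendsto (fun n : ℕ => (1 + (ε n - shift j) * (1 / ((n : ℂ) + 1))) * S (π * ε n)) atTop
        (𝓝 ((1 + (0 - shift j) * 0) * 1)) :=
      (tendsto_const_nhds.add ((hε0.sub_const _).mul hn)).mul hSc
    rw [mul_zero, add_zero, mul_one] at h1
    refine h1.congr fun n => ?_
    congr 1
    have : ((n : ℂ) + 1) ≠ 0 := by exact_mod_cast Nat.succ_ne_zero n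
    simp only [hε, freeRoot]
    push_cast
    field_simp
    ring
  have hinv := hquot.inv₀ one_ne_zero
  rw [inv_one] at hinv
  set K : ℕ → ℂ := fun n => ((lam n) ^ (1 / 2 : ℂ) / ((n : ℂ) + 1) * S (π * ε n))⁻¹ with hK
  have h1 := hmain.mul hinv
  have h2 : Tendsto (fun n : ℕ => (K n - 1) * (A₀ * Complex.cos (freeRoot j n * a))) atTop
      (𝓝 0) := by
    have h3 : Tendsto (fun n => ‖K n - 1‖ * ‖A₀‖) atTop (𝓝 0) := by
      simpa using (hinv.sub_const 1).norm.mul_const ‖A₀‖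
    refine squeeze_zero_norm (fun n => ?_) h3
    rw [norm_mul, norm_mul]
    refine mul_le_mul_of_nonneg_left (mul_le_of_le_one_right (norm_nonneg _) ?_) (norm_nonneg _)
    rw [← Complex.ofReal_mul, ← Complex.ofReal_cos, Complex.norm_real]
    exact Real.abs_cos_le_one _
  have h4 := h1.add h2
  rw [zero_mul, add_zero] at h4
  refine h4.congr' ?_
  have hne : ∀ᶠ n : ℕ in atTop, (lam n) ^ (1 / 2 : ℂ) / ((n : ℂ) + 1) * S (π * ε n) ≠ 0 :=
    hquot.eventually_ne one_ne_zero
  filter_upwards [hne] with n hn0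
  have hn1 : ((n : ℂ) + 1) ≠ 0 := by exact_mod_cast Nat.succ_ne_zero n
  have e3 : (lam n) ^ (1 / 2 : ℂ) - freeRoot j n = ε n := rfl
  rw [e3, hSmul]
  set ρ := (lam n) ^ (1 / 2 : ℂ)
  set s := S (π * ε n)
  have hKn : ρ * s * K n = (n : ℂ) + 1 := by
    have hKe : K n = (ρ / ((n : ℂ) + 1) * s)⁻¹ := rfl
    rw [hKe]
    have hs : s ≠ 0 := fun h0 => hn0 (by rw [h0, mul_zero])
    have hr : ρ ≠ 0 := fun h0 => hn0 (by rw [h0, zero_div, zero_mul])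
    field_simp
  change (2 * ρ * (π * ε n * s) - A₀ * Complex.cos (freeRoot j n * a)) * K n
    + (K n - 1) * (A₀ * Complex.cos (freeRoot j n * a)) = _
  linear_combination (2 * π * ε n) * hKn

lemma cast_add_cons_eq_freeRoot (j : Fin 2) (n : ℕ) :
    (n : ℂ) + (![1, 1 / 2] j : ℂ) = freeRoot j n := by
  fin_cases j
  · simp [freeRoot, shift]
  · simp only [freeRoot, shift, Fin.mk_one, Matrix.cons_val_one, Matrix.cons_val_fin_one]
    push_cast
    ring

lemma isLittleO_asymptotics_iff {j : Fin 2} {lam : ℕ → ℂ} {A₀ : ℂ} :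
    ((fun n : ℕ => (lam n) ^ (1 / 2 : ℂ) - (((n : ℂ) + (![1, 1 / 2] j : ℂ))
        + A₀ * Complex.cos (((n : ℂ) + (![1, 1 / 2] j : ℂ)) * a) / (2 * π * ((n : ℂ) + 1))))
      =o[atTop] fun n : ℕ => 1 / ((n : ℝ) + 1)) ↔
    Tendsto (fun n : ℕ => 2 * π * ((n : ℂ) + 1) * ((lam n) ^ (1 / 2 : ℂ) - freeRoot j n)
      - A₀ * Complex.cos (freeRoot j n * a)) atTop (𝓝 0) := by
  have hcast : (fun n : ℕ => 1 / ((n : ℝ) + 1)) = fun n : ℕ => ‖(1 / ((n : ℂ) + 1) : ℂ)‖ := by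
    funext n
    have : ((n : ℂ) + 1) = (((n : ℝ) + 1 : ℝ) : ℂ) := by push_cast; rfl
    rw [this, norm_div, norm_one, Complex.norm_real, Real.norm_of_nonneg (by positivity)]
  rw [hcast, Asymptotics.isLittleO_norm_right, Asymptotics.isLittleO_iff_tendsto (fun n hn => by
    have : ((n : ℂ) + 1) ≠ 0 := by exact_mod_cast Nat.succ_ne_zero n
    exact absurd hn (by simpa using this))]
  have hπ : (2 * π : ℂ) ≠ 0 := by simp
  have key : ∀ n : ℕ, 2 * π * ((n : ℂ) + 1) * ((lam n) ^ (1 / 2 : ℂ) - freeRoot j n)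
      - A₀ * Complex.cos (freeRoot j n * a) = 2 * π * (((lam n) ^ (1 / 2 : ℂ)
        - (((n : ℂ) + (![1, 1 / 2] j : ℂ)) + A₀ * Complex.cos (((n : ℂ)
        + (![1, 1 / 2] j : ℂ)) * a) / (2 * π * ((n : ℂ) + 1)))) / (1 / ((n : ℂ) + 1))) := by
    intro n
    have : ((n : ℂ) + 1) ≠ 0 := by exact_mod_cast Nat.succ_ne_zero n
    rw [cast_add_cons_eq_freeRoot]
    field_simp
    ring
  constructor
  · intro h
    have := h.const_mul (2 * π : ℂ)
    rw [mul_zero] at this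
    exact this.congr fun n => (key n).symm
  · intro h
    have := h.const_mul (2 * π : ℂ)⁻¹
    rw [mul_zero] at this
    refine this.congr fun n => ?_
    rw [key, inv_mul_cancel_left₀ hπ]

/-- The cosines `cos (m a)` along the eigenvalues of the zero potential do not tend to zero. -/
lemma not_tendsto_cos_freeRoot (ha : 0 < a) (ha2 : 2 * a ≤ π) (j : Fin 2) :
    ¬ Tendsto (fun n => Real.cos (freeRoot j n * a)) atTop (𝓝 0) := by
  intro h
  have hsa : Real.sin a ≠ 0 := (Real.sin_pos_of_pos_of_lt_pi ha (by linarith)).ne'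
  have h1 : Tendsto (fun n => Real.sin (freeRoot j n * a)) atTop (𝓝 0) := by
    have h2 := (((h.mul_const (Real.cos a)).sub (h.comp (tendsto_add_atTop_nat 1)))).mul_const
      (Real.sin a)⁻¹
    rw [zero_mul, sub_zero, zero_mul] at h2
    refine h2.congr fun n => ?_
    have e : freeRoot j (n + 1) * a = freeRoot j n * a + a := by
      simp only [freeRoot]
      push_cast
      ring
    simp only [Function.comp]
    rw [e, Real.cos_add]
    field_simp
    ring
  have h3 := (h1.pow 2).add (h.pow 2)
  simp only [Real.sin_sq_add_cos_sq] at h3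
  norm_num at h3

lemma eq_of_eigenvalue_asymptotics (ha : 0 < a) (ha2 : 2 * a ≤ π) {j : Fin 2} {A A' : ℂ}
    {u : ℕ → ℂ} (h : Tendsto (fun n => u n - A * Complex.cos (freeRoot j n * a)) atTop (𝓝 0))
    (h' : Tendsto (fun n => u n - A' * Complex.cos (freeRoot j n * a)) atTop (𝓝 0)) : A = A' := by
  by_contra hne
  have hd : A' - A ≠ 0 := sub_ne_zero.2 (Ne.symm hne)
  have h1 := (h.sub h').const_mul (A' - A)⁻¹
  rw [sub_zero, mul_zero] at h1
  have h2 : Tendsto (fun n => Complex.cos (freeRoot j n * a)) atTop (𝓝 0) := by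
    refine h1.congr fun n => ?_
    field_simp
    ring
  refine not_tendsto_cos_freeRoot ha ha2 j ?_
  have h3 := (Complex.continuous_re.tendsto 0).comp h2
  refine h3.congr fun n => ?_
  simp only [Function.comp]
  rw [← Complex.ofReal_mul, ← Complex.ofReal_cos, Complex.ofReal_re]

end eigenvalueAsymptotics

/-! ### Product formula -/

/-- Comparison of the canonical products of two entire functions that are asymptotic on large circles
and whose zeros are close to each other: the maximum principle is applied to the quotient of the
cofactors left over when the zeros inside a circle are split off. -/
lemma exists_prod_ratio {f g : ℂ → ℂ} (hf : Differentiable ℂ f) (hg : Differentiable ℂ g)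
    {c d : ℕ → ℂ} (hc : IsZeroSeq f c) (hd : IsZeroSeq g d) {r : ℕ → ℝ} (hr : Tendsto r atTop atTop)
    (hcr : ∀ᶠ N in atTop, ∀ n, ‖c n‖ < r N ↔ n < N) (hdr : ∀ᶠ N in atTop, ∀ n, ‖d n‖ < r N ↔ n < N)
    (hfg : ∀ ε > 0, ∀ᶠ N in atTop, ∀ z, ‖z‖ = r N → g z ≠ 0 ∧ ‖f z - g z‖ ≤ ε * ‖g z‖)
    (hcd : ∀ ε > 0, ∀ᶠ N in atTop, ∀ z, ‖z‖ = r N →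
      ∑ n ∈ Finset.range N, ‖(d n - c n) / (z - d n)‖ ≤ ε) (z₀ : ℂ) :
    ∃ t : ℕ → ℂ, Tendsto t atTop (𝓝 1) ∧ ∀ᶠ N in atTop,
      (∏ n ∈ Finset.range N, (z₀ - c n)) * g z₀ = f z₀ * (∏ n ∈ Finset.range N, (z₀ - d n)) * t N := by
  have hfac := fun N => hc.exists_factorization hf (Finset.range N)
  have gfac := fun N => hd.exists_factorization hg (Finset.range N)
  choose h hh hfh hho using hfac
  choose k hk hgk hko using gfac
  have hne : ∀ {F : ℂ → ℂ} {e : ℕ → ℂ} {H : ℂ → ℂ} {N : ℕ}, Differentiable ℂ H →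
      (∀ z, F z = (∏ n ∈ Finset.range N, (z - e n)) * H z) →
      (∀ z, {n | n ∉ Finset.range N ∧ e n = z}.encard = analyticOrderAt H z) →
      (∀ n, ‖e n‖ < r N ↔ n < N) → (∀ z, ‖z‖ = r N → F z ≠ 0) → ∀ z, ‖z‖ ≤ r N → H z ≠ 0 := by
    intro F e H N hH hFH hHo her hF z hz
    rcases hz.lt_or_eq with hz | hz
    · refine (hH.analyticAt z).analyticOrderAt_eq_zero.1 ?_
      rw [← hHo, encard_eq_zero, eq_empty_iff_forall_notMem]
      rintro n ⟨h1, rfl⟩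
      exact h1 (Finset.mem_range.2 ((her n).1 hz))
    · intro h0
      exact hF z hz (by rw [hFH, h0, mul_zero])
  have hf0 : ∀ᶠ N in atTop, ∀ z, ‖z‖ = r N → f z ≠ 0 := by
    filter_upwards [hfg _ one_half_pos] with N hN z hz h0
    obtain ⟨h1, h2⟩ := hN z hz
    rw [h0, zero_sub, norm_neg] at h2
    linarith [norm_pos_iff.2 h1]
  refine ⟨fun N => k N z₀ / h N z₀, ?_, ?_⟩
  · rw [Metric.tendsto_nhds]
    intro ε hε
    set δ := min (ε / 8) (1 / 2) with hδ
    have hδ0 : 0 < δ := by positivity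
    have hδ1 : δ ≤ ε / 8 := min_le_left _ _
    have hδ2 : δ ≤ 1 / 2 := min_le_right _ _
    filter_upwards [hcr, hdr, hfg δ hδ0, hcd δ hδ0, hf0, hr.eventually_gt_atTop 0,
      hr.eventually_ge_atTop ‖z₀‖] with N hcN hdN hfgN hcdN hfN hrN hzN
    have hh0 := hne (hh N) (hfh N) (hho N) hcN hfN
    have hk0 := hne (hk N) (hgk N) (hko N) hdN fun z hz => (hfgN z hz).1
    rw [dist_eq_norm]
    refine lt_of_le_of_lt ?_ (by linarith : 6 * δ < ε)
    refine Complex.norm_le_of_forall_mem_frontier_norm_le (U := Metric.ball 0 (r N))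
      Metric.isBounded_ball (f := fun z => k N z / h N z - 1) ?_ (fun z hz => ?_) ?_
    · refine DifferentiableOn.diffContOnCl_ball (U := {z | h N z ≠ 0}) ?_ fun z hz => hh0 z (by
        simpa using hz)
      intro z hz
      exact (((hk N) z).div ((hh N) z) hz |>.sub_const 1).differentiableWithinAt
    · rw [frontier_ball _ hrN.ne'] at hz
      have hz' : ‖z‖ = r N := by simpa using hz
      obtain ⟨hg0, hfg1⟩ := hfgN z hz'
      have hd0 : ∀ n ∈ Finset.range N, z - d n ≠ 0 := by
        intro n hn h0
        rw [sub_eq_zero] at h0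
        have := (hdN n).2 (Finset.mem_range.1 hn)
        rw [← h0, hz'] at this
        exact this.false
      set v := ∏ n ∈ Finset.range N, (1 + (d n - c n) / (z - d n)) with hv
      have hve : v * ∏ n ∈ Finset.range N, (z - d n) = ∏ n ∈ Finset.range N, (z - c n) := by
        rw [hv, ← Finset.prod_mul_distrib]
        refine Finset.prod_congr rfl fun n hn => ?_
        have := hd0 n hn
        field_simp
        ring
      have hv1 : ‖v - 1‖ ≤ 2 * δ := by
        refine (Finset.norm_prod_one_add_sub_one_le _ _).trans ?_
        have h1 := hcdN z hz'
        have h2 : (0 : ℝ) ≤ ∑ n ∈ Finset.range N, ‖(d n - c n) / (z - d n)‖ :=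
          Finset.sum_nonneg fun _ _ => norm_nonneg _
        have h3 := Real.abs_exp_sub_one_le (x := ∑ n ∈ Finset.range N, ‖(d n - c n) / (z - d n)‖)
          (by rw [abs_of_nonneg h2]; linarith)
        rw [abs_of_nonneg h2] at h3
        linarith [le_abs_self (Real.exp (∑ n ∈ Finset.range N, ‖(d n - c n) / (z - d n)‖) - 1)]
      have hfz := hfN z hz'
      have hhz := hh0 z hz'.le
      have hpd : ∏ n ∈ Finset.range N, (z - d n) ≠ 0 := Finset.prod_ne_zero_iff.2 hd0
      have hkh : k N z / h N z = g z / f z * v := by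
        rw [div_mul_eq_mul_div, div_eq_div_iff hhz hfz, hfh N z, hgk N z, ← hve]
        ring
      have hu1 : ‖g z / f z - 1‖ ≤ 2 * δ := by
        rw [div_sub_one hfz, norm_div, div_le_iff₀ (norm_pos_iff.2 hfz), norm_sub_rev]
        have h5 : ‖g z‖ ≤ ‖f z‖ + ‖f z - g z‖ := by
          have := norm_sub_le (f z) (f z - g z)
          rwa [sub_sub_cancel] at this
        have h6 : ‖g z‖ ≤ 2 * ‖f z‖ := by nlinarith [norm_nonneg (g z)]
        nlinarith
      rw [hkh]
      have e : g z / f z * v - 1 = (g z / f z - 1) * (v - 1) + (g z / f z - 1) + (v - 1) := by ring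
      rw [e]
      refine (norm_add₃_le).trans ?_
      rw [norm_mul]
      nlinarith [norm_nonneg (v - 1), norm_nonneg (g z / f z - 1)]
    · rw [closure_ball _ hrN.ne']
      simpa using hzN
  · filter_upwards [hcr, hf0, hr.eventually_ge_atTop ‖z₀‖] with N hcN hfN hzN
    have hh0 := hne (hh N) (hfh N) (hho N) hcN hfN z₀ hzN
    rw [hfh N z₀, hgk N z₀]
    field_simp

section products

variable {a : ℝ} {q : ℝ → ℂ}

lemma exists_bound_eigenvalue_sub (ha : 0 < a) (ha2 : 2 * a ≤ π) (ha3 : π ≤ 3 * a)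
    (hq : IsPotential a q) {j : Fin 2} {lam : ℕ → ℂ} (h : IsSpectrum a q j lam) :
    ∃ M, 0 < M ∧ ∀ n, ‖lam n - (freeRoot j n : ℂ) ^ 2‖ ≤ M := by
  have h1 := (tendsto_eigenvalue_asymptotics ha ha2 ha3 hq h).norm
  obtain ⟨B, hB⟩ := h1.bddAbove_range
  set A₀ := ∫ t in a..π, cutoff a q t
  set K := |B| + ‖A₀‖ with hK
  have hK0 : 0 ≤ K := by positivity
  refine ⟨2 * K + K ^ 2 + 1, by positivity, fun n => ?_⟩
  set ε := (lam n) ^ (1 / 2 : ℂ) - freeRoot j n with hε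
  have h2 : ‖2 * π * ((n : ℂ) + 1) * ε - A₀ * Complex.cos (freeRoot j n * a)‖ ≤ B :=
    hB ⟨n, rfl⟩
  have h3 : ‖A₀ * Complex.cos (freeRoot j n * a)‖ ≤ ‖A₀‖ := by
    rw [norm_mul, ← Complex.ofReal_mul, ← Complex.ofReal_cos, Complex.norm_real]
    exact mul_le_of_le_one_right (norm_nonneg _) (Real.abs_cos_le_one _)
  have h4 : ‖2 * π * ((n : ℂ) + 1) * ε‖ ≤ K := by
    have := norm_add_le (2 * π * ((n : ℂ) + 1) * ε - A₀ * Complex.cos (freeRoot j n * a))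
      (A₀ * Complex.cos (freeRoot j n * a))
    rw [sub_add_cancel] at this
    linarith [le_abs_self B]
  have hn : ‖(n : ℂ) + 1‖ = n + 1 := by
    have : ((n : ℂ) + 1) = (((n : ℝ) + 1 : ℝ) : ℂ) := by push_cast; rfl
    rw [this, Complex.norm_real, Real.norm_of_nonneg (by positivity)]
  have hn0 : (0 : ℝ) ≤ n := n.cast_nonneg
  have h5 : (n + 1) * ‖ε‖ ≤ K := by
    rw [norm_mul, norm_mul, norm_mul, hn, Complex.norm_real, Real.norm_of_nonneg pi_pos.le,
      Complex.norm_ofNat] at h4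
    refine le_trans ?_ h4
    have : (1 : ℝ) ≤ 2 * π := by linarith [pi_gt_three]
    have h6 : 0 ≤ (n + 1) * ‖ε‖ := by positivity
    nlinarith
  have h6 : ‖ε‖ ≤ K := by nlinarith [norm_nonneg ε]
  have e : lam n - (freeRoot j n : ℂ) ^ 2 = ε * (2 * freeRoot j n + ε) := by
    rw [← sq_cpow_half (lam n), hε]
    ring
  have hm : freeRoot j n ≤ n + 1 := by
    have := shift_nonneg j
    unfold freeRoot
    linarith
  have hm' : ‖2 * (freeRoot j n : ℂ)‖ ≤ 2 * (n + 1) := by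
    rw [norm_mul, Complex.norm_real, Real.norm_of_nonneg (freeRoot_pos j n).le, Complex.norm_ofNat]
    linarith
  rw [e, norm_mul]
  calc ‖ε‖ * ‖2 * (freeRoot j n : ℂ) + ε‖ ≤ ‖ε‖ * (2 * (n + 1) + ‖ε‖) := by
        gcongr
        exact (norm_add_le _ _).trans (by gcongr)
    _ = 2 * ((n + 1) * ‖ε‖) + ‖ε‖ ^ 2 := by ring
    _ ≤ 2 * K + K ^ 2 := by gcongr
    _ ≤ _ := by linarith

lemma eventually_sum_div_le {j : Fin 2} {M : ℝ} (hM : 0 ≤ M) {c : ℕ → ℂ}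
    (hc : ∀ n, ‖c n - (freeRoot j n : ℂ) ^ 2‖ ≤ M) {ε : ℝ} (hε : 0 < ε) :
    ∀ᶠ N in atTop, ∀ z : ℂ, ‖z‖ = radius j N →
      ∑ n ∈ Finset.range N, ‖((freeRoot j n : ℂ) ^ 2 - c n) / (z - (freeRoot j n : ℂ) ^ 2)‖ ≤ ε := by
  have h1 : Tendsto (fun N : ℕ => 2 * M * ((N : ℝ)⁻¹ * ∑ i ∈ Finset.range N, 1 / ((i : ℝ) + 1)))
      atTop (𝓝 0) := by
    have := (tendsto_one_div_add_atTop_nhds_zero_nat (𝕜 := ℝ)).cesaro.const_mul (2 * M)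
    rwa [mul_zero] at this
  filter_upwards [h1.eventually_lt_const hε, eventually_ge_atTop 1] with N hN hN1 z hz
  refine le_trans ?_ hN.le
  rw [← Finset.sum_range_reflect (fun i : ℕ => 1 / ((i : ℝ) + 1)), ← mul_assoc, Finset.mul_sum]
  refine Finset.sum_le_sum fun n hn => ?_
  have hnN := Finset.mem_range.1 hn
  have hN1' : (1 : ℝ) ≤ N := by exact_mod_cast hN1
  have hnN' : (n : ℝ) + 1 ≤ N := by exact_mod_cast hnN
  have hcast : ((N - 1 - n : ℕ) : ℝ) = N - 1 - n := by
    rw [Nat.sub_sub, Nat.cast_sub (by lia)]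
    push_cast
    ring
  have hs := shift_le j
  have hs0 := shift_nonneg j
  have hlow : (N : ℝ) * (N - n - 1 / 2) ≤ ‖z - (freeRoot j n : ℂ) ^ 2‖ := by
    have h2 := norm_sub_norm_le z ((freeRoot j n : ℂ) ^ 2)
    rw [hz, norm_pow, Complex.norm_real, Real.norm_of_nonneg (freeRoot_pos j n).le, radius] at h2
    refine le_trans ?_ h2
    have h3 : ((N : ℝ) + 1 / 2 - shift j) ^ 2 - freeRoot j n ^ 2
        = (N - n - 1 / 2) * (N + 1 / 2 - shift j + freeRoot j n) := by
      unfold freeRoot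
      ring
    rw [h3, mul_comm]
    have := freeRoot_pos j n
    exact mul_le_mul_of_nonneg_left (by linarith) (by linarith)
  have hpos : (0 : ℝ) < N - n := by linarith
  rw [hcast, norm_div, norm_sub_rev]
  have e : (N : ℝ) - 1 - n + 1 = N - n := by ring
  rw [e]
  calc ‖c n - (freeRoot j n : ℂ) ^ 2‖ / ‖z - (freeRoot j n : ℂ) ^ 2‖
      ≤ M / (N * ((N - n) / 2)) := by
        refine div_le_div₀ hM (hc n) (by positivity) (le_trans ?_ hlow)
        exact mul_le_mul_of_nonneg_left (by linarith) (by linarith)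
    _ = 2 * M * (N : ℝ)⁻¹ * (1 / (N - n)) := by
        field_simp

lemma tendsto_euler_sin_prod_range (ρ : ℂ) :
    Tendsto (fun N : ℕ => π * ρ * ∏ n ∈ Finset.range N, (1 - ρ ^ 2 / ((n : ℂ) + 1) ^ 2)) atTop
      (𝓝 (Complex.sin (π * ρ))) :=
  Complex.tendsto_euler_sin_prod ρ

lemma prod_range_two_mul {M : Type*} [CommMonoid M] (u : ℕ → M) (N : ℕ) :
    ∏ n ∈ Finset.range (2 * N), u n
      = (∏ n ∈ Finset.range N, u (2 * n)) * ∏ n ∈ Finset.range N, u (2 * n + 1) := by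
  induction N with
  | zero => simp
  | succ N ih =>
    rw [mul_add, mul_one, Finset.prod_range_succ, Finset.prod_range_succ, ih,
      Finset.prod_range_succ, Finset.prod_range_succ]
    exact (mul_assoc _ _ _).trans (mul_mul_mul_comm _ _ _ _)

/-- The product for the cosine, as a quotient of products for the sine. -/
lemma tendsto_euler_cos_prod {ρ : ℂ} (hρ : Complex.sin (π * ρ) ≠ 0) :
    Tendsto (fun N : ℕ => ∏ n ∈ Finset.range N, (1 - ρ ^ 2 / ((n : ℂ) + 1 / 2) ^ 2)) atTop
      (𝓝 (Complex.cos (π * ρ))) := by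
  have h1 := tendsto_euler_sin_prod_range ρ
  have h2 := (tendsto_euler_sin_prod_range (2 * ρ)).comp (tendsto_id.const_mul_atTop' two_pos)
  have h3 := (h2.div h1 hρ).const_mul (1 / 2 : ℂ)
  have e : (1 / 2 : ℂ) * (Complex.sin (π * (2 * ρ)) / Complex.sin (π * ρ))
      = Complex.cos (π * ρ) := by
    rw [show (π : ℂ) * (2 * ρ) = 2 * (π * ρ) by ring, Complex.sin_two_mul]
    field_simp
  rw [e] at h3
  refine h3.congr' ?_
  filter_upwards [h1.eventually_ne hρ] with N hN
  simp only [Function.comp, Pi.div_apply, id]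
  rw [prod_range_two_mul]
  have e1 : ∏ n ∈ Finset.range N, (1 - (2 * ρ) ^ 2 / (((2 * n : ℕ) : ℂ) + 1) ^ 2)
      = ∏ n ∈ Finset.range N, (1 - ρ ^ 2 / ((n : ℂ) + 1 / 2) ^ 2) := by
    refine Finset.prod_congr rfl fun n _ => ?_
    have : (((2 * n : ℕ) : ℂ) + 1) = 2 * ((n : ℂ) + 1 / 2) := by push_cast; ring
    rw [this, mul_pow, mul_pow, mul_div_mul_left _ _ (by norm_num)]
  have e2 : ∏ n ∈ Finset.range N, (1 - (2 * ρ) ^ 2 / (((2 * n + 1 : ℕ) : ℂ) + 1) ^ 2)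
      = ∏ n ∈ Finset.range N, (1 - ρ ^ 2 / ((n : ℂ) + 1) ^ 2) := by
    refine Finset.prod_congr rfl fun n _ => ?_
    have : (((2 * n + 1 : ℕ) : ℂ) + 1) = 2 * ((n : ℂ) + 1) := by push_cast; ring
    rw [this, mul_pow, mul_pow, mul_div_mul_left _ _ (by norm_num)]
  rw [e1, e2]
  have h4 : ρ ≠ 0 := by
    rintro rfl
    simp at hρ
  have h5 := right_ne_zero_of_mul hN
  have hπ : (π : ℂ) ≠ 0 := by exact_mod_cast pi_ne_zero
  generalize ∏ n ∈ Finset.range N, (1 - ρ ^ 2 / ((n : ℂ) + 1) ^ 2) = P at h5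
  field_simp

/-- The product formula for the zero potential, away from the zeros of `sin 2πρ`. -/
lemma tendsto_prod_freeRoot (ha : 0 < a) (ha3 : π ≤ 3 * a) (j : Fin 2) {ρ : ℂ}
    (hρ : Complex.sin (π * ρ) ≠ 0) :
    Tendsto (fun N : ℕ => (![π, 1] j : ℂ) * ∏ n ∈ Finset.range N,
      ((freeRoot j n : ℂ) ^ 2 - ρ ^ 2) / (freeRoot j n : ℂ) ^ 2) atTop
      (𝓝 (characteristicFn a 0 j (ρ ^ 2))) := by
  have hw := weight_mul_characteristicFn_zero ha ha3 j ρ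
  have hm : ∀ n, (freeRoot j n : ℂ) ≠ 0 := fun n => by exact_mod_cast (freeRoot_pos j n).ne'
  have hρ0 : ρ ≠ 0 := by
    rintro rfl
    simp at hρ
  have hprod : ∀ N, ∏ n ∈ Finset.range N, ((freeRoot j n : ℂ) ^ 2 - ρ ^ 2) / (freeRoot j n : ℂ) ^ 2
      = ∏ n ∈ Finset.range N, (1 - ρ ^ 2 / (freeRoot j n : ℂ) ^ 2) := fun N =>
    Finset.prod_congr rfl fun n _ => by
      rw [sub_div, div_self (pow_ne_zero _ (hm n))]
  simp only [hprod]
  fin_cases j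
  · have h1 := (tendsto_euler_sin_prod_range ρ).const_mul ρ⁻¹
    simp only [Fin.zero_eta, Matrix.cons_val_zero, shift] at hw ⊢
    rw [Complex.ofReal_zero, add_zero] at hw
    rw [← hw, inv_mul_cancel_left₀ hρ0] at h1
    refine h1.congr fun N => ?_
    simp only [freeRoot, shift, Matrix.cons_val_zero, sub_zero]
    push_cast
    field_simp
  · have h1 := tendsto_euler_cos_prod hρ
    simp only [Fin.mk_one, Matrix.cons_val_one, Matrix.cons_val_fin_one, shift, one_mul,
      Complex.ofReal_one] at hw ⊢
    have e : Complex.sin (π * (ρ + ((1 / 2 : ℝ) : ℂ))) = Complex.cos (π * ρ) := by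
      rw [← Complex.sin_add_pi_div_two]
      push_cast
      ring_nf
    rw [hw, e]
    refine h1.congr fun N => Finset.prod_congr rfl fun n _ => ?_
    simp only [freeRoot, shift, Matrix.cons_val_one, Matrix.cons_val_fin_one]
    push_cast
    ring_nf

lemma eventually_freeRoot_sq_lt_radius (j : Fin 2) :
    ∀ᶠ N in atTop, ∀ n, ‖(freeRoot j n : ℂ) ^ 2‖ < radius j N ↔ n < N :=
  Eventually.of_forall fun N n => norm_freeRoot_sq_lt_radius_iff j n N

/-- The partial products converge, locally uniformly with respect to the spectral parameter. -/
lemma exists_continuous_tendsto_prod {j : Fin 2} {M : ℝ} {c : ℕ → ℂ}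
    (hc : ∀ n, ‖c n - (freeRoot j n : ℂ) ^ 2‖ ≤ M) :
    ∃ P : ℂ → ℂ, Continuous P ∧ ∀ μ, Tendsto (fun N : ℕ => ∏ n ∈ Finset.range N,
      (c n - μ) / (freeRoot j n : ℂ) ^ 2) atTop (𝓝 (P μ)) := by
  have hm : ∀ n, (freeRoot j n : ℂ) ≠ 0 := fun n => by exact_mod_cast (freeRoot_pos j n).ne'
  set F : ℕ → ℂ → ℂ := fun n μ => (c n - (freeRoot j n : ℂ) ^ 2 - μ) / (freeRoot j n : ℂ) ^ 2 with hF
  have hfac : ∀ n μ, (c n - μ) / (freeRoot j n : ℂ) ^ 2 = 1 + F n μ := by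
    intro n μ
    have := hm n
    simp only [hF]
    field_simp
    ring
  have hsum : ∀ B : ℝ, Summable fun n : ℕ => B * (4 * (1 / ((n : ℝ) + 1) ^ 2)) := fun B =>
    (((summable_nat_add_iff 1).2 (Real.summable_one_div_nat_pow.2 one_lt_two)).congr
      (by intro n; push_cast; rfl)).mul_left 4 |>.mul_left B
  have hbound : ∀ B : ℝ, ∀ n, ∀ μ ∈ Metric.ball (0 : ℂ) B,
      ‖F n μ‖ ≤ (M + B) * (4 * (1 / ((n : ℝ) + 1) ^ 2)) := by
    intro B n μ hμ
    have hμ' : ‖μ‖ ≤ B := (by simpa using hμ : ‖μ‖ < B).le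
    have h1 : ‖c n - (freeRoot j n : ℂ) ^ 2 - μ‖ ≤ M + B :=
      (norm_sub_le _ _).trans (add_le_add (hc n) hμ')
    have h2 : ((n : ℝ) + 1) / 2 ≤ freeRoot j n := by
      have := shift_le j
      have : (0 : ℝ) ≤ n := n.cast_nonneg
      unfold freeRoot
      linarith
    have hn : (0 : ℝ) < (n : ℝ) + 1 := by positivity
    have h3 : (((n : ℝ) + 1) / 2) ^ 2 ≤ freeRoot j n ^ 2 := by gcongr
    simp only [hF]
    rw [norm_div, norm_pow, Complex.norm_real, Real.norm_of_nonneg (freeRoot_pos j n).le]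
    calc _ ≤ (M + B) / (((n : ℝ) + 1) / 2) ^ 2 :=
          div_le_div₀ ((norm_nonneg _).trans h1) h1 (by positivity) h3
      _ = _ := by
        field_simp
        ring
  have hcont : ∀ n, Continuous (F n) := fun n => by fun_prop
  have hloc : ∀ B : ℝ, TendstoLocallyUniformlyOn
      (fun N μ => ∏ n ∈ Finset.range N, (1 + F n μ)) (fun μ => ∏' n, (1 + F n μ)) atTop
      (Metric.ball (0 : ℂ) B) := fun B =>
    (Summable.hasProdLocallyUniformlyOn_nat_one_add Metric.isOpen_ball (hsum (M + B))
      (Eventually.of_forall (hbound B))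
      fun n => (hcont n).continuousOn).tendstoLocallyUniformlyOn_finsetRange
  refine ⟨fun μ => ∏' n, (1 + F n μ), ?_, fun μ => ?_⟩
  · rw [continuous_iff_continuousAt]
    intro μ
    refine ContinuousOn.continuousAt ((hloc (‖μ‖ + 1)).continuousOn (Frequently.of_forall fun N => ?_))
      (Metric.isOpen_ball.mem_nhds (by simp))
    exact (continuous_finsetProd _ fun n _ => continuous_const.add (hcont n)).continuousOn
  · simp only [hfac]
    exact (hloc (‖μ‖ + 1)).tendsto_at (by simp)

/-- The product formula for the characteristic functions. The comparison with the zero potential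
gives it outside a countable set, and continuity everywhere. -/
lemma tendsto_prod_eigenvalue (ha : 0 < a) (ha2 : 2 * a ≤ π) (ha3 : π ≤ 3 * a)
    (hq : IsPotential a q) {j : Fin 2} {lam : ℕ → ℂ} (h : IsSpectrum a q j lam) (μ : ℂ) :
    Tendsto (fun N : ℕ => (![π, 1] j : ℂ) * ∏ n ∈ Finset.range N,
      (lam n - μ) / (freeRoot j n : ℂ) ^ 2) atTop (𝓝 (characteristicFn a q j μ)) := by
  obtain ⟨M, hM, hlam⟩ := exists_bound_eigenvalue_sub ha ha2 ha3 hq h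
  obtain ⟨P, hP, hlim⟩ := exists_continuous_tendsto_prod hlam
  have hf := differentiable_characteristicFn ha ha3 hq j
  have hm : ∀ n, (freeRoot j n : ℂ) ≠ 0 := fun n => by exact_mod_cast (freeRoot_pos j n).ne'
  set E : Set ℂ := (range fun k : ℤ => (k : ℂ) ^ 2) ∪ range fun n => (freeRoot j n : ℂ) ^ 2 with hE
  have hdense : Dense Eᶜ :=
    ((countable_range _).union (countable_range _)).dense_compl ℝ
  have key : (fun μ => (![π, 1] j : ℂ) * P μ) = characteristicFn a q j := by
    refine Continuous.ext_on hdense (continuous_const.mul hP) hf.continuous fun μ hμ => ?_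
    obtain ⟨ρ, rfl⟩ : ∃ ρ : ℂ, ρ ^ 2 = μ := IsAlgClosed.exists_pow_nat_eq μ two_pos
    have hsin : Complex.sin (π * ρ) ≠ 0 := by
      intro h0
      obtain ⟨k, hk⟩ := Complex.sin_eq_zero_iff.1 h0
      have hπ : (π : ℂ) ≠ 0 := by exact_mod_cast pi_ne_zero
      rw [mul_comm] at hk
      exact hμ (Or.inl ⟨k, by rw [mul_right_cancel₀ hπ hk]⟩)
    have hg0 : characteristicFn a 0 j (ρ ^ 2) ≠ 0 := by
      intro h0
      obtain ⟨n, hn⟩ := (characteristicFn_zero_eq_zero_iff ha ha3 j _).1 h0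
      exact hμ (Or.inr ⟨n, hn.symm⟩)
    obtain ⟨t, ht, hratio⟩ := exists_prod_ratio hf
      (differentiable_characteristicFn ha ha3 (isPotential_zero a) j)
      (isZeroSeq_of_isSpectrum ha ha3 hq h) (isZeroSeq_freeRoot ha ha3 j) (tendsto_radius j)
      (norm_lt_radius_iff ha ha2 ha3 hq h) (eventually_freeRoot_sq_lt_radius j)
      (fun ε hε => characteristicFn_asymptotic ha ha2 ha3 hq j hε)
      (fun ε hε => eventually_sum_div_le hM.le hlam hε) (ρ ^ 2)
    have h1 := ((tendsto_prod_freeRoot ha ha3 j hsin).mul_const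
      (characteristicFn a q j (ρ ^ 2) / characteristicFn a 0 j (ρ ^ 2))).mul ht
    rw [mul_one, mul_div_cancel₀ _ hg0] at h1
    refine tendsto_nhds_unique ((hlim (ρ ^ 2)).const_mul _) (h1.congr' ?_)
    filter_upwards [hratio] with N hN
    have hsign : ∀ e : ℕ → ℂ, ∏ n ∈ Finset.range N, (e n - ρ ^ 2) / (freeRoot j n : ℂ) ^ 2
        = (-1) ^ N * (∏ n ∈ Finset.range N, (ρ ^ 2 - e n))
          / ∏ n ∈ Finset.range N, (freeRoot j n : ℂ) ^ 2 := by
      intro e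
      rw [Finset.prod_div_distrib]
      congr 1
      rw [← Finset.card_range N, ← Finset.prod_const, Finset.card_range, ← Finset.prod_mul_distrib]
      refine Finset.prod_congr rfl fun n _ => ?_
      ring
    rw [hsign, hsign]
    have hw : ∏ n ∈ Finset.range N, (freeRoot j n : ℂ) ^ 2 ≠ 0 :=
      Finset.prod_ne_zero_iff.2 fun n _ => pow_ne_zero _ (hm n)
    field_simp
    linear_combination -(![π, 1] j : ℂ) * hN
  rw [← key]
  exact (hlim μ).const_mul _

end products

/-! ### Absolutely continuous potentials -/

section absolutelyContinuous

variable {f : ℝ → ℂ} {α β : ℝ}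

lemma absolutelyContinuousOnInterval_comp_of_dist_le {X Y : Type*} [PseudoMetricSpace X]
    [PseudoMetricSpace Y] {f : ℝ → X} (hf : AbsolutelyContinuousOnInterval f α β) {g : ℝ → Y}
    (hg : ∀ x y, dist (g x) (g y) ≤ dist (f x) (f y)) : AbsolutelyContinuousOnInterval g α β :=
  squeeze_zero (fun _ => Finset.sum_nonneg fun _ _ => dist_nonneg)
    (fun _ => Finset.sum_le_sum fun _ _ => hg _ _) hf

lemma absolutelyContinuousOnInterval_re (hf : AbsolutelyContinuousOnInterval f α β) :
    AbsolutelyContinuousOnInterval (fun x => (f x).re) α β :=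
  absolutelyContinuousOnInterval_comp_of_dist_le hf fun x y => by
    simpa [dist_eq_norm] using Complex.abs_re_le_norm (f x - f y)

lemma absolutelyContinuousOnInterval_im (hf : AbsolutelyContinuousOnInterval f α β) :
    AbsolutelyContinuousOnInterval (fun x => (f x).im) α β :=
  absolutelyContinuousOnInterval_comp_of_dist_le hf fun x y => by
    simpa [dist_eq_norm] using Complex.abs_im_le_norm (f x - f y)

lemma deriv_eq_re_add_im (hf : AbsolutelyContinuousOnInterval f α β) :
    ∀ᵐ x, x ∈ uIcc α β → deriv f x
      = ((deriv (fun x => (f x).re) x : ℝ) : ℂ) + (deriv (fun x => (f x).im) x : ℝ) * Complex.I := by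
  filter_upwards [(absolutelyContinuousOnInterval_re hf).ae_differentiableAt,
    (absolutelyContinuousOnInterval_im hf).ae_differentiableAt] with x h1 h2 hx
  have h := ((h1 hx).hasDerivAt.ofReal_comp).add (((h2 hx).hasDerivAt.ofReal_comp).mul_const Complex.I)
  refine HasDerivAt.deriv (h.congr_of_eventuallyEq (Eventually.of_forall fun y => ?_))
  simp

lemma intervalIntegrable_ofReal {g : ℝ → ℝ} (hg : IntervalIntegrable g volume α β) :
    IntervalIntegrable (fun x => (g x : ℂ)) volume α β :=
  ⟨hg.1.ofReal, hg.2.ofReal⟩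

lemma intervalIntegrable_deriv_of_absolutelyContinuous
    (hf : AbsolutelyContinuousOnInterval f α β) : IntervalIntegrable (deriv f) volume α β := by
  have h := (intervalIntegrable_ofReal (absolutelyContinuousOnInterval_re hf).intervalIntegrable_deriv).add
    ((intervalIntegrable_ofReal (absolutelyContinuousOnInterval_im hf).intervalIntegrable_deriv).mul_const Complex.I)
  refine h.congr_ae ?_
  rw [EventuallyEq, ae_restrict_iff' measurableSet_uIoc]
  filter_upwards [deriv_eq_re_add_im hf] with x hx hm
  exact (hx (uIoc_subset_uIcc hm)).symm

lemma integral_deriv_of_absolutelyContinuous (hf : AbsolutelyContinuousOnInterval f α β) :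
    ∫ x in α..β, deriv f x = f β - f α := by
  have h1 := (absolutelyContinuousOnInterval_re hf).integral_deriv_eq_sub
  have h2 := (absolutelyContinuousOnInterval_im hf).integral_deriv_eq_sub
  have h3 : ∫ x in α..β, deriv f x = ∫ x in α..β, (((deriv (fun x => (f x).re) x : ℝ) : ℂ)
      + (deriv (fun x => (f x).im) x : ℝ) * Complex.I) := by
    refine intervalIntegral.integral_congr_ae ?_
    filter_upwards [deriv_eq_re_add_im hf] with x hx hm
    exact hx (uIoc_subset_uIcc hm)
  rw [h3, intervalIntegral.integral_add
      (intervalIntegrable_ofReal (absolutelyContinuousOnInterval_re hf).intervalIntegrable_deriv)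
      ((intervalIntegrable_ofReal (absolutelyContinuousOnInterval_im hf).intervalIntegrable_deriv).mul_const _),
    intervalIntegral.integral_mul_const, intervalIntegral.integral_ofReal,
    intervalIntegral.integral_ofReal, h1, h2]
  apply Complex.ext <;> simp

lemma eq_add_integral_deriv (hf : AbsolutelyContinuousOnInterval f α β) {x : ℝ}
    (hx : x ∈ Icc α β) : f x = f α + ∫ t in α..x, deriv f t := by
  have hαβ : α ≤ β := hx.1.trans hx.2
  rw [integral_deriv_of_absolutelyContinuous (hf.mono ?_)]
  · ring
  · rw [uIcc_of_le hx.1, uIcc_of_le hαβ]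
    exact Icc_subset_Icc_right hx.2

lemma eq_sub_integral_deriv (hf : AbsolutelyContinuousOnInterval f α β) {x : ℝ}
    (hx : x ∈ Icc α β) : f x = f β - ∫ t in x..β, deriv f t := by
  have hαβ : α ≤ β := hx.1.trans hx.2
  rw [integral_deriv_of_absolutelyContinuous (hf.mono ?_)]
  · ring
  · rw [uIcc_of_le hx.2, uIcc_of_le hαβ]
    exact Icc_subset_Icc_left hx.1

/-- Integration by parts for `2iρ ∫ q(t) e^{iρ(2t - π - a)} dt`. -/
lemma integral_mul_wave_by_parts {a : ℝ} (ha : a ≤ π) {q : ℝ → ℂ}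
    (hq : AbsolutelyContinuousOnInterval q a π) (ρ : ℂ) :
    2 * Complex.I * ρ * ∫ t in a..π, q t * wave ρ (2 * t - π - a)
      = q π * wave ρ (π - a) - q a * wave ρ (a - π)
        - ∫ t in a..π, deriv q t * wave ρ (2 * t - π - a) := by
  set p := deriv q with hp
  have hpi : IntervalIntegrable p volume a π := intervalIntegrable_deriv_of_absolutelyContinuous hq
  set φ : ℝ → ℂ := fun t => wave ρ (2 * t - π - a) with hφ
  set φ' : ℝ → ℂ := fun t => 2 * Complex.I * ρ * wave ρ (2 * t - π - a) with hφ'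
  have hcont : Continuous φ := (continuous_wave ρ).comp (by fun_prop)
  have hcont' : Continuous φ' := continuous_const.mul hcont
  have hd : ∀ t, HasDerivAt φ (φ' t) t := by
    intro t
    have h1 : HasDerivAt (fun t : ℝ => 2 * t - π - a) 2 t := by
      simpa using! (((hasDerivAt_id t).const_mul 2).sub_const π).sub_const a
    have h2 := HasDerivAt.scomp t (hasDerivAt_wave ρ (2 * t - π - a)) h1
    refine h2.congr_deriv ?_
    simp only [hφ', Complex.real_smul]
    push_cast
    ring
  have h1 := integral_primitive_mul_deriv ha hpi hd hcont'
  have h2 : ∫ x in a..π, φ' x = φ π - φ a :=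
    intervalIntegral.integral_eq_sub_of_hasDerivAt (fun x _ => hd x) (hcont'.intervalIntegrable _ _)
  have h3 : ∫ t in a..π, p t * (φ π - φ t) = (q π - q a) * φ π - ∫ t in a..π, p t * φ t := by
    have e : ∀ t, p t * (φ π - φ t) = p t * φ π - p t * φ t := fun t => mul_sub _ _ _
    simp only [e]
    rw [intervalIntegral.integral_sub (hpi.mul_const _) (hpi.mul_continuousOn hcont.continuousOn),
      intervalIntegral.integral_mul_const, hp, integral_deriv_of_absolutelyContinuous hq]
  have hprim : ContinuousOn (fun x => ∫ t in a..x, p t) (uIcc a π) :=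
    intervalIntegral.continuousOn_primitive_interval' hpi left_mem_uIcc
  have h4 : 2 * Complex.I * ρ * ∫ t in a..π, q t * wave ρ (2 * t - π - a)
      = (∫ x in a..π, (∫ t in a..x, p t) * φ' x) + q a * ∫ x in a..π, φ' x := by
    rw [← intervalIntegral.integral_const_mul, ← intervalIntegral.integral_const_mul,
      ← intervalIntegral.integral_add (f := fun x => (∫ t in a..x, p t) * φ' x)
        ((hprim.mul hcont'.continuousOn).intervalIntegrable)
        ((hcont'.intervalIntegrable _ _).const_mul _)]
    refine intervalIntegral.integral_congr fun t ht => ?_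
    rw [uIcc_of_le ha] at ht
    simp only [hφ']
    rw [eq_add_integral_deriv hq ht]
    ring
  have e1 : φ π = wave ρ (π - a) := by simp only [hφ]; congr 1; ring
  have e2 : φ a = wave ρ (a - π) := by simp only [hφ]; congr 1; ring
  rw [h4, h1, h2, h3, e1, e2]
  ring

/-- The function `R` of the algorithm. -/
noncomputable def densityR (a : ℝ) (q : ℝ → ℂ) (ξ : ℝ) : ℂ :=
  deriv q (ξ / 2 + π / 2 + a / 2) - quadraticPart a q ξ

end absolutelyContinuous

section stars

variable {a : ℝ} {q : ℝ → ℂ}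

lemma integral_cutoff_mul (ha : a ≤ π) (q g : ℝ → ℂ) :
    ∫ t in a..π, cutoff a q t * g t = ∫ t in a..π, q t * g t := by
  refine intervalIntegral.integral_congr_ae ?_
  filter_upwards [compl_mem_ae_iff.2 (measure_singleton π)] with t ht hm
  rw [uIoc_of_le ha] at hm
  rw [cutoff_of_mem ⟨hm.1, lt_of_le_of_ne hm.2 ht⟩]

lemma integral_cutoff (ha : a ≤ π) (q : ℝ → ℂ) :
    ∫ t in a..π, cutoff a q t = ∫ t in a..π, q t := by
  simpa using integral_cutoff_mul ha q fun _ => 1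

lemma cutoff_eq_on_ends (ha : 0 < a) (q : ℝ → ℂ) :
    ∀ᵐ x : ℝ, x ∈ Ioo a (π - a) ∪ Ioo (2 * a) π → cutoff a q x = q x := by
  refine ae_of_all _ fun x hx => cutoff_of_mem ?_
  rcases hx with hx | hx
  · exact ⟨hx.1, by linarith [hx.2]⟩
  · exact ⟨by linarith [hx.1], hx.2⟩

lemma intervalIntegrable_densityR (ha : 0 < a) (ha2 : 2 * a ≤ π) (hq : IsPotential a q)
    (hac : AbsolutelyContinuousOnInterval q a π) :
    IntervalIntegrable (densityR a q) volume (-(π - a)) (π - a) := by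
  refine (intervalIntegrable_comp_affine
    (intervalIntegrable_deriv_of_absolutelyContinuous hac)).sub ?_
  exact (intervalIntegrable_quadraticPart ha2 ha.le (integrable_cutoff hq)).congr_ae
    (ae_restrict_of_ae (quadraticPart_ae_eq (cutoff_eq_on_ends ha q)))

/-- The main identity for an absolutely continuous potential. -/
lemma eight_mul_solDefect (ha : 0 < a) (ha2 : 2 * a ≤ π) (hq : IsPotential a q)
    (hac : AbsolutelyContinuousOnInterval q a π) (ρ : ℂ) :
    8 * ρ ^ 2 * solDefect a (cutoff a q) ρ
      = 4 * Complex.I * ρ * (∫ t in a..π, q t) * wave ρ (a - π)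
        - 2 * q π * wave ρ (π - a) + 2 * q a * wave ρ (a - π)
        - 2 * (∫ t in (2 * a)..π, q t * ∫ s in a..(t - a), q s) * wave ρ (2 * a - π)
        + ∫ ξ in -(π - a)..(π - a), densityR a q ξ * wave ρ ξ := by
  have haπ : a ≤ π := by linarith
  have hends := cutoff_eq_on_ends ha q
  have h1 := sol_identity (fun x hx => cutoff_of_le hx) ha.le ha2 (integrable_cutoff hq) ρ
  have h2 := integral_mul_wave_by_parts haπ hac ρ
  have h3 := integral_comp_affine_mul_wave (a := a) (deriv q) ρ
  have h4 : ∫ ξ in -(π - a)..(π - a), quadraticPart a (cutoff a q) ξ * wave ρ ξ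
      = ∫ ξ in -(π - a)..(π - a), quadraticPart a q ξ * wave ρ ξ := by
    refine intervalIntegral.integral_congr_ae ?_
    filter_upwards [quadraticPart_ae_eq hends] with ξ hξ _
    rw [hξ]
  have hQ : IntervalIntegrable (quadraticPart a q) volume (-(π - a)) (π - a) :=
    (intervalIntegrable_quadraticPart ha2 ha.le (integrable_cutoff hq)).congr_ae
      (ae_restrict_of_ae (quadraticPart_ae_eq hends))
  have h5 : ∫ ξ in -(π - a)..(π - a), densityR a q ξ * wave ρ ξ
      = (∫ ξ in -(π - a)..(π - a), deriv q (ξ / 2 + π / 2 + a / 2) * wave ρ ξ)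
        - ∫ ξ in -(π - a)..(π - a), quadraticPart a q ξ * wave ρ ξ := by
    rw [← intervalIntegral.integral_sub]
    · refine intervalIntegral.integral_congr fun ξ _ => ?_
      simp only [densityR]
      ring
    · exact (intervalIntegrable_comp_affine
        (intervalIntegrable_deriv_of_absolutelyContinuous hac)).mul_continuousOn
        (continuous_wave ρ).continuousOn
    · exact hQ.mul_continuousOn (continuous_wave ρ).continuousOn
  rw [integral_cutoff haπ, integral_cutoff_mul haπ q fun t => wave ρ (2 * t - π - a), h4,
    quadraticConst_eq hends ha2] at h1
  rw [h5, h3, solDefect]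
  linear_combination h1 - 2 * h2

lemma wave_sub_wave_neg (ρ : ℂ) (x : ℝ) :
    wave ρ x - wave (-ρ) x = 2 * Complex.I * Complex.sin (ρ * x) := by
  rw [wave_eq_cos_add_sin, wave_eq_cos_add_sin, neg_mul, Complex.cos_neg, Complex.sin_neg]
  ring

lemma wave_add_wave_neg (ρ : ℂ) (x : ℝ) :
    wave ρ x + wave (-ρ) x = 2 * Complex.cos (ρ * x) := by
  rw [wave_eq_cos_add_sin, wave_eq_cos_add_sin, neg_mul, Complex.cos_neg, Complex.sin_neg]
  ring

lemma integral_mul_sin {R : ℝ → ℂ} {α β : ℝ} (hR : IntervalIntegrable R volume α β) (ρ : ℂ) :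
    2 * Complex.I * ∫ ξ in α..β, R ξ * Complex.sin (ρ * ξ)
      = (∫ ξ in α..β, R ξ * wave ρ ξ) - ∫ ξ in α..β, R ξ * wave (-ρ) ξ := by
  rw [← intervalIntegral.integral_sub (hR.mul_continuousOn (continuous_wave _).continuousOn)
    (hR.mul_continuousOn (continuous_wave _).continuousOn), ← intervalIntegral.integral_const_mul]
  refine intervalIntegral.integral_congr fun ξ _ => ?_
  linear_combination -R ξ * wave_sub_wave_neg ρ ξ

lemma integral_mul_cos {R : ℝ → ℂ} {α β : ℝ} (hR : IntervalIntegrable R volume α β) (ρ : ℂ) :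
    2 * ∫ ξ in α..β, R ξ * Complex.cos (ρ * ξ)
      = (∫ ξ in α..β, R ξ * wave ρ ξ) + ∫ ξ in α..β, R ξ * wave (-ρ) ξ := by
  rw [← intervalIntegral.integral_add (hR.mul_continuousOn (continuous_wave _).continuousOn)
    (hR.mul_continuousOn (continuous_wave _).continuousOn), ← intervalIntegral.integral_const_mul]
  refine intervalIntegral.integral_congr fun ξ _ => ?_
  linear_combination -R ξ * wave_add_wave_neg ρ ξ

/-- The remainder `Δ₀*` of the first characteristic function. -/
noncomputable def starZero (a : ℝ) (q : ℝ → ℂ) (ρ : ℂ) : ℂ :=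
  2 * ρ ^ 2 * characteristicFn a q 0 (ρ ^ 2) - 2 * ρ * Complex.sin (ρ * π)
    + (∫ t in a..π, q t) * Complex.cos (ρ * (π - a))

/-- The remainder `Δ₁*` of the second characteristic function. -/
noncomputable def starOne (a : ℝ) (q : ℝ → ℂ) (ρ : ℂ) : ℂ :=
  2 * ρ * characteristicFn a q 1 (ρ ^ 2) - 2 * ρ * Complex.cos (ρ * π)
    - (∫ t in a..π, q t) * Complex.sin (ρ * (π - a))

lemma four_mul_starOne_sub (ha : 0 < a) (ha2 : 2 * a ≤ π) (ha3 : π ≤ 3 * a) (hq : IsPotential a q)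
    (hac : AbsolutelyContinuousOnInterval q a π) (ρ : ℂ) :
    4 * ρ * starOne a q ρ - Complex.I * (4 * ρ * starZero a q ρ)
      = 2 * q a * wave ρ (a - π) - 2 * q π * wave ρ (π - a)
        - 2 * (∫ t in (2 * a)..π, q t * ∫ s in a..(t - a), q s) * wave ρ (2 * a - π)
        + ∫ ξ in -(π - a)..(π - a), densityR a q ξ * wave ρ ξ := by
  have h1 := eight_mul_solDefect ha ha2 hq hac ρ
  have h2 := wave_eq_cos_add_sin ρ (-π)
  have h3 := wave_eq_cos_add_sin ρ (a - π)
  have e1 : ρ * ((-π : ℝ) : ℂ) = -(ρ * π) := by push_cast; ring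
  have e2 : ρ * ((a - π : ℝ) : ℂ) = -(ρ * (π - a)) := by push_cast; ring
  rw [e1, Complex.cos_neg, Complex.sin_neg] at h2
  rw [e2, Complex.cos_neg, Complex.sin_neg] at h3
  have c0 := characteristicFn_sq ha ha3 hq 0 ρ
  have c1 := characteristicFn_sq ha ha3 hq 1 ρ
  simp only [Matrix.cons_val_zero, Matrix.cons_val_one, Matrix.cons_val_fin_one] at c0 c1
  rw [solDefect, ← c0, ← c1] at h1
  simp only [starOne, starZero]
  linear_combination h1 + 8 * ρ ^ 2 * h2 + 4 * Complex.I * ρ * (∫ t in a..π, q t) * h3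
    - 4 * ρ * (∫ t in a..π, q t) * Complex.sin (ρ * (π - a)) * Complex.I_sq

lemma starZero_neg (ρ : ℂ) : starZero a q (-ρ) = starZero a q ρ := by
  simp only [starZero, neg_sq, neg_mul, Complex.sin_neg, Complex.cos_neg]
  ring

lemma starOne_neg (ρ : ℂ) : starOne a q (-ρ) = -starOne a q ρ := by
  simp only [starOne, neg_sq, neg_mul, Complex.sin_neg, Complex.cos_neg]
  ring

lemma four_mul_starZero (ha : 0 < a) (ha2 : 2 * a ≤ π) (ha3 : π ≤ 3 * a) (hq : IsPotential a q)
    (hac : AbsolutelyContinuousOnInterval q a π) (ρ : ℂ) :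
    4 * ρ * starZero a q ρ = 2 * (q a + q π) * Complex.sin (ρ * (π - a))
      - 2 * (∫ t in (2 * a)..π, q t * ∫ s in a..(t - a), q s) * Complex.sin (ρ * (π - 2 * a))
      - ∫ ξ in -(π - a)..(π - a), densityR a q ξ * Complex.sin (ρ * ξ) := by
  have h1 := four_mul_starOne_sub ha ha2 ha3 hq hac ρ
  have h2 := four_mul_starOne_sub ha ha2 ha3 hq hac (-ρ)
  rw [starZero_neg, starOne_neg] at h2
  have h3 := integral_mul_sin (intervalIntegrable_densityR ha ha2 hq hac) ρ
  have w1 := wave_sub_wave_neg ρ (a - π)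
  have w2 := wave_sub_wave_neg ρ (π - a)
  have w3 := wave_sub_wave_neg ρ (2 * a - π)
  have e1 : ρ * ((a - π : ℝ) : ℂ) = -(ρ * (π - a)) := by push_cast; ring
  have e2 : ρ * ((π - a : ℝ) : ℂ) = ρ * (π - a) := by push_cast; ring
  have e3 : ρ * ((2 * a - π : ℝ) : ℂ) = -(ρ * (π - 2 * a)) := by push_cast; ring
  rw [e1, Complex.sin_neg] at w1
  rw [e2] at w2
  rw [e3, Complex.sin_neg] at w3
  have hI : (2 * Complex.I : ℂ) ≠ 0 := by simp
  refine mul_left_cancel₀ hI ?_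
  linear_combination h2 - h1 + h3 - 2 * q a * w1 + 2 * q π * w2
    + 2 * (∫ t in (2 * a)..π, q t * ∫ s in a..(t - a), q s) * w3

lemma four_mul_starOne (ha : 0 < a) (ha2 : 2 * a ≤ π) (ha3 : π ≤ 3 * a) (hq : IsPotential a q)
    (hac : AbsolutelyContinuousOnInterval q a π) (ρ : ℂ) :
    4 * ρ * starOne a q ρ = 2 * (q a - q π) * Complex.cos (ρ * (π - a))
      - 2 * (∫ t in (2 * a)..π, q t * ∫ s in a..(t - a), q s) * Complex.cos (ρ * (π - 2 * a))
      + ∫ ξ in -(π - a)..(π - a), densityR a q ξ * Complex.cos (ρ * ξ) := by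
  have h1 := four_mul_starOne_sub ha ha2 ha3 hq hac ρ
  have h2 := four_mul_starOne_sub ha ha2 ha3 hq hac (-ρ)
  rw [starZero_neg, starOne_neg] at h2
  have h3 := integral_mul_cos (intervalIntegrable_densityR ha ha2 hq hac) ρ
  have w1 := wave_add_wave_neg ρ (a - π)
  have w2 := wave_add_wave_neg ρ (π - a)
  have w3 := wave_add_wave_neg ρ (2 * a - π)
  have e1 : ρ * ((a - π : ℝ) : ℂ) = -(ρ * (π - a)) := by push_cast; ring
  have e2 : ρ * ((π - a : ℝ) : ℂ) = ρ * (π - a) := by push_cast; ring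
  have e3 : ρ * ((2 * a - π : ℝ) : ℂ) = -(ρ * (π - 2 * a)) := by push_cast; ring
  rw [e1, Complex.cos_neg] at w1
  rw [e2] at w2
  rw [e3, Complex.cos_neg] at w3
  refine mul_left_cancel₀ (two_ne_zero (α := ℂ)) ?_
  linear_combination h2 + h1 - h3 + 2 * q a * w1 - 2 * q π * w2
    - 2 * (∫ t in (2 * a)..π, q t * ∫ s in a..(t - a), q s) * w3

end stars

/-! ### Runs of the algorithm -/

section leadingTerms

lemma tendsto_integral_mul_wave_neg_atTop {w : ℝ → ℂ} {α β : ℝ} (hαβ : α ≤ β)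
    (hw : IntervalIntegrable w volume α β) :
    Tendsto (fun ρ : ℝ => ∫ x in α..β, w x * wave (-ρ) x) atTop (𝓝 0) := by
  have h := tendsto_integral_mul_wave hαβ hw (m := fun ρ : ℝ => -ρ) (l := atTop)
    (tendsto_neg_atTop_atBot.mono_right (by rw [cocompact_eq_atBot_atTop]; exact le_sup_left))
    (tendsto_const_nhds (x := (0 : ℂ)))
  simpa using h

lemma tendsto_integral_mul_sin {R : ℝ → ℂ} {α β : ℝ} (hαβ : α ≤ β)
    (hR : IntervalIntegrable R volume α β) :
    Tendsto (fun ρ : ℝ => ∫ ξ in α..β, R ξ * Complex.sin (ρ * ξ)) atTop (𝓝 0) := by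
  have h := ((tendsto_integral_mul_wave_atTop hαβ hR).sub
    (tendsto_integral_mul_wave_neg_atTop hαβ hR)).const_mul (2 * Complex.I)⁻¹
  rw [sub_zero, mul_zero] at h
  refine h.congr fun ρ => ?_
  rw [← integral_mul_sin hR, inv_mul_cancel_left₀ (by simp)]

lemma tendsto_integral_mul_cos {R : ℝ → ℂ} {α β : ℝ} (hαβ : α ≤ β)
    (hR : IntervalIntegrable R volume α β) :
    Tendsto (fun ρ : ℝ => ∫ ξ in α..β, R ξ * Complex.cos (ρ * ξ)) atTop (𝓝 0) := by
  have h := ((tendsto_integral_mul_wave_atTop hαβ hR).add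
    (tendsto_integral_mul_wave_neg_atTop hαβ hR)).const_mul (2 : ℂ)⁻¹
  rw [add_zero, mul_zero] at h
  refine h.congr fun ρ => ?_
  rw [← integral_mul_cos hR, inv_mul_cancel_left₀ two_ne_zero]

lemma eq_zero_of_tendsto_mul_sin {x : ℂ} {α : ℝ} (hα : 0 < α)
    (h : Tendsto (fun ρ : ℝ => x * Complex.sin (ρ * α)) atTop (𝓝 0)) : x = 0 := by
  have h1 : Tendsto (fun n : ℕ => (π / 2 + n * (2 * π)) / α) atTop atTop :=
    (tendsto_atTop_add_const_left _ _
      (tendsto_natCast_atTop_atTop.atTop_mul_const (by positivity))).atTop_div_const hα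
  refine tendsto_nhds_unique (tendsto_const_nhds (f := (atTop : Filter ℕ))) ((h.comp h1).congr fun n => ?_)
  have e : ((((π / 2 + n * (2 * π)) / α : ℝ) : ℂ) * α) = ((π / 2 + n * (2 * π) : ℝ) : ℂ) := by
    rw [← Complex.ofReal_mul, div_mul_cancel₀ _ hα.ne']
  simp only [Function.comp]
  rw [e, ← Complex.ofReal_sin, Real.sin_add_nat_mul_two_pi, Real.sin_pi_div_two, Complex.ofReal_one,
    mul_one]

lemma eq_zero_of_tendsto_mul_cos {x : ℂ} {α : ℝ} (hα : 0 < α)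
    (h : Tendsto (fun ρ : ℝ => x * Complex.cos (ρ * α)) atTop (𝓝 0)) : x = 0 := by
  refine eq_zero_of_tendsto_mul_sin hα
    ((h.comp (tendsto_atTop_add_const_right _ (-(π / 2 / α)) tendsto_id)).congr fun ρ => ?_)
  have : (α : ℂ) ≠ 0 := by exact_mod_cast hα.ne'
  simp only [Function.comp, id]
  rw [← Complex.cos_sub_pi_div_two]
  congr 2
  push_cast
  field_simp
  ring

/-- Two sine waves of different frequencies cannot cancel asymptotically: a combination of shifts
removes one of them. -/
lemma eq_zero_of_tendsto_sin_add_sin {x y : ℂ} {α β : ℝ} (hβ : 0 < β) (hβα : β < α)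
    (h : Tendsto (fun ρ : ℝ => x * Complex.sin (ρ * α) + y * Complex.sin (ρ * β)) atTop (𝓝 0)) :
    x = 0 ∧ y = 0 := by
  have hα : 0 < α := hβ.trans hβα
  set s : ℝ := π / α with hs
  have hsα : s * α = π := div_mul_cancel₀ _ hα.ne'
  have hsβ0 : 0 < s * β := by positivity
  have hsβ : s * β < π := by
    rw [← hsα]
    exact mul_lt_mul_of_pos_left hβα (by positivity)
  have hcos : (-1 - Complex.cos ((s * β : ℝ) : ℂ)) ≠ 0 := by
    have : -1 < Real.cos (s * β) := by
      rw [← Real.cos_pi]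
      exact Real.cos_lt_cos_of_nonneg_of_le_pi hsβ0.le le_rfl hsβ
    rw [← Complex.ofReal_cos]
    have : (-1 - Real.cos (s * β) : ℝ) ≠ 0 := by linarith
    exact_mod_cast this
  have h1 := h.comp (tendsto_atTop_add_const_right _ s tendsto_id)
  have h2 := h.comp (tendsto_atTop_add_const_right _ (-s) tendsto_id)
  have h3 := ((h1.add h2).sub (h.const_mul (2 * Complex.cos ((s * β : ℝ) : ℂ)))).const_mul
    (2 * (-1 - Complex.cos ((s * β : ℝ) : ℂ)))⁻¹
  have hx : x = 0 := by
    refine eq_zero_of_tendsto_mul_sin hα ?_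
    rw [mul_zero, add_zero, sub_zero, mul_zero] at h3
    refine h3.congr fun ρ => ?_
    have e1 : ∀ c : ℝ, Complex.sin (((ρ + s : ℝ) : ℂ) * c) + Complex.sin (((ρ + -s : ℝ) : ℂ) * c)
        = 2 * Complex.cos ((s * c : ℝ) : ℂ) * Complex.sin (ρ * c) := by
      intro c
      push_cast
      rw [add_mul, add_mul, neg_mul, Complex.sin_add, Complex.sin_add, Complex.cos_neg,
        Complex.sin_neg]
      ring
    have eα := e1 α
    have eβ := e1 β
    rw [hsα, ← Complex.ofReal_cos, Real.cos_pi] at eα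
    simp only [Function.comp, id]
    rw [inv_mul_eq_iff_eq_mul₀ (mul_ne_zero two_ne_zero hcos)]
    push_cast at eα eβ ⊢
    linear_combination x * eα + y * eβ
  refine ⟨hx, eq_zero_of_tendsto_mul_sin hβ ?_⟩
  simpa [hx] using h

end leadingTerms

section run

variable {a : ℝ} {q : ℝ → ℂ} {lam : Fin 2 → ℕ → ℂ}

lemma tendsto_prod_zero (ha : 0 < a) (ha2 : 2 * a ≤ π) (ha3 : π ≤ 3 * a) (hq : IsPotential a q)
    (hlam : ∀ j, IsSpectrum a q j (lam j)) (μ : ℂ) :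
    Tendsto (fun N : ℕ => (π : ℂ) * ∏ n ∈ Finset.range N, (lam 0 n - μ) / ((n : ℂ) + 1) ^ 2)
      atTop (𝓝 (characteristicFn a q 0 μ)) := by
  simpa [freeRoot, shift] using tendsto_prod_eigenvalue ha ha2 ha3 hq (hlam 0) μ

lemma tendsto_prod_one (ha : 0 < a) (ha2 : 2 * a ≤ π) (ha3 : π ≤ 3 * a) (hq : IsPotential a q)
    (hlam : ∀ j, IsSpectrum a q j (lam j)) (μ : ℂ) :
    Tendsto (fun N : ℕ => ∏ n ∈ Finset.range N, (lam 1 n - μ) / ((n : ℂ) + 1 / 2) ^ 2)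
      atTop (𝓝 (characteristicFn a q 1 μ)) := by
  have h := tendsto_prod_eigenvalue ha ha2 ha3 hq (hlam 1) μ
  simp only [← cast_add_cons_eq_freeRoot] at h
  simpa using h

lemma quadraticPart_of_mem {x : ℝ} (hx : x ∈ Ioo (3 * a / 2) (π - a / 2)) :
    quadraticPart a q (2 * x - π - a) = q (x + a / 2) * (∫ s in a..(x - a / 2), q s)
      - q (x - a / 2) * (∫ s in (x + a / 2)..π, q s)
      - ∫ s in (x + a / 2)..π, q s * q (s - x + a / 2) := by
  have habs : |2 * x - π - a| < π - 2 * a := by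
    rw [abs_lt]
    constructor <;> linarith [hx.1, hx.2]
  have e1 : (2 * x - π - a) / 2 + π / 2 + a = x + a / 2 := by ring
  have e2 : (2 * x - π - a) / 2 + π / 2 = x - a / 2 := by ring
  have e3 : x - a / 2 + a = x + a / 2 := by ring
  have e4 : x + a / 2 - a = x - a / 2 := by ring
  have e5 : ∀ s, s - (x - a / 2) = s - x + a / 2 := fun s => by ring
  rw [quadraticPart, if_pos habs]
  simp only [e2, e3, e4, e5]

lemma quadraticPart_of_outer {ξ : ℝ}
    (hξ : ξ ∈ Iic (-(π - 2 * a)) ∪ Ici (π - 2 * a)) : quadraticPart a q ξ = 0 := by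
  refine if_neg (not_lt.2 ?_)
  rcases hξ with h | h
  · exact (by linarith [mem_Iic.1 h] : π - 2 * a ≤ -ξ).trans (neg_le_abs ξ)
  · exact (mem_Ici.1 h).trans (le_abs_self ξ)

lemma densityR_affine (x : ℝ) :
    densityR a q (2 * x - π - a) = deriv q x - quadraticPart a q (2 * x - π - a) := by
  have e : (2 * x - π - a) / 2 + π / 2 + a / 2 = x := by ring
  rw [densityR, e]

lemma densityR_outer {x : ℝ} (hx : x ∈ Iic (3 * a / 2) ∪ Ici (π - a / 2)) :
    densityR a q (2 * x - π - a) = deriv q x := by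
  rw [densityR_affine, quadraticPart_of_outer, sub_zero]
  rcases hx with h | h
  · exact Or.inl (mem_Iic.2 (by linarith [mem_Iic.1 h]))
  · exact Or.inr (mem_Ici.2 (by linarith [mem_Ici.1 h]))

/-- The algorithm can be carried out. -/
lemma nonempty_reconstructionRun (ha : 0 < a) (ha2 : 2 * a < π) (ha3 : π ≤ 3 * a)
    (hq : IsPotential a q) (hac : AbsolutelyContinuousOnInterval q a π)
    (hlam : ∀ j, IsSpectrum a q j (lam j)) (i : Fin 2) : Nonempty (ReconstructionRun a lam i) := by
  have haπ : a ≤ π := by linarith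
  have hR := intervalIntegrable_densityR ha ha2.le hq hac
  have hle : -(π - a) ≤ π - a := by linarith
  exact ⟨{
    Δ₀ := characteristicFn a q 0
    Δ₁ := characteristicFn a q 1
    A₀ := ∫ t in a..π, q t
    Δs₀ := starZero a q
    Δs₁ := starOne a q
    A := ∫ t in (2 * a)..π, q t * ∫ s in a..(t - a), q s
    B₁ := 2 * (q a + q π)
    B₂ := 2 * (q a - q π)
    q_a := q a
    q_pi := q π
    d₀ := fun ρ => -∫ ξ in -(π - a)..(π - a), densityR a q ξ * Complex.sin (ρ * ξ)
    d₁ := fun ρ => ∫ ξ in -(π - a)..(π - a), densityR a q ξ * Complex.cos (ρ * ξ)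
    R := densityR a q
    q₀ := densityR a q
    q₁ := deriv q
    q := q
    product₀ := tendsto_prod_zero ha ha2.le ha3 hq hlam
    product₁ := tendsto_prod_one ha ha2.le ha3 hq hlam
    asymptotics := by
      rw [isLittleO_asymptotics_iff, ← integral_cutoff haπ]
      exact tendsto_eigenvalue_asymptotics ha ha2.le ha3 hq (hlam i)
    star₀ := fun _ => rfl
    star₁ := fun _ => rfl
    leading₀ := by
      have h := (tendsto_integral_mul_sin hle hR).neg
      rw [neg_zero] at h
      refine h.congr fun ρ => ?_
      rw [four_mul_starZero ha ha2.le ha3 hq hac]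
      ring
    leading₁ := by
      refine (tendsto_integral_mul_cos hle hR).congr fun ρ => ?_
      rw [four_mul_starOne ha ha2.le ha3 hq hac]
      ring
    q_a_eq := by ring
    q_pi_eq := by ring
    d₀_eq := fun ρ => by
      rw [four_mul_starZero ha ha2.le ha3 hq hac]
      ring
    d₁_eq := fun ρ => by
      rw [four_mul_starOne ha ha2.le ha3 hq hac]
      ring
    R_integrable := (intervalIntegrable_iff_integrableOn_Ioo_of_le hle).1 hR
    sine := fun _ => rfl
    cosine := fun _ => rfl
    q₀_outer := fun _ _ => rfl
    q₁_outer := fun x hx =>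
      (densityR_outer (hx.imp (fun h => mem_Iic.2 h.2.le) fun h => mem_Ici.2 h.1.le)).symm
    q_left := fun x hx => eq_add_integral_deriv hac ⟨hx.1, by linarith [hx.2]⟩
    q_right := fun x hx => eq_sub_integral_deriv hac ⟨by linarith [hx.1], hx.2⟩
    q₁_middle := fun x hx => by
      rw [densityR_affine, quadraticPart_of_mem hx]
      ring
    q_middle := fun x hx =>
      eq_add_integral_deriv hac ⟨by linarith [hx.1], by linarith [hx.2]⟩ }⟩

/-- A sine and a cosine transform determine an integrable function. -/
lemma ae_eq_of_integral_sin_cos {R S : ℝ → ℂ} {α β : ℝ} (hαβ : α ≤ β)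
    (hR : IntervalIntegrable R volume α β) (hS : IntervalIntegrable S volume α β)
    (hsin : ∀ ρ : ℂ, ∫ ξ in α..β, R ξ * Complex.sin (ρ * ξ) = ∫ ξ in α..β, S ξ * Complex.sin (ρ * ξ))
    (hcos : ∀ ρ : ℂ, ∫ ξ in α..β, R ξ * Complex.cos (ρ * ξ) = ∫ ξ in α..β, S ξ * Complex.cos (ρ * ξ)) :
    ∀ᵐ ξ ∂(volume.restrict (Ioo α β)), R ξ = S ξ := by
  have h := ae_eq_zero_of_integral_mul_wave_eq_zero hαβ (hR.sub hS) fun ρ => by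
    have e : ∫ ξ in α..β, (R ξ - S ξ) * wave ρ ξ
        = (∫ ξ in α..β, R ξ * wave ρ ξ) - ∫ ξ in α..β, S ξ * wave ρ ξ := by
      rw [← intervalIntegral.integral_sub (hR.mul_continuousOn (continuous_wave _).continuousOn)
        (hS.mul_continuousOn (continuous_wave _).continuousOn)]
      refine intervalIntegral.integral_congr fun ξ _ => ?_
      ring
    rw [e]
    have s1 := integral_mul_sin hR ρ
    have s2 := integral_mul_sin hS ρ
    have c1 := integral_mul_cos hR ρ
    have c2 := integral_mul_cos hS ρ
    rw [hsin] at s1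
    rw [hcos] at c1
    refine mul_left_cancel₀ (two_ne_zero (α := ℂ)) ?_
    linear_combination s2 - s1 + c2 - c1
  filter_upwards [ae_restrict_of_ae_restrict_of_subset Ioo_subset_Ioc_self h] with ξ hξ
  exact sub_eq_zero.1 hξ

/-- Whenever the last steps of the algorithm are carried out with the correct data, they return the
potential. -/
lemma reconstruction_eq (ha2 : 2 * a < π) (ha5 : 2 * π ≤ 5 * a)
    (hac : AbsolutelyContinuousOnInterval q a π) {i : Fin 2} (r : ReconstructionRun a lam i)
    (hqa : r.q_a = q a) (hqπ : r.q_pi = q π)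
    (hR : ∀ᵐ ξ ∂(volume.restrict (Ioo (-(π - a)) (π - a))), r.R ξ = densityR a q ξ) :
    ∀ x ∈ Icc a π, r.q x = q x := by
  have hR' : ∀ᵐ x : ℝ, x ∈ Ioo a π → r.R (2 * x - π - a) = densityR a q (2 * x - π - a) := by
    rw [ae_restrict_iff' measurableSet_Ioo] at hR
    filter_upwards [ae_comp_affine hR two_ne_zero (-(π + a))] with x hx hm
    have e : 2 * x + -(π + a) = 2 * x - π - a := by ring
    rw [e] at hx
    exact hx ⟨by linarith [hm.1], by linarith [hm.2]⟩
  have hleft : ∀ᵐ x : ℝ, x ∈ Ioo a (3 * a / 2) → r.q₁ x = deriv q x := by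
    filter_upwards [hR'] with x hx hm
    rw [r.q₁_outer x (Or.inl hm), r.q₀_outer _ (Or.inl ⟨by linarith [hm.1], by linarith [hm.2]⟩),
      hx ⟨hm.1, by linarith [hm.2]⟩, densityR_outer (Or.inl hm.2.le)]
  have hright : ∀ᵐ x : ℝ, x ∈ Ioo (π - a / 2) π → r.q₁ x = deriv q x := by
    filter_upwards [hR'] with x hx hm
    rw [r.q₁_outer x (Or.inr hm), r.q₀_outer _ (Or.inr ⟨by linarith [hm.1], by linarith [hm.2]⟩),
      hx ⟨by linarith [hm.1], hm.2⟩, densityR_outer (Or.inr hm.1.le)]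
  have hqleft : ∀ x ∈ Ico a (3 * a / 2), r.q x = q x := by
    intro x hx
    rw [r.q_left x hx, hqa, eq_add_integral_deriv hac ⟨hx.1, by linarith [hx.2]⟩]
    congr 1
    refine intervalIntegral.integral_congr_ae ?_
    filter_upwards [hleft] with t ht hm
    rw [uIoc_of_le hx.1] at hm
    exact ht ⟨hm.1, hm.2.trans_lt hx.2⟩
  have hqright : ∀ x ∈ Ioc (π - a / 2) π, r.q x = q x := by
    intro x hx
    rw [r.q_right x hx, hqπ, eq_sub_integral_deriv hac ⟨by linarith [hx.1], hx.2⟩]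
    congr 1
    refine intervalIntegral.integral_congr_ae ?_
    filter_upwards [hright, compl_mem_ae_iff.2 (measure_singleton π)] with t ht htπ hm
    rw [uIoc_of_le hx.2] at hm
    exact ht ⟨hx.1.trans hm.1, lt_of_le_of_ne hm.2 htπ⟩
  -- for `x` in the middle interval, `x - a/2` and `x + a/2` lie in the outer ones
  have hmid : ∀ᵐ x : ℝ, x ∈ Ioo (3 * a / 2) (π - a / 2) → r.q₁ x = deriv q x := by
    filter_upwards [hR'] with x hx hm
    obtain ⟨hm1, hm2⟩ := hm
    rw [r.q₁_middle x ⟨hm1, hm2⟩, hx ⟨by linarith, by linarith⟩, densityR_affine,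
      quadraticPart_of_mem ⟨hm1, hm2⟩, hqright (x + a / 2) ⟨by linarith, by linarith⟩,
      hqleft (x - a / 2) ⟨by linarith, by linarith⟩]
    have e1 : ∫ s in a..(x - a / 2), r.q s = ∫ s in a..(x - a / 2), q s := by
      refine intervalIntegral.integral_congr fun s hs => ?_
      rw [uIcc_of_le (by linarith)] at hs
      exact hqleft s ⟨hs.1, by linarith [hs.2]⟩
    have e2 : ∫ s in (x + a / 2)..π, r.q s = ∫ s in (x + a / 2)..π, q s := by
      refine intervalIntegral.integral_congr fun s hs => ?_
      rw [uIcc_of_le (by linarith)] at hs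
      exact hqright s ⟨by linarith [hs.1], hs.2⟩
    have e3 : ∫ s in (x + a / 2)..π, r.q s * r.q (s - x + a / 2)
        = ∫ s in (x + a / 2)..π, q s * q (s - x + a / 2) := by
      refine intervalIntegral.integral_congr fun s hs => ?_
      rw [uIcc_of_le (by linarith)] at hs
      rw [hqright s ⟨by linarith [hs.1], hs.2⟩,
        hqleft (s - x + a / 2) ⟨by linarith [hs.1], by linarith [hs.2]⟩]
    rw [e1, e2, e3]
    ring
  intro x hx
  rcases lt_or_ge x (3 * a / 2) with h1 | h1
  · exact hqleft x ⟨hx.1, h1⟩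
  rcases lt_or_ge (π - a / 2) x with h2 | h2
  · exact hqright x ⟨h2, hx.2⟩
  rw [r.q_middle x ⟨h1, h2⟩, hqa, eq_add_integral_deriv hac hx]
  congr 1
  refine intervalIntegral.integral_congr_ae ?_
  filter_upwards [hleft, hmid, compl_mem_ae_iff.2 (measure_singleton (3 * a / 2)),
    compl_mem_ae_iff.2 (measure_singleton (π - a / 2))] with t ht1 ht2 ht3 ht4 hm
  rw [uIoc_of_le hx.1] at hm
  rcases lt_or_gt_of_ne ht3 with h | h
  · exact ht1 ⟨hm.1, h⟩
  · exact ht2 ⟨h, lt_of_le_of_ne (hm.2.trans h2) ht4⟩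

/-- Every quantity computed by the algorithm has the intended value. -/
lemma reconstructionRun_spec (ha : 0 < a) (ha2 : 2 * a < π) (ha5 : 2 * π ≤ 5 * a)
    (hq : IsPotential a q) (hac : AbsolutelyContinuousOnInterval q a π)
    (hlam : ∀ j, IsSpectrum a q j (lam j)) {i : Fin 2} (r : ReconstructionRun a lam i) :
    r.Δ₀ = characteristicFn a q 0 ∧ r.Δ₁ = characteristicFn a q 1 ∧
    r.A₀ = (∫ t in a..π, q t) ∧
    r.A = (∫ t in (2 * a)..π, q t * ∫ s in a..(t - a), q s) ∧
    r.B₁ = 2 * (q a + q π) ∧ r.B₂ = 2 * (q a - q π) ∧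
    (∀ᵐ ξ ∂(volume.restrict (Ioo (-(π - a)) (π - a))), r.R ξ = densityR a q ξ) ∧
    ∀ x ∈ Icc a π, r.q x = q x := by
  have ha3 : π ≤ 3 * a := by linarith
  have haπ : a ≤ π := by linarith
  have hle : -(π - a) ≤ π - a := by linarith
  have hRi := intervalIntegrable_densityR ha ha2.le hq hac
  have hΔ₀ : r.Δ₀ = characteristicFn a q 0 := funext fun μ =>
    tendsto_nhds_unique (r.product₀ μ) (tendsto_prod_zero ha ha2.le ha3 hq hlam μ)
  have hΔ₁ : r.Δ₁ = characteristicFn a q 1 := funext fun μ =>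
    tendsto_nhds_unique (r.product₁ μ) (tendsto_prod_one ha ha2.le ha3 hq hlam μ)
  have hA₀ : r.A₀ = ∫ t in a..π, q t := by
    have h1 := isLittleO_asymptotics_iff.1 r.asymptotics
    have h2 := tendsto_eigenvalue_asymptotics ha ha2.le ha3 hq (hlam i)
    rw [integral_cutoff haπ] at h2
    exact eq_of_eigenvalue_asymptotics ha ha2.le h1 h2
  have hs₀ : ∀ ρ, r.Δs₀ ρ = starZero a q ρ := fun ρ => by
    rw [r.star₀, hΔ₀, hA₀, starZero]
  have hs₁ : ∀ ρ, r.Δs₁ ρ = starOne a q ρ := fun ρ => by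
    rw [r.star₁, hΔ₁, hA₀, starOne]
  have c1 : (((π - a : ℝ) : ℂ)) = π - a := by push_cast; rfl
  have c2 : (((π - 2 * a : ℝ) : ℂ)) = π - 2 * a := by push_cast; rfl
  set A := ∫ t in (2 * a)..π, q t * ∫ s in a..(t - a), q s
  have hlead₀ : Tendsto (fun ρ : ℝ => (r.B₁ - 2 * (q a + q π)) * Complex.sin (ρ * (π - a : ℝ))
      + (-2 * (r.A - A)) * Complex.sin (ρ * (π - 2 * a : ℝ))) atTop (𝓝 0) := by
    have h := ((tendsto_integral_mul_sin hle hRi).add r.leading₀).neg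
    rw [add_zero, neg_zero] at h
    refine h.congr fun ρ => ?_
    rw [hs₀, four_mul_starZero ha ha2.le ha3 hq hac, c1, c2]
    ring
  obtain ⟨hB₁, hA⟩ := eq_zero_of_tendsto_sin_add_sin (by linarith) (by linarith) hlead₀
  have hA' : r.A = A := by
    rw [mul_eq_zero] at hA
    exact sub_eq_zero.1 (hA.resolve_left (by norm_num))
  have hlead₁ : Tendsto (fun ρ : ℝ => (r.B₂ - 2 * (q a - q π)) * Complex.cos (ρ * (π - a : ℝ)))
      atTop (𝓝 0) := by
    have h := (tendsto_integral_mul_cos hle hRi).sub r.leading₁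
    rw [sub_zero] at h
    refine h.congr fun ρ => ?_
    rw [hs₁, four_mul_starOne ha ha2.le ha3 hq hac, c1, hA']
    ring
  have hB₂ := eq_zero_of_tendsto_mul_cos (by linarith) hlead₁
  rw [sub_eq_zero] at hB₁ hB₂
  have hR := ae_eq_of_integral_sin_cos hle
    ((intervalIntegrable_iff_integrableOn_Ioo_of_le hle).2 r.R_integrable) hRi
    (fun ρ => by
      have h := r.sine ρ
      rw [r.d₀_eq, hs₀, four_mul_starZero ha ha2.le ha3 hq hac, hA', hB₁] at h
      linear_combination h)
    (fun ρ => by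
      have h := r.cosine ρ
      rw [r.d₁_eq, hs₁, four_mul_starOne ha ha2.le ha3 hq hac, hA', hB₂] at h
      linear_combination -h)
  refine ⟨hΔ₀, hΔ₁, hA₀, hA', hB₁, hB₂, hR, ?_⟩
  refine reconstruction_eq ha2 ha5 hac r ?_ ?_ hR
  · rw [r.q_a_eq, hB₁, hB₂]
    ring
  · rw [r.q_pi_eq, hB₁, hB₂]
    ring

end run

end DelayInverse

theorem theorem1 (a : ℝ) (ha : a ∈ Ico (2 * π / 5) (π / 2)) :
    -- the two spectra determine the potential
    (∀ q q' : ℝ → ℂ, IsPotential a q → IsPotential a q' →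
      (∀ (j : Fin 2) (μ : ℂ),
        eigenvalueMultiplicity a q j μ = eigenvalueMultiplicity a q' j μ) →
      ∀ᵐ x ∂(volume.restrict (Ioo a π)), q x = q' x) ∧
    -- the algorithm can be carried out, and it returns the potential
    (∀ q : ℝ → ℂ, IsPotential a q → AbsolutelyContinuousOnInterval q a π →
      ∀ lam : Fin 2 → ℕ → ℂ, (∀ j, IsSpectrum a q j (lam j)) →
      ∀ i : Fin 2, Nonempty (ReconstructionRun a lam i) ∧
        ∀ r : ReconstructionRun a lam i,
          r.Δ₀ = characteristicFn a q 0 ∧ r.Δ₁ = characteristicFn a q 1 ∧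
          r.A₀ = (∫ t in a..π, q t) ∧
          r.A = (∫ t in (2 * a)..π, q t * ∫ s in a..(t - a), q s) ∧
          r.B₁ = 2 * (q a + q π) ∧ r.B₂ = 2 * (q a - q π) ∧
          (∀ᵐ ξ ∂(volume.restrict (Ioo (-(π - a)) (π - a))),
            r.R ξ = deriv q (ξ / 2 + π / 2 + a / 2) - quadraticPart a q ξ) ∧
          ∀ x ∈ Icc a π, r.q x = q x) := by
  have hπ := pi_pos
  have ha0 : 0 < a := lt_of_lt_of_le (by positivity) ha.1
  have ha2 : 2 * a < π := by linarith [ha.2]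
  have ha5 : 2 * π ≤ 5 * a := by linarith [ha.1]
  refine ⟨fun q q' hq hq' h => DelayInverse.potential_ae_eq ha0 ha2 ha5 hq hq' h,
    fun q hq hac lam hlam i => ⟨?_, fun r => ?_⟩⟩
  · exact DelayInverse.nonempty_reconstructionRun ha0 ha2 (by linarith) hq hac hlam i
  · exact DelayInverse.reconstructionRun_spec ha0 ha2 ha5 hq hac hlam r
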